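/- **Theorem.** Let $\mathcal L\in\{\mathcal{EL}_\bot,\mathcal{ELI}_\bot\}$. The consistent $\mathcal L$-ontology fitting problem, defined as follows, is in PTime (decidable by a deterministic Turing machine in time polynomial in the length of the input). *Syntax.* Let $\mathsf{N_C},\mathsf{N_R},\mathsf{N_I}$ be countably infinite sets of concept, role and individual names. A role is a role name $r$ or an inverse role $r^-$. $\mathcal{ELI}_\bot$-concepts are given by $C,D::=\top\mid\bot\mid A\mid C\sqcap D\mid\exists R.C$ with $A\in\mathsf{N_C}$ and $R$ a role; $\mathcal{EL}_\bot$-concepts are those without inverse roles. An $\mathcal L$-ontology is a finite set of inclusions $C\sqsubseteq D$ between $\mathcal L$-concepts. An ABox is a finite nonempty set of assertions $A(a)$ and $r(a,b)$ with $A\in\mathsf{N_C}$, $r\in\mathsf{N_R}$, $a,b\in\mathsf{N_I}$. *Semantics.* An interpretation $\mathcal I$ consists of a nonempty set $\Delta^{\mathcal I}$, a set $A^{\mathcal I}\subseteq\Delta^{\mathcal I}$ for each $A\in\mathsf{N_C}$ and a relation $r^{\mathcal I}\subseteq\Delta^{\mathcal I}\times\Delta^{\mathcal I}$ for each $r\in\mathsf{N_R}$;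 $(r^-)^{\mathcal I}$ is the converse of $r^{\mathcal I}$, and concepts are interpreted by $\top^{\mathcal I}=\Delta^{\mathcal I}$, $\bot^{\mathcal I}=\emptyset$, $(C\sqcap D)^{\mathcal I}=C^{\mathcal I}\cap D^{\mathcal I}$, $(\exists R.C)^{\mathcal I}=\{d\mid \exists e\in C^{\mathcal I}: (d,e)\in R^{\mathcal I}\}$. It is a model of an ontology if $C^{\mathcal I}\subseteq D^{\mathcal I}$ for each of its inclusions $C\sqsubseteq D$, and a model of an ABox if $a\in A^{\mathcal I}$ for each of its assertions $A(a)$ and $(a,b)\in r^{\mathcal I}$ for each of its assertions $r(a,b)$ (individual names denote themselves). An ABox is consistent with an ontology if the two have a common model. *Problem.* Input: a pair $E=(E^+,E^-)$ of finite sets of ABoxes, written as a word over a fixed finite alphabet by listing, in any order and possibly with repetitions, the ABoxes with their labels and the assertions of each ABox, where names are binary strings. Question: is there an $\mathcal L$-ontology that is consistent with every ABox in $E^+$ and inconsistent with every ABox in $E^-$? -/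

import Mathlib

namespace OntologyFitting

/-! ### Names, roles, concepts, ontologies

The three countably infinite supplies of names are three copies of the set of binary strings;
they are kept apart by the positions in which they occur. -/

abbrev ConceptName : Type := List Bool

abbrev RoleName : Type := List Bool

abbrev IndName : Type := List Bool

/-- A role is a role name `r` or an inverse role `r⁻`. -/
inductive Role : Type
  | name (r : RoleName)
  | inv (r : RoleName)
  deriving DecidableEq

/-- The concepts of the description logic `ELI⊥`. -/
inductive Concept : Type
  | top
  | bot
  | atom (A : ConceptName)
  | conj (C D : Concept)
  | ex (r : Role) (C : Concept)
  deriving DecidableEq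

/-- The concept uses no inverse role, that is, it is an `EL⊥`-concept. -/
def Concept.NoInverse : Concept → Prop
  | .top => True
  | .bot => True
  | .atom _ => True
  | .conj C D => C.NoInverse ∧ D.NoInverse
  | .ex (.name _) C => C.NoInverse
  | .ex (.inv _) _ => False

/-- The two description logics `EL⊥` and `ELI⊥`. -/
inductive DL : Type
  | ELbot
  | ELIbot

/-- The concepts that belong to a given description logic. -/
def DL.IsConcept : DL → Concept → Prop
  | .ELbot, C => C.NoInverse
  | .ELIbot, _ => True

/-- A concept inclusion `lhs ⊑ rhs`. -/
structure ConceptInclusion : Type where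
  lhs : Concept
  rhs : Concept
  deriving DecidableEq

/-- An `L`-ontology: a finite set of inclusions between `L`-concepts. -/
structure Ontology (L : DL) : Type where
  inclusions : Finset ConceptInclusion
  isConcept : ∀ i ∈ inclusions, L.IsConcept i.lhs ∧ L.IsConcept i.rhs

/-! ### ABoxes -/

/-- Concept assertions `A(a)` and role assertions `r(a,b)`. -/
inductive Assertion : Type
  | concept (A : ConceptName) (a : IndName)
  | role (r : RoleName) (a b : IndName)
  deriving DecidableEq

/-- An ABox is a finite and nonempty set of assertions. -/
abbrev ABox : Type := {A : Finset Assertion // A.Nonempty}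

/-! ### Semantics -/

/-- An interpretation: a nonempty domain, each of whose elements is either an individual name or
one of any other objects (taken from the type `Other`), a subset of the domain for every concept
name, and a binary relation on the domain for every role name. -/
structure Interpretation : Type 1 where
  Other : Type
  domain : Set (IndName ⊕ Other)
  domain_nonempty : domain.Nonempty
  concept : ConceptName → Set (IndName ⊕ Other)
  concept_subset : ∀ A, concept A ⊆ domain
  role : RoleName → Set ((IndName ⊕ Other) × (IndName ⊕ Other))
  role_subset : ∀ r, role r ⊆ domain ×ˢ domain

namespace Interpretation

/-- The extension of a role; `r⁻` denotes the converse of `r`. -/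
def roleExt (I : Interpretation) : Role → Set ((IndName ⊕ I.Other) × (IndName ⊕ I.Other))
  | .name r => I.role r
  | .inv r => {p | (p.2, p.1) ∈ I.role r}

/-- The extension of a concept. -/
def ext (I : Interpretation) : Concept → Set (IndName ⊕ I.Other)
  | .top => I.domain
  | .bot => ∅
  | .atom A => I.concept A
  | .conj C D => I.ext C ∩ I.ext D
  | .ex r C => {d | ∃ e, (d, e) ∈ I.roleExt r ∧ e ∈ I.ext C}

/-- Satisfaction of an assertion, under the standard names assumption: an individual name that
is used in an assertion denotes itself. -/
def SatAssertion (I : Interpretation) : Assertion → Prop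
  | .concept A a => Sum.inl a ∈ I.concept A
  | .role r a b => (Sum.inl a, Sum.inl b) ∈ I.role r

def IsModelOfABox (I : Interpretation) (A : ABox) : Prop :=
  ∀ α ∈ A.1, I.SatAssertion α

def IsModelOfOntology (I : Interpretation) {L : DL} (O : Ontology L) : Prop :=
  ∀ i ∈ O.inclusions, I.ext i.lhs ⊆ I.ext i.rhs

end Interpretation

/-- The ABox and the ontology have a common model. -/
def Consistent {L : DL} (A : ABox) (O : Ontology L) : Prop :=
  ∃ I : Interpretation, I.IsModelOfABox A ∧ I.IsModelOfOntology O

/-! ### The fitting problem -/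

/-- A collection of labeled examples: a finite set of positive ABoxes and a finite set of
negative ABoxes. -/
structure LabeledExamples : Type where
  pos : Finset ABox
  neg : Finset ABox

/-- The ontology is consistent with all positive and inconsistent with all negative ABoxes. -/
def Fits {L : DL} (O : Ontology L) (E : LabeledExamples) : Prop :=
  (∀ A ∈ E.pos, Consistent A O) ∧ (∀ A ∈ E.neg, ¬ Consistent A O)

def AdmitsFitting (L : DL) (E : LabeledExamples) : Prop :=
  ∃ O : Ontology L, Fits O E

/-! ### Collections of examples as words

A set is written down by listing its elements in any order, possibly with repetitions. -/

/-- The input alphabet: the two bits, of which names consist, a marker for each kind of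
assertion, a separator, and a marker for each of the two labels. -/
inductive Sym : Type
  | bit (b : Bool)
  | conceptMark
  | roleMark
  | comma
  | posMark
  | negMark
  deriving DecidableEq, Fintype

def encodeName (n : List Bool) : List Sym :=
  n.map Sym.bit

def encodeAssertion : Assertion → List Sym
  | .concept A a => Sym.conceptMark :: encodeName A ++ Sym.comma :: encodeName a
  | .role r a b =>
      Sym.roleMark :: encodeName r ++ Sym.comma :: encodeName a ++ Sym.comma :: encodeName b

/-- The word for one labeled example (`true` means positive): its label, followed by its
assertions. -/
def encodeExample (x : Bool × List Assertion) : List Sym :=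
  (if x.1 then Sym.posMark else Sym.negMark) :: x.2.flatMap encodeAssertion

/-- The word `w` is a description of the collection `E`. -/
def Describes (w : List Sym) (E : LabeledExamples) : Prop :=
  ∃ xs : List (Bool × List Assertion),
    w = xs.flatMap encodeExample ∧
    (∀ x ∈ xs, x.2 ≠ []) ∧
    (∀ A : ABox, A ∈ E.pos ↔ ∃ x ∈ xs, x.1 = true ∧ x.2.toFinset = A.1) ∧
    (∀ A : ABox, A ∈ E.neg ↔ ∃ x ∈ xs, x.1 = false ∧ x.2.toFinset = A.1)

/-- The consistent `L`-ontology fitting problem, as a set of words. -/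
def ConsistentFittingProblem (L : DL) : Language Sym :=
  {w | ∃ E : LabeledExamples, Describes w E ∧ AdmitsFitting L E}

/-! ### Polynomial time -/

/-- The class PTime: some Turing machine halts on every word `w` over the finite alphabet after
a number of steps that is at most a fixed polynomial in the length of `w`, and outputs `true` if
`w` belongs to the language and `false` otherwise. -/
def InPTime {Γ : Type} [Fintype Γ] (X : Language Γ) : Prop :=
  ∃ f : List Γ → Bool, (∀ w, f w = true ↔ w ∈ X) ∧
    Nonempty (Turing.TM2ComputableInPolyTime (id : List Γ → List Γ) Computability.encodeBool f)

end OntologyFitting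

/-! A fitting exists iff every negative ABox has an individual that is simulated by no individual of
any positive ABox (`admitsFitting_iff`). Simulations respect concept names and successors and, for
ELI⊥, also predecessors.

Suppose such individuals exist. Since everything is finite, each of them satisfies, in its own ABox,
a concept `C` that is empty in every positive ABox read as an interpretation
(`exists_separating_concept`). The inclusions `C ⊑ ⊥` form a fitting: each positive ABox is its own
model, while concepts are preserved from an ABox to all its models, so the negative ABoxes have
none. Conversely, suppose that an ontology is consistent with all positive ABoxes and that every
individual of an ABox `A` is simulated in some of them. From the disjoint union of models of the
positive ABoxes, build an interpretation whose elements stand for nonempty sets of elements of that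
union, such that a concept holds at a set iff it holds at all its members (`mem_ext_powerModel`).
All inclusions survive, and if an individual of `A` stands for the set of individuals simulating it,
this is a model of `A` (`consistent_of_simulated`).

Non-simulation is a least fixed point: a pair is separated once a concept name, a successor or (for
ELI⊥) a predecessor of the first individual has no counterpart at the second, where separated
neighbours do not count as counterparts. Individuals are represented by positions in the input word,
so for length `n` there are at most `n * n` pairs, and as many rounds reach the fixed point
(`stages_closed`). One round and the final test are fixed first-order formulas over positions with a
variable for the current relation (`Fm.eval_step`, `Fm.eval_final`).

A fixed formula is evaluated in polynomial time with one head per variable and a table of `n * n`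
bits; a quantifier is a loop over the word (`Fm.realizes`). The program is written in a structured
language on stacks with timed semantics and compiled to a Turing machine (`steps_code`,
`inPTime_of_formulas`). -/

namespace OntologyFitting

/-! ### Structured programs on stacks -/

section StackPrograms

variable {K : Type} [DecidableEq K] {Γ : K → Type}

/-- The contents of all stacks. -/
abbrev Store (Γ : K → Type) : Type := ∀ k, List (Γ k)

/-- The topmost symbols of all stacks. -/
abbrev Tops (Γ : K → Type) : Type := ∀ k, Option (Γ k)

def tops (S : Store Γ) : Tops Γ := fun k => (S k).head?

/-- Elementary operations; the symbol to be pushed may depend on the topmost symbols. -/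
inductive Op (Γ : K → Type) : Type
  | pop (k : K)
  | push (k : K) (f : Tops Γ → Γ k)

/-- `t` stays fixed while the stacks change: the machine reads all tops once and then executes the
whole list within the same step. -/
def runOps (t : Tops Γ) : List (Op Γ) → Store Γ → Store Γ
  | [], S => S
  | .pop k :: os, S => runOps t os (Function.update S k (S k).tail)
  | .push k f :: os, S => runOps t os (Function.update S k (f t :: S k))

/-- Structured programs: all operations in an `act` see the topmost symbols from before
the `act`. -/
inductive Cmd (Γ : K → Type) : Type
  | act (os : List (Op Γ))
  | seq (c d : Cmd Γ)
  | ite (p : Tops Γ → Bool) (c d : Cmd Γ)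
  | loop (p : Tops Γ → Bool) (c : Cmd Γ)

/-- Big-step semantics with running time. -/
inductive Run : Cmd Γ → Store Γ → Store Γ → ℕ → Prop
  | act (os S) : Run (.act os) S (runOps (tops S) os S) 1
  | seq {c d S S' S'' t t'} : Run c S S' t → Run d S' S'' t' → Run (.seq c d) S S'' (t + t')
  | iteTrue {p c d S S' t} : p (tops S) = true → Run c S S' t → Run (.ite p c d) S S' (1 + t)
  | iteFalse {p c d S S' t} : p (tops S) = false → Run d S S' t → Run (.ite p c d) S S' (1 + t)
  | loopDone {p c S} : p (tops S) = false → Run (.loop p c) S S 1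
  | loopStep {p c S S' S'' t t'} : p (tops S) = true → Run c S S' t → Run (.loop p c) S' S'' t' →
      Run (.loop p c) S S'' (1 + t + t')

namespace Cmd

/-- The labels of the machine code of a program. -/
def Lab : Cmd Γ → Type
  | act _ => Unit
  | seq c d => c.Lab ⊕ d.Lab
  | ite _ c d => Option (c.Lab ⊕ d.Lab)
  | loop _ c => Option c.Lab

def entry : (c : Cmd Γ) → c.Lab
  | act _ => ()
  | seq c _ => Sum.inl c.entry
  | ite _ _ _ => none
  | loop _ _ => none

@[reducible] noncomputable def fintypeLab : (c : Cmd Γ) → Fintype c.Lab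
  | act _ => inferInstanceAs (Fintype Unit)
  | seq c d => @instFintypeSum _ _ c.fintypeLab d.fintypeLab
  | ite _ c d => @instFintypeOption _ (@instFintypeSum _ _ c.fintypeLab d.fintypeLab)
  | loop _ c => @instFintypeOption _ c.fintypeLab

end Cmd

open Turing

/-- Read the topmost symbols of the listed stacks into the internal state. -/
def readTops {Λ : Type} : List K → TM2.Stmt Γ Λ (Tops Γ) → TM2.Stmt Γ Λ (Tops Γ)
  | [], q => q
  | k :: ks, q => .peek k (fun x o => Function.update x k o) (readTops ks q)

def opsStmt {Λ : Type} : List (Op Γ) → TM2.Stmt Γ Λ (Tops Γ) → TM2.Stmt Γ Λ (Tops Γ)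
  | [], q => q
  | .pop k :: os, q => .pop k (fun x _ => x) (opsStmt os q)
  | .push k f :: os, q => .push k f (opsStmt os q)

theorem stepAux_readTops {Λ : Type} (ks : List K) (q : TM2.Stmt Γ Λ (Tops Γ)) (x : Tops Γ)
    (S : Store Γ) :
    TM2.stepAux (readTops ks q) x S =
      TM2.stepAux q (fun k => if k ∈ ks then tops S k else x k) S := by
  induction ks generalizing x with
  | nil => simp [readTops]
  | cons k ks ih =>
    simp only [readTops, TM2.stepAux, ih]
    congr 1
    funext j
    by_cases hj : j ∈ ks
    · simp [hj]
    · by_cases hk : j = k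
      · subst hk; simp [hj, tops]
      · simp [hj, hk]

theorem stepAux_opsStmt {Λ : Type} (os : List (Op Γ)) (q : TM2.Stmt Γ Λ (Tops Γ)) (x : Tops Γ)
    (S : Store Γ) :
    TM2.stepAux (opsStmt os q) x S = TM2.stepAux q x (runOps x os S) := by
  induction os generalizing S with
  | nil => rfl
  | cons o os ih => cases o <;> simp [opsStmt, runOps, TM2.stepAux, ih]

/-- `t` steps of a machine. -/
def steps {Λ : Type} (M : Λ → TM2.Stmt Γ Λ (Tops Γ)) (t : ℕ) :
    Option (TM2.Cfg Γ Λ (Tops Γ)) → Option (TM2.Cfg Γ Λ (Tops Γ)) :=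
  (flip bind (TM2.step M))^[t]

theorem steps_add {Λ : Type} (M : Λ → TM2.Stmt Γ Λ (Tops Γ)) (t t' : ℕ)
    (a : Option (TM2.Cfg Γ Λ (Tops Γ))) : steps M (t + t') a = steps M t' (steps M t a) := by
  simp only [steps]
  rw [add_comm, Function.iterate_add_apply]

theorem steps_one {Λ : Type} (M : Λ → TM2.Stmt Γ Λ (Tops Γ)) (l : Λ) (x : Tops Γ) (S : Store Γ) :
    steps M 1 (some ⟨some l, x, S⟩) = some (TM2.stepAux (M l) x S) := rfl

variable [Fintype K]

noncomputable def readAll {Λ : Type} (q : TM2.Stmt Γ Λ (Tops Γ)) : TM2.Stmt Γ Λ (Tops Γ) :=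
  readTops Finset.univ.toList q

theorem stepAux_readAll {Λ : Type} (q : TM2.Stmt Γ Λ (Tops Γ)) (x : Tops Γ) (S : Store Γ) :
    TM2.stepAux (readAll q) x S = TM2.stepAux q (tops S) S := by
  simp [readAll, stepAux_readTops]

/-- Machine code of a program, with its labels embedded in a larger set of labels; control
leaves the code for the label `exit`. -/
noncomputable def Cmd.code : (c : Cmd Γ) → {Λ : Type} → (c.Lab → Λ) → (exit : Λ) → c.Lab →
    TM2.Stmt Γ Λ (Tops Γ)
  | .act os, _, _, exit, _ => readAll (opsStmt os (.goto fun _ => exit))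
  | .seq c d, _, emb, exit, l =>
      match l with
      | .inl l => c.code (fun a => emb (.inl a)) (emb (.inr d.entry)) l
      | .inr l => d.code (fun a => emb (.inr a)) exit l
  | .ite p c d, _, emb, exit, l =>
      match l with
      | none => readAll (.branch p (.goto fun _ => emb (some (.inl c.entry)))
          (.goto fun _ => emb (some (.inr d.entry))))
      | some (.inl l) => c.code (fun a => emb (some (.inl a))) exit l
      | some (.inr l) => d.code (fun a => emb (some (.inr a))) exit l
  | .loop p c, _, emb, exit, l =>
      match l with
      | none => readAll (.branch p (.goto fun _ => emb (some c.entry)) (.goto fun _ => exit))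
      | some l => c.code (fun a => emb (some a)) (emb none) l

/-- Every block of code begins by rereading all tops, so the internal state on entry is irrelevant
and blocks can be chained. Embedding and exit label are arbitrary because a subprogram sits inside
the labels of a larger one. -/
theorem steps_code {c : Cmd Γ} {S S' : Store Γ} {t : ℕ} (h : Run c S S' t) {Λ : Type}
    (M : Λ → TM2.Stmt Γ Λ (Tops Γ)) (emb : c.Lab → Λ) (exit : Λ)
    (hM : ∀ l, M (emb l) = c.code emb exit l) (x : Tops Γ) :
    ∃ x', steps M t (some ⟨some (emb c.entry), x, S⟩) = some ⟨some exit, x', S'⟩ := by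
  induction h generalizing exit x with
  | act os S =>
    refine ⟨tops S, ?_⟩
    rw [steps_one, hM, Cmd.code, stepAux_readAll, stepAux_opsStmt]
    rfl
  | seq hc hd ihc ihd =>
    obtain ⟨y, hy⟩ := ihc (fun a => emb (.inl a)) _ (fun l => hM (.inl l)) x
    obtain ⟨z, hz⟩ := ihd (fun a => emb (.inr a)) _ (fun l => hM (.inr l)) y
    exact ⟨z, by rw [steps_add, ← hz, ← hy]; rfl⟩
  | @iteTrue p c d S S' t hp hc ihc =>
    obtain ⟨y, hy⟩ := ihc (fun a => emb (some (.inl a))) exit (fun l => hM (some (.inl l))) (tops S)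
    refine ⟨y, ?_⟩
    rw [steps_add, steps_one, hM, ← hy]
    simp only [Cmd.entry, Cmd.code, stepAux_readAll, TM2.stepAux, hp, cond_true]
  | @iteFalse p c d S S' t hp hc ihc =>
    obtain ⟨y, hy⟩ := ihc (fun a => emb (some (.inr a))) exit (fun l => hM (some (.inr l))) (tops S)
    refine ⟨y, ?_⟩
    rw [steps_add, steps_one, hM, ← hy]
    simp only [Cmd.entry, Cmd.code, stepAux_readAll, TM2.stepAux, hp, cond_false]
  | @loopDone p c S hp =>
    refine ⟨tops S, ?_⟩
    rw [steps_one, hM]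
    simp only [Cmd.entry, Cmd.code, stepAux_readAll, TM2.stepAux, hp, cond_false]
  | @loopStep p c S S' S'' t t' hp hc hd ihc ihd =>
    obtain ⟨y, hy⟩ := ihc (fun a => emb (some a)) (emb none) (fun l => hM (some l)) (tops S)
    obtain ⟨z, hz⟩ := ihd emb exit hM y
    refine ⟨z, ?_⟩
    rw [steps_add, steps_add, steps_one, hM, ← hz]
    congr 1
    simp only [Cmd.entry, Cmd.code, stepAux_readAll, TM2.stepAux, hp, cond_true]
    exact hy

/-- The Turing machine that runs a program. -/
noncomputable def Cmd.machine [∀ k, Fintype (Γ k)] (c : Cmd Γ) (k₀ k₁ : K) : FinTM2 :=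
  letI := c.fintypeLab
  { K := K
    k₀ := k₀
    k₁ := k₁
    Γ := Γ
    Λ := Option c.Lab
    main := some c.entry
    σ := Tops Γ
    initialState := fun _ => none
    m := fun l => match l with
      -- A halting configuration that counts as output has the initial internal state, so the exit
      -- label restores it; this costs the additional step in `Run.outputs`.
      | none => .load (fun _ _ => none) .halt
      | some l => c.code some none l }

theorem Run.outputs [∀ k, Fintype (Γ k)] {c : Cmd Γ} {k₀ k₁ : K} {inp : List (Γ k₀)}
    {out : List (Γ k₁)} {t m : ℕ}
    (h : Run c (initList (c.machine k₀ k₁) inp).stk (haltList (c.machine k₀ k₁) out).stk t)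
    (ht : t + 1 ≤ m) : Nonempty (TM2OutputsInTime (c.machine k₀ k₁) inp (some out) m) := by
  obtain ⟨x, hx⟩ := steps_code h (c.machine k₀ k₁).m some none (fun l => rfl) (fun _ => none)
  exact ⟨⟨⟨t + 1, (steps_add _ t 1 _).trans ((congrArg _ hx).trans rfl)⟩, ht⟩⟩

end StackPrograms

/-! ### Families of polynomial-time runs -/

section Realizes

variable {K : Type} [DecidableEq K] {Γ : K → Type} {ι : Type}

/-- The program turns `S i` into `S' i` for all `i`, in time polynomial in `n i`. -/
def Realizes (c : Cmd Γ) (n : ι → ℕ) (S S' : ι → Store Γ) : Prop :=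
  ∃ q : Polynomial ℕ, ∀ i, ∃ t ≤ q.eval (n i), Run c (S i) (S' i) t

variable {n : ι → ℕ} {S S' S'' : ι → Store Γ} {c d : Cmd Γ}

theorem Realizes.act {os : List (Op Γ)} (h : ∀ i, runOps (tops (S i)) os (S i) = S' i) :
    Realizes (.act os) n S S' :=
  ⟨1, fun i => ⟨1, by simp, h i ▸ Run.act os (S i)⟩⟩

theorem Realizes.seq (hc : Realizes c n S S') (hd : Realizes d n S' S'') :
    Realizes (.seq c d) n S S'' := by
  obtain ⟨q, hq⟩ := hc
  obtain ⟨q', hq'⟩ := hd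
  refine ⟨q + q', fun i => ?_⟩
  obtain ⟨t, ht, h⟩ := hq i
  obtain ⟨t', ht', h'⟩ := hq' i
  exact ⟨t + t', by simpa using Nat.add_le_add ht ht', h.seq h'⟩

theorem Realizes.iteAct {p : Tops Γ → Bool} {os os' : List (Op Γ)}
    (h : ∀ i, p (tops (S i)) = true → runOps (tops (S i)) os (S i) = S' i)
    (h' : ∀ i, p (tops (S i)) = false → runOps (tops (S i)) os' (S i) = S' i) :
    Realizes (.ite p (.act os) (.act os')) n S S' := by
  refine ⟨2, fun i => ⟨2, by simp, ?_⟩⟩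
  cases hp : p (tops (S i))
  · exact Run.iteFalse hp (h' i hp ▸ Run.act os' (S i))
  · exact Run.iteTrue hp (h i hp ▸ Run.act os (S i))

theorem Realizes.congr {S₁ S₁' : ι → Store Γ} (h : Realizes c n S S') (hS : ∀ i, S i = S₁ i)
    (hS' : ∀ i, S' i = S₁' i) : Realizes c n S₁ S₁' := by
  rw [← funext hS, ← funext hS']
  exact h

/-- Each of the `N` rounds costs one test plus at most `b`; the last summand is the failing test. -/
theorem Run.loop {p : Tops Γ → Bool} {inv : ℕ → Store Γ} {N b : ℕ}
    (hp : ∀ k < N, p (tops (inv k)) = true) (hN : p (tops (inv N)) = false)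
    (hc : ∀ k < N, ∃ t ≤ b, Run c (inv k) (inv (k + 1)) t) :
    ∃ t ≤ N * (1 + b) + 1, Run (.loop p c) (inv 0) (inv N) t := by
  induction N generalizing inv with
  | zero => exact ⟨1, by simp, Run.loopDone hN⟩
  | succ N ih =>
    obtain ⟨t', ht', h'⟩ := ih (inv := fun k => inv (k + 1)) (fun k hk => hp _ (by omega)) hN
      (fun k hk => hc _ (by omega))
    obtain ⟨t, ht, h⟩ := hc 0 (by omega)
    exact ⟨1 + t + t', by rw [Nat.succ_mul]; omega, Run.loopStep (hp 0 (by omega)) h h'⟩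

/-- The body is treated as a single family indexed by instance and round, so one polynomial bounds
all rounds of all instances. -/
theorem Realizes.loop {p : Tops Γ → Bool} (N : ι → ℕ) (inv : ι → ℕ → Store Γ)
    (bound : Polynomial ℕ) (hb : ∀ i, N i ≤ bound.eval (n i))
    (h0 : ∀ i, inv i 0 = S i) (hN : ∀ i, inv i (N i) = S' i)
    (hp : ∀ i, ∀ k < N i, p (tops (inv i k)) = true)
    (hp' : ∀ i, p (tops (inv i (N i))) = false)
    (hc : Realizes c (fun x : {x : ι × ℕ // x.2 < N x.1} => n x.1.1)
      (fun x => inv x.1.1 x.1.2) (fun x => inv x.1.1 (x.1.2 + 1))) :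
    Realizes (.loop p c) n S S' := by
  obtain ⟨q, hq⟩ := hc
  refine ⟨bound * (1 + q) + 1, fun i => ?_⟩
  obtain ⟨t, ht, h⟩ := Run.loop (c := c) (hp i) (hp' i) (b := q.eval (n i))
    (fun k hk => hq ⟨(i, k), hk⟩)
  rw [h0, hN] at h
  refine ⟨t, ht.trans ?_, h⟩
  simp only [Polynomial.eval_add, Polynomial.eval_mul, Polynomial.eval_one]
  gcongr
  exact hb i

/-- Empty a stack. -/
def clear (k : K) : Cmd Γ := .loop (fun t => (t k).isSome) (.act [.pop k])

theorem Realizes.clear (k : K) (bound : Polynomial ℕ)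
    (hb : ∀ i, (S i k).length ≤ bound.eval (n i)) :
    Realizes (clear k) n S (fun i => Function.update (S i) k []) := by
  refine Realizes.loop (fun i => (S i k).length)
    (fun i j => Function.update (S i) k ((S i k).drop j)) bound hb (by simp) (by simp) ?_ ?_ ?_
  · intro i j hj
    simp [tops, hj]
  · intro i
    simp [tops]
  · refine Realizes.act fun x => ?_
    simp [runOps]

def clearAll : List K → Cmd Γ
  | [] => .act []
  | k :: ks => .seq (clear k) (clearAll ks)

theorem Realizes.clearAll (ks : List K) (bound : Polynomial ℕ)
    (hb : ∀ i k, (S i k).length ≤ bound.eval (n i)) :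
    Realizes (clearAll ks) n S (fun i k => if k ∈ ks then [] else S i k) := by
  induction ks generalizing S with
  | nil => exact Realizes.act fun i => by simp [runOps]
  | cons k ks ih =>
    refine (Realizes.clear k bound fun i => hb i k).seq ((ih fun i j => ?_).congr (fun _ => rfl) ?_)
    · by_cases h : j = k
      · subst h; simp
      · simpa [h] using hb i j
    · intro i
      funext j
      by_cases h : j = k
      · subst h; simp
      · simp [h]

end Realizes

/-! ### Memory: a word with several heads, a table of bits, and some auxiliary stacks -/

/-- The heads on the input word. -/
abbrev Var : Type := Fin 12

/-- States of the automaton that recognizes well-formed words. -/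
inductive WfState : Type
  | start
  | label
  | conceptName
  | roleName
  | source
  | last
  | dead
  deriving DecidableEq

instance : Fintype WfState :=
  ⟨{.start, .label, .conceptName, .roleName, .source, .last, .dead}, by intro x; cases x <;> decide⟩

inductive Stk : Type
  | inp
  | out
  | left (i : Var)
  | right (i : Var)
  | bits
  | counter
  | tabLeft
  | tabRight
  | tabNew
  | states
  deriving DecidableEq, Fintype

abbrev Alph : Stk → Type
  | .inp => Sym
  | .out => Bool
  | .left _ => Sym
  | .right _ => Sym
  | .bits => Bool
  | .counter => Unit
  | .tabLeft => Bool
  | .tabRight => Bool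
  | .tabNew => Bool
  | .states => WfState

instance (k : Stk) : Fintype (Alph k) := by
  cases k <;> exact inferInstance

@[ext]
structure Mem : Type where
  inp : List Sym
  out : List Bool
  /-- The positions of the heads. -/
  pos : Var → ℕ
  bits : List Bool
  counter : ℕ
  table : List Bool
  tabPos : ℕ
  tabNew : List Bool
  states : List WfState

/-- Move a head. -/
def Mem.set (m : Mem) (i : Var) (p : ℕ) : Mem := { m with pos := Function.update m.pos i p }

/-- The representation of a memory by stacks; `w` is the word below the heads. -/
def stk (w : List Sym) (m : Mem) : Store Alph
  | .inp => m.inp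
  | .out => m.out
  | .left i => (w.take (m.pos i)).reverse
  | .right i => w.drop (m.pos i)
  | .bits => m.bits
  | .counter => List.replicate m.counter ()
  | .tabLeft => (m.table.take m.tabPos).reverse
  | .tabRight => m.table.drop m.tabPos
  | .tabNew => m.tabNew
  | .states => m.states

def moveRight (i : Var) : List (Op Alph) :=
  [.push (.left i) (fun t => (t (.right i)).getD Sym.comma), .pop (.right i)]

def moveLeft (i : Var) : List (Op Alph) :=
  [.push (.right i) (fun t => (t (.left i)).getD Sym.comma), .pop (.left i)]

theorem List.reverse_take_succ {α : Type} (l : List α) {k : ℕ} (h : k < l.length) :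
    (l.take (k + 1)).reverse = l[k] :: (l.take k).reverse := by
  rw [List.take_succ_eq_append_getElem h]
  simp

theorem List.head?_drop_of_lt {α : Type} (l : List α) {k : ℕ} (h : k < l.length) :
    (l.drop k).head? = some l[k] := by
  rw [List.drop_eq_getElem_cons h]
  rfl

theorem List.head?_reverse_take_succ {α : Type} (l : List α) {k : ℕ} (h : k < l.length) :
    (l.take (k + 1)).reverse.head? = some l[k] := by
  rw [List.reverse_take_succ l h]
  rfl

theorem runOps_moveRight {w : List Sym} {m : Mem} {i : Var} (h : m.pos i < w.length) :
    runOps (tops (stk w m)) (moveRight i) (stk w m) = stk w (m.set i (m.pos i + 1)) := by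
  funext k
  cases k with
  | left j =>
    by_cases hj : j = i
    · subst hj
      simp [runOps, moveRight, stk, Mem.set, tops, -List.head?_drop, List.head?_drop_of_lt w h,
        List.reverse_take_succ w h]
    · simp [runOps, moveRight, stk, Mem.set, hj]
  | right j =>
    by_cases hj : j = i
    · subst hj
      simp [runOps, moveRight, stk, Mem.set]
    · simp [runOps, moveRight, stk, Mem.set, hj]
  | _ => simp [runOps, moveRight, stk, Mem.set]

theorem runOps_moveLeft {w : List Sym} {m : Mem} {i : Var} {p : ℕ} (hp : m.pos i = p + 1)
    (h : p < w.length) :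
    runOps (tops (stk w m)) (moveLeft i) (stk w m) = stk w (m.set i p) := by
  funext k
  cases k with
  | left j =>
    by_cases hj : j = i
    · subst hj
      simp [runOps, moveLeft, stk, Mem.set, hp, List.reverse_take_succ w h]
    · simp [runOps, moveLeft, stk, Mem.set, hj]
  | right j =>
    by_cases hj : j = i
    · subst hj
      simp [runOps, moveLeft, stk, Mem.set, hp, tops, -List.head?_reverse, List.head?_reverse_take_succ w h]
    · simp [runOps, moveLeft, stk, Mem.set, hj]
  | _ => simp [runOps, moveLeft, stk, Mem.set]

theorem tops_right_isSome (w : List Sym) (m : Mem) (i : Var) :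
    (tops (stk w m) (.right i)).isSome = decide (m.pos i < w.length) := by
  by_cases h : m.pos i < w.length <;> simp [tops, stk, h]

theorem tops_left_isSome {w : List Sym} {m : Mem} {i : Var} (h : m.pos i ≤ w.length) :
    (tops (stk w m) (.left i)).isSome = decide (0 < m.pos i) := by
  cases hp : m.pos i with
  | zero => simp [tops, stk, hp]
  | succ p =>
    rw [hp] at h
    simp [tops, stk, hp, -List.head?_reverse, List.head?_reverse_take_succ w (k := p) h]

def rewind (i : Var) : Cmd Alph := .loop (fun t => (t (.left i)).isSome) (.act (moveLeft i))

/-- The loop leaves head `i` just beyond the last symbol, which is where `Mem.Ready` wants unused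
heads to rest. -/
def forEach (i : Var) (c : Cmd Alph) : Cmd Alph :=
  .seq (rewind i) (.loop (fun t => (t (.right i)).isSome) (.seq c (.act (moveRight i))))

@[simp] theorem Mem.set_set (m : Mem) (i : Var) (p q : ℕ) : (m.set i p).set i q = m.set i q := by
  simp [Mem.set]

theorem Mem.set_eq_self {m : Mem} {i : Var} {p : ℕ} (h : m.pos i = p) : m.set i p = m := by
  subst h; simp [Mem.set]

@[simp] theorem Mem.pos_set_self (m : Mem) (i : Var) (p : ℕ) : (m.set i p).pos i = p := by
  simp [Mem.set]

theorem Realizes.rewind {ι : Type} (i : Var) (w : ι → List Sym) (m : ι → Mem)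
    (h : ∀ x, (m x).pos i ≤ (w x).length) :
    Realizes (rewind i) (fun x => (w x).length) (fun x => stk (w x) (m x))
      (fun x => stk (w x) ((m x).set i 0)) := by
  refine Realizes.loop (fun x => (m x).pos i)
    (fun x k => stk (w x) ((m x).set i ((m x).pos i - k))) Polynomial.X
    (by simpa using h) (fun x => by simp [Mem.set_eq_self]) (by simp) ?_ ?_ ?_
  · intro x k hk
    have := h x
    rw [tops_left_isSome] <;> simp <;> omega
  · intro x
    rw [tops_left_isSome] <;> simp
  · refine Realizes.act fun x => ?_
    obtain ⟨⟨x, k⟩, hk⟩ := x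
    have := h x
    simp only at hk ⊢
    rw [runOps_moveLeft (p := (m x).pos i - (k + 1)), Mem.set_set]
    · simp; omega
    · omega

/-- `M x k` is the memory before round `k`. The body must end with head `i` still at `k`; the
subsequent move then yields `M x (k + 1)`. -/
theorem Realizes.forEach {ι : Type} {i : Var} {c : Cmd Alph} {w : ι → List Sym} {m m' : ι → Mem}
    (M : ι → ℕ → Mem) (h : ∀ x, (m x).pos i ≤ (w x).length)
    (h0 : ∀ x, M x 0 = (m x).set i 0) (hN : ∀ x, M x (w x).length = m' x)
    (hpos : ∀ x k, (M x k).pos i = k)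
    (hc : Realizes c (fun x : {x : ι × ℕ // x.2 < (w x.1).length} => (w x.1.1).length)
      (fun x => stk (w x.1.1) (M x.1.1 x.1.2))
      (fun x => stk (w x.1.1) ((M x.1.1 (x.1.2 + 1)).set i x.1.2))) :
    Realizes (forEach i c) (fun x => (w x).length) (fun x => stk (w x) (m x))
      (fun x => stk (w x) (m' x)) := by
  refine (Realizes.rewind i w m h).seq ?_
  refine Realizes.loop (fun x => (w x).length) (fun x k => stk (w x) (M x k)) Polynomial.X
    (by simp) (by simp [h0]) (by simp [hN]) ?_ ?_ ?_
  · intro x k hk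
    rw [tops_right_isSome, hpos]
    simpa using hk
  · intro x
    rw [tops_right_isSome, hpos]
    simp
  · refine hc.seq (Realizes.act fun x => ?_)
    rw [runOps_moveRight (by simpa using x.2)]
    simp [Mem.set_eq_self, hpos]

/-! ### Moving two heads in lockstep, and looking up the table -/

def move (d : Bool) (i : Var) : List (Op Alph) := if d then moveRight i else moveLeft i

def shift (d : Bool) (a k : ℕ) : ℕ := if d then a + k else a - k

theorem runOps_move {w : List Sym} {m : Mem} {i : Var} {d : Bool} {a : ℕ}
    (h : d = true → m.pos i < w.length ∧ a = m.pos i + 1)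
    (h' : d = false → m.pos i = a + 1 ∧ a < w.length) :
    runOps (tops (stk w m)) (move d i) (stk w m) = stk w (m.set i a) := by
  cases d
  · exact runOps_moveLeft (h' rfl).1 (h' rfl).2
  · rw [(h rfl).2]
    exact runOps_moveRight (h rfl).1

def Mem.setCounter (m : Mem) (k : ℕ) : Mem := { m with counter := k }

def Mem.push (m : Mem) (b : Bool) : Mem := { m with bits := b :: m.bits }

def Mem.setTabPos (m : Mem) (k : ℕ) : Mem := { m with tabPos := k }

@[simp] theorem Mem.pos_set_of_ne {m : Mem} {i j : Var} {p : ℕ} (h : j ≠ i) :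
    (m.set i p).pos j = m.pos j := by
  simp [Mem.set, h]

@[simp] theorem Mem.pos_setCounter (m : Mem) (k : ℕ) : (m.setCounter k).pos = m.pos := rfl
@[simp] theorem Mem.pos_push (m : Mem) (b : Bool) : (m.push b).pos = m.pos := rfl
@[simp] theorem Mem.pos_setTabPos (m : Mem) (k : ℕ) : (m.setTabPos k).pos = m.pos := rfl

theorem Mem.setCounter_eq_self {m : Mem} {k : ℕ} (h : m.counter = k) : m.setCounter k = m := by
  subst h; rfl

theorem Mem.setTabPos_eq_self {m : Mem} {k : ℕ} (h : m.tabPos = k) : m.setTabPos k = m := by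
  subst h; rfl

theorem runOps_pushCounter (w : List Sym) (m : Mem) :
    runOps (tops (stk w m)) [.push .counter fun _ => ()] (stk w m) =
      stk w (m.setCounter (m.counter + 1)) := by
  funext k
  cases k <;> simp [runOps, stk, Mem.setCounter, List.replicate_succ]

theorem runOps_popCounter (w : List Sym) (m : Mem) :
    runOps (tops (stk w m)) [.pop .counter] (stk w m) =
      stk w (m.setCounter (m.counter - 1)) := by
  funext k
  cases k <;> simp [runOps, stk, Mem.setCounter]

theorem runOps_pushBit (w : List Sym) (m : Mem) (f : Tops Alph → Bool) :
    runOps (tops (stk w m)) [.push .bits f] (stk w m) =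
      stk w (m.push (f (tops (stk w m)))) := by
  funext k
  cases k <;> simp [runOps, stk, Mem.push]

theorem tops_counter_isSome (w : List Sym) (m : Mem) :
    (tops (stk w m) .counter).isSome = decide (0 < m.counter) := by
  cases h : m.counter <;> simp [tops, stk, h, List.replicate_succ]

/-- Move two heads in the same direction while `p` holds, push a bit, and move them back. -/
def lockstep (d : Bool) (i j : Var) (p q : Tops Alph → Bool) : Cmd Alph :=
  .seq (.loop p (.seq (.act (move d i)) (.seq (.act (move d j))
      (.act [.push .counter fun _ => ()]))))
    (.seq (.act [.push .bits q]) (.loop (fun t => (t .counter).isSome)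
      (.seq (.act (move (!d) i)) (.seq (.act (move (!d) j)) (.act [.pop .counter])))))

/-- The memory in the course of `lockstep`. -/
def Mem.shifted (m : Mem) (d : Bool) (i j : Var) (k : ℕ) : Mem :=
  ((m.set i (shift d (m.pos i) k)).set j (shift d (m.pos j) k)).setCounter k

theorem Mem.shifted_zero {m : Mem} {d : Bool} {i j : Var} (h : m.counter = 0) :
    m.shifted d i j 0 = m := by
  cases d <;> ext <;> simp [Mem.shifted, shift, Mem.set, Mem.setCounter, h]

/-- The counter records the number of joint moves, so the second loop undoes exactly these and only
the pushed bit remains. -/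
theorem Realizes.lockstep {ι : Type} {d : Bool} {i j : Var} (hij : i ≠ j) {p q : Tops Alph → Bool}
    {w : ι → List Sym} {m : ι → Mem} (N : ι → ℕ) (b : ι → Bool)
    (h0 : ∀ x, (m x).counter = 0)
    (hd : d = true → ∀ x, (m x).pos i + N x ≤ (w x).length ∧ (m x).pos j + N x ≤ (w x).length)
    (hd' : d = false → ∀ x, N x ≤ (m x).pos i ∧ N x ≤ (m x).pos j ∧
      (m x).pos i ≤ (w x).length ∧ (m x).pos j ≤ (w x).length)
    (hp : ∀ x, ∀ k < N x, p (tops (stk (w x) ((m x).shifted d i j k))) = true)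
    (hp' : ∀ x, p (tops (stk (w x) ((m x).shifted d i j (N x)))) = false)
    (hq : ∀ x, q (tops (stk (w x) ((m x).shifted d i j (N x)))) = b x) :
    Realizes (lockstep d i j p q) (fun x => (w x).length) (fun x => stk (w x) (m x))
      (fun x => stk (w x) ((m x).push (b x))) := by
  have hN : ∀ x, N x ≤ (w x).length := by
    intro x
    cases d
    · have := hd' rfl x; omega
    · have := hd rfl x; omega
  refine Realizes.seq (S' := fun x => stk (w x) ((m x).shifted d i j (N x))) ?_
    (Realizes.seq (S' := fun x => stk (w x) (((m x).shifted d i j (N x)).push (b x))) ?_ ?_)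
  · refine Realizes.loop N (fun x k => stk (w x) ((m x).shifted d i j k)) Polynomial.X (by simpa)
      (fun x => by simp [Mem.shifted_zero, h0]) (fun _ => rfl) hp hp' ?_
    refine Realizes.seq (S' := fun x => stk (w x.1.1) (((m x.1.1).shifted d i j x.1.2).set i
      (shift d ((m x.1.1).pos i) (x.1.2 + 1)))) ?_ (Realizes.seq (S' := fun x => stk (w x.1.1)
      ((((m x.1.1).shifted d i j x.1.2).set i (shift d ((m x.1.1).pos i) (x.1.2 + 1))).set j
        (shift d ((m x.1.1).pos j) (x.1.2 + 1)))) ?_ ?_)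
    · refine Realizes.act fun x => runOps_move ?_ ?_
      · rintro rfl
        have := hd rfl x.1.1
        have := x.2
        simp [Mem.shifted, hij, shift]
        omega
      · rintro rfl
        have := hd' rfl x.1.1
        have := x.2
        simp [Mem.shifted, hij, shift]
        omega
    · refine Realizes.act fun x => runOps_move ?_ ?_
      · rintro rfl
        have := hd rfl x.1.1
        have := x.2
        simp [Mem.shifted, hij.symm, shift]
        omega
      · rintro rfl
        have := hd' rfl x.1.1
        have := x.2
        simp [Mem.shifted, hij.symm, shift]
        omega
    · refine Realizes.act fun x => ?_
      rw [runOps_pushCounter]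
      congr 1
      ext l <;> simp [Mem.shifted, Mem.set, Mem.setCounter, Function.update_apply]
      split_ifs <;> rfl
  · refine Realizes.act fun x => ?_
    rw [runOps_pushBit, hq]
  · refine Realizes.loop N (fun x k => stk (w x) (((m x).shifted d i j (N x - k)).push (b x)))
      Polynomial.X (by simpa) (fun x => by simp) (fun x => by simp [Mem.shifted_zero, h0])
      (fun x k hk => ?_) (fun x => ?_) ?_
    · rw [tops_counter_isSome]
      simp [Mem.shifted, Mem.push, Mem.setCounter]
      omega
    · rw [tops_counter_isSome]
      simp [Mem.shifted, Mem.push, Mem.setCounter]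
    refine Realizes.seq (S' := fun x => stk (w x.1.1)
      ((((m x.1.1).shifted d i j (N x.1.1 - x.1.2)).push (b x.1.1)).set i
      (shift d ((m x.1.1).pos i) (N x.1.1 - (x.1.2 + 1))))) ?_
      (Realizes.seq (S' := fun x => stk (w x.1.1)
      (((((m x.1.1).shifted d i j (N x.1.1 - x.1.2)).push (b x.1.1)).set i
      (shift d ((m x.1.1).pos i) (N x.1.1 - (x.1.2 + 1)))).set j
      (shift d ((m x.1.1).pos j) (N x.1.1 - (x.1.2 + 1))))) ?_ ?_)
    · refine Realizes.act fun x => runOps_move ?_ ?_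
      · intro h
        obtain rfl : d = false := by simpa using h
        have := hd' rfl x.1.1
        have := x.2
        simp [Mem.shifted, hij, shift]
        omega
      · intro h
        obtain rfl : d = true := by simpa using h
        have := hd rfl x.1.1
        have := x.2
        simp [Mem.shifted, hij, shift]
        omega
    · refine Realizes.act fun x => runOps_move ?_ ?_
      · intro h
        obtain rfl : d = false := by simpa using h
        have := hd' rfl x.1.1
        have := x.2
        simp [Mem.shifted, hij.symm, shift]
        omega
      · intro h
        obtain rfl : d = true := by simpa using h
        have := hd rfl x.1.1
        have := x.2
        simp [Mem.shifted, hij.symm, shift]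
        omega
    · refine Realizes.act fun x => ?_
      rw [runOps_popCounter]
      congr 1
      ext l <;> simp [Mem.shifted, Mem.set, Mem.setCounter, Mem.push, Function.update_apply]
      · split_ifs <;> rfl
      · omega

/-- Run `c` as often as the position of head `i` says, keeping this position. -/
def walk (i : Var) (c : Cmd Alph) : Cmd Alph :=
  .seq (.loop (fun t => (t (.left i)).isSome) (.seq (.act (moveLeft i))
      (.seq (.act [.push .counter fun _ => ()]) c)))
    (.loop (fun t => (t .counter).isSome) (.seq (.act (moveRight i)) (.act [.pop .counter])))

/-- The position of head `i` is transferred to the counter unit by unit and back again at the end.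
The body therefore runs with a displaced head and a nonzero counter, neither of which it may change.
-/
theorem Realizes.walk {ι : Type} {i : Var} {c : Cmd Alph} {w : ι → List Sym} {m m' : ι → Mem}
    (M : ι → ℕ → Mem) (h : ∀ x, (m x).pos i ≤ (w x).length) (h0 : ∀ x, M x 0 = m x)
    (hN : ∀ x, M x ((m x).pos i) = m' x)
    (hpos : ∀ x k, (M x k).pos i = (m x).pos i) (hcounter : ∀ x k, (M x k).counter = 0)
    (hc : Realizes c (fun x : {x : ι × ℕ // x.2 < (m x.1).pos i} => (w x.1.1).length)
      (fun x => stk (w x.1.1)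
        (((M x.1.1 x.1.2).set i ((m x.1.1).pos i - (x.1.2 + 1))).setCounter (x.1.2 + 1)))
      (fun x => stk (w x.1.1)
        (((M x.1.1 (x.1.2 + 1)).set i ((m x.1.1).pos i - (x.1.2 + 1))).setCounter (x.1.2 + 1)))) :
    Realizes (walk i c) (fun x => (w x).length) (fun x => stk (w x) (m x))
      (fun x => stk (w x) (m' x)) := by
  refine Realizes.seq (S' := fun x => stk (w x)
    (((m' x).set i 0).setCounter ((m x).pos i))) ?_ ?_
  · refine Realizes.loop (fun x => (m x).pos i) (fun x k => stk (w x)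
      (((M x k).set i ((m x).pos i - k)).setCounter k)) Polynomial.X (by simpa) ?_ (by simp [hN])
      ?_ ?_ ?_
    · intro x
      rw [Mem.set_eq_self (by simp [hpos]), Mem.setCounter_eq_self (hcounter x 0), h0]
    · intro x k hk
      have := h x
      rw [tops_left_isSome] <;> simp <;> omega
    · intro x
      rw [tops_left_isSome] <;> simp
    · refine Realizes.seq (S' := fun x => stk (w x.1.1)
        (((M x.1.1 x.1.2).set i ((m x.1.1).pos i - (x.1.2 + 1))).setCounter x.1.2))
        (Realizes.act fun x => ?_) (Realizes.seq (Realizes.act fun x => ?_) hc)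
      · have := x.2
        have := h x.1.1
        rw [runOps_moveLeft (p := (m x.1.1).pos i - (x.1.2 + 1)) (by simp; omega) (by omega)]
        congr 1
        simp [Mem.set, Mem.setCounter]
      · rw [runOps_pushCounter]
        rfl
  · have hpos' : ∀ x, (m' x).pos i = (m x).pos i := fun x => by rw [← hN, hpos]
    have hcounter' : ∀ x, (m' x).counter = 0 := fun x => by rw [← hN, hcounter]
    refine Realizes.loop (fun x => (m x).pos i) (fun x k => stk (w x)
      (((m' x).set i k).setCounter ((m x).pos i - k))) Polynomial.X (by simpa) (by simp) ?_
      ?_ ?_ ?_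
    · intro x
      rw [Mem.set_eq_self (hpos' x), Nat.sub_self, Mem.setCounter_eq_self (hcounter' x)]
    · intro x k hk
      rw [tops_counter_isSome]
      simpa [Mem.setCounter] using hk
    · intro x
      rw [tops_counter_isSome]
      simp [Mem.setCounter]
    · refine Realizes.seq (S' := fun x => stk (w x.1.1)
        (((m' x.1.1).set i (x.1.2 + 1)).setCounter ((m x.1.1).pos i - x.1.2)))
        (Realizes.act fun x => ?_) (Realizes.act fun x => ?_)
      · have := x.2
        have := h x.1.1
        rw [runOps_moveRight (by simp; omega)]
        congr 1
        simp [Mem.set, Mem.setCounter]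
      · rw [runOps_popCounter]
        congr 1

def tabRight : List (Op Alph) :=
  [.push .tabLeft (fun t => (t .tabRight).getD false), .pop .tabRight]

def tabLeft : List (Op Alph) :=
  [.push .tabRight (fun t => (t .tabLeft).getD false), .pop .tabLeft]

theorem runOps_tabRight {w : List Sym} {m : Mem} (h : m.tabPos < m.table.length) :
    runOps (tops (stk w m)) tabRight (stk w m) = stk w (m.setTabPos (m.tabPos + 1)) := by
  funext k
  cases k <;> simp [runOps, tabRight, stk, Mem.setTabPos, tops, -List.head?_drop,
    List.head?_drop_of_lt _ h, List.reverse_take_succ _ h]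

theorem runOps_tabLeft {w : List Sym} {m : Mem} {p : ℕ} (hp : m.tabPos = p + 1)
    (h : p < m.table.length) :
    runOps (tops (stk w m)) tabLeft (stk w m) = stk w (m.setTabPos p) := by
  funext k
  cases k <;> simp [runOps, tabLeft, stk, Mem.setTabPos, tops, -List.head?_reverse, hp,
    List.reverse_take_succ _ h]

theorem tops_tabLeft_isSome {w : List Sym} {m : Mem} (h : m.tabPos ≤ m.table.length) :
    (tops (stk w m) .tabLeft).isSome = decide (0 < m.tabPos) := by
  cases hp : m.tabPos with
  | zero => simp [tops, stk, hp]
  | succ p =>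
    rw [hp] at h
    simp [tops, stk, hp, -List.head?_reverse, List.head?_reverse_take_succ _ (k := p) h]

/-- Push the bit of the table at row `i` and column `j`, with `z` as an auxiliary head. -/
def lookup (i j z : Var) : Cmd Alph :=
  .seq (walk i (forEach z (.act tabRight))) (.seq (walk j (.act tabRight))
    (.seq (.act [.push .bits fun t => (t .tabRight).getD false])
      (.loop (fun t => (t .tabLeft).isSome) (.act tabLeft))))

/-- The table is stored by rows: each unit of the position of `i` costs one sweep of `z` over the
word, which skips a whole row, and `j` further moves select the column. The sweep leaves `z` at the
end of the word, where it was. -/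
theorem Realizes.lookup {ι : Type} {i j z : Var} (hi : i ≠ z)
    {w : ι → List Sym} {m : ι → Mem} (h0 : ∀ x, (m x).counter = 0) (ht : ∀ x, (m x).tabPos = 0)
    (hT : ∀ x, (m x).table.length = (w x).length * (w x).length)
    (hpi : ∀ x, (m x).pos i < (w x).length) (hpj : ∀ x, (m x).pos j < (w x).length)
    (hz : ∀ x, (m x).pos z = (w x).length) :
    Realizes (lookup i j z) (fun x => (w x).length) (fun x => stk (w x) (m x))
      (fun x => stk (w x) ((m x).push
        ((m x).table.getD ((m x).pos i * (w x).length + (m x).pos j) false))) := by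
  have key : ∀ x a b, a < (w x).length → b < (w x).length →
      a * (w x).length + b < (m x).table.length := by
    intro x a b ha hb
    rw [hT]
    calc a * (w x).length + b < a * (w x).length + (w x).length := by omega
      _ = (a + 1) * (w x).length := by ring
      _ ≤ _ := Nat.mul_le_mul_right _ ha
  refine Realizes.seq (S' := fun x => stk (w x)
    ((m x).setTabPos ((m x).pos i * (w x).length))) ?_ (Realizes.seq (S' := fun x => stk (w x)
    ((m x).setTabPos ((m x).pos i * (w x).length + (m x).pos j))) ?_ (Realizes.seq
      (S' := fun x => stk (w x) (((m x).setTabPos ((m x).pos i * (w x).length + (m x).pos j)).push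
        ((m x).table.getD ((m x).pos i * (w x).length + (m x).pos j) false)))
      (Realizes.act fun x => ?_) ?_))
  · refine Realizes.walk (fun x k => (m x).setTabPos (k * (w x).length)) (fun x => (hpi x).le)
      (fun x => ?_) (fun _ => rfl) (fun _ _ => rfl) (fun x _ => h0 x) ?_
    · rw [Nat.zero_mul, Mem.setTabPos_eq_self (ht x)]
    · refine Realizes.forEach (fun x k => (((((m x.1.1).setTabPos (x.1.2 * (w x.1.1).length + k)).set i
        ((m x.1.1).pos i - (x.1.2 + 1))).setCounter (x.1.2 + 1)).set z k)) (fun x => ?_)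
        (fun x => rfl) (fun x => ?_) (by simp) (Realizes.act fun x => ?_)
      · simp [hi.symm, hz]
      · rw [Mem.set_eq_self (by simp [hi.symm, hz])]
        congr 2
        congr 1
        ring
      · rw [runOps_tabRight]
        · congr 1
          simp [Mem.set, Mem.setTabPos, Mem.setCounter, add_assoc]
        · refine key x.1.1.1.1 x.1.1.1.2 x.1.2 ?_ x.2
          have := x.1.1.2
          have := hpi x.1.1.1.1
          omega
  · refine Realizes.walk (fun x k => (m x).setTabPos ((m x).pos i * (w x).length + k))
      (fun x => (hpj x).le) (fun x => rfl) (fun x => rfl) (fun _ _ => rfl) (fun x _ => h0 x)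
      (Realizes.act fun x => ?_)
    rw [runOps_tabRight]
    · rfl
    · exact key x.1.1 _ _ (hpi _) (by exact lt_trans x.2 (hpj x.1.1))
  · rw [runOps_pushBit]
    congr 2
    simp [tops, stk, Mem.setTabPos, List.getD_eq_getElem?_getD]
  · refine Realizes.loop (fun x => (m x).pos i * (w x).length + (m x).pos j) (fun x k =>
      stk (w x) (((m x).setTabPos ((m x).pos i * (w x).length + (m x).pos j - k)).push
        ((m x).table.getD ((m x).pos i * (w x).length + (m x).pos j) false)))
      (Polynomial.X * Polynomial.X) (fun x => ?_) (fun x => rfl) (fun x => ?_) (fun x k hk => ?_)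
      (fun x => ?_) (Realizes.act fun x => ?_)
    · have := key x _ _ (hpi x) (hpj x)
      rw [hT] at this
      simpa using this.le
    · rw [Nat.sub_self, Mem.setTabPos_eq_self (ht x)]
    · have := key x _ _ (hpi x) (hpj x)
      rw [tops_tabLeft_isSome]
      · simpa [Mem.setTabPos, Mem.push] using hk
      · simp [Mem.setTabPos, Mem.push]; omega
    · rw [tops_tabLeft_isSome] <;> simp [Mem.setTabPos, Mem.push]
    · have := key x.1.1 _ _ (hpi x.1.1) (hpj x.1.1)
      have := x.2
      rw [runOps_tabLeft (p := (m x.1.1).pos i * (w x.1.1).length + (m x.1.1).pos j - (x.1.2 + 1))]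
      · rfl
      · simp [Mem.setTabPos, Mem.push]; omega
      · simp [Mem.setTabPos, Mem.push]; omega

/-! ### First-order formulas over words, with a binary relation variable -/

def Sym.isBit : Sym → Bool
  | .bit _ => true
  | _ => false

/-- The bits that follow position `p`. -/
def nameAt (w : List Sym) (p : ℕ) : List Sym := (w.drop (p + 1)).takeWhile Sym.isBit

inductive Fm : Type
  /-- The symbol at position `i` has the property `s`. -/
  | sym (s : Sym → Bool) (i : Var)
  | lt (i j : Var)
  /-- The same sequence of bits follows positions `i` and `j`. -/
  | sameName (i j : Var)
  /-- The relation holds between `i` and `j`; `z` is an auxiliary head. -/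
  | tab (i j z : Var)
  | not (φ : Fm)
  | and (φ ψ : Fm)
  | ex (i : Var) (φ : Fm)

def Fm.eval (w : List Sym) (T : ℕ → ℕ → Prop) : Fm → (Var → ℕ) → Prop
  | .sym s i, v => ∃ a, w[v i]? = some a ∧ s a = true
  | .lt i j, v => v i < v j
  | .sameName i j, v => nameAt w (v i) = nameAt w (v j)
  | .tab i j _, v => T (v i) (v j)
  | .not φ, v => ¬ φ.eval w T v
  | .and φ ψ, v => φ.eval w T v ∧ ψ.eval w T v
  | .ex i φ, v => ∃ p < w.length, φ.eval w T (Function.update v i p)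

/-- The variables in `B` are the ones in use. -/
def Fm.ok : Fm → List Var → Bool
  | .sym _ i, B => decide (i ∈ B)
  | .lt i j, B => decide (i ∈ B ∧ j ∈ B ∧ i ≠ j)
  | .sameName i j, B => decide (i ∈ B ∧ j ∈ B ∧ i ≠ j)
  | .tab i j z, B => decide (i ∈ B ∧ j ∈ B ∧ z ∉ B)
  | .not φ, B => φ.ok B
  | .and φ ψ, B => φ.ok B && ψ.ok B
  | .ex i φ, B => decide (i ∉ B) && φ.ok (i :: B)

def sameBit : Option Sym → Option Sym → Bool
  | some (.bit a), some (.bit b) => a == b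
  | _, _ => false

theorem sameBit_eq_true_iff {o o' : Option Sym} :
    sameBit o o' = true ↔ ∃ b, o = some (.bit b) ∧ o' = some (.bit b) := by
  rcases o with _ | a
  · simp [sameBit]
  · rcases o' with _ | a'
    · cases a <;> simp [sameBit]
    · cases a <;> cases a' <;> simp [sameBit]
      exact eq_comm

def notBit (o : Option Sym) : Bool := !(o.any Sym.isBit)

/-- Evaluate a formula and push the result. -/
def Fm.cmd : Fm → Cmd Alph
  | .sym s i => .act [.push .bits fun t => (t (.right i)).any s]
  | .lt i j => lockstep false i j (fun t => (t (.left i)).isSome && (t (.left j)).isSome)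
      (fun t => (t (.left j)).isSome)
  | .sameName i j => lockstep true i j
      (fun t => !(t .counter).isSome || sameBit (t (.right i)) (t (.right j)))
      (fun t => notBit (t (.right i)) && notBit (t (.right j)))
  | .tab i j z => lookup i j z
  | .not φ => .seq φ.cmd (.act [.pop .bits, .push .bits fun t => !(t .bits).getD false])
  | .and φ ψ => .seq φ.cmd (.seq ψ.cmd (.ite (fun t => (t .bits).getD false)
      (.act [.pop .bits]) (.act [.pop .bits, .pop .bits, .push .bits fun _ => false])))
  | .ex i φ => .seq (.act [.push .bits fun _ => false])
      (forEach i (.seq φ.cmd (.ite (fun t => (t .bits).getD false)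
        (.act [.pop .bits, .pop .bits, .push .bits fun _ => true]) (.act [.pop .bits]))))

/-- The memory between two evaluations of formulas. -/
structure Mem.Ready (m : Mem) (B : List Var) (n : ℕ) : Prop where
  used : ∀ i ∈ B, m.pos i < n
  unused : ∀ i ∉ B, m.pos i = n
  counter : m.counter = 0
  tabPos : m.tabPos = 0
  table : m.table.length = n * n

/-- The relation that is stored in the table. -/
def tabRel (n : ℕ) (l : List Bool) (p q : ℕ) : Prop :=
  p < n ∧ q < n ∧ l.getD (p * n + q) false = true

open Classical in
noncomputable def Fm.value (φ : Fm) (w : List Sym) (m : Mem) : Bool :=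
  decide (φ.eval w (tabRel w.length m.table) m.pos)

theorem Fm.value_eq_true_iff {φ : Fm} {w : List Sym} {m : Mem} :
    φ.value w m = true ↔ φ.eval w (tabRel w.length m.table) m.pos := by
  simp [Fm.value]

theorem runOps_popBit (t : Tops Alph) (w : List Sym) (m : Mem) :
    runOps t [.pop .bits] (stk w m) = stk w { m with bits := m.bits.tail } := by
  funext k
  cases k <;> simp [runOps, stk]

theorem runOps_popBit_push (t : Tops Alph) (w : List Sym) (m : Mem) (f : Tops Alph → Bool) :
    runOps t [.pop .bits, .push .bits f] (stk w m) =
      stk w { m with bits := f t :: m.bits.tail } := by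
  funext k
  cases k <;> simp [runOps, stk]

theorem runOps_popBit_popBit_push (t : Tops Alph) (w : List Sym) (m : Mem) (f : Tops Alph → Bool) :
    runOps t [.pop .bits, .pop .bits, .push .bits f] (stk w m) =
      stk w { m with bits := f t :: m.bits.tail.tail } := by
  funext k
  cases k <;> simp [runOps, stk]

theorem Mem.Ready.ex {m : Mem} {B : List Var} {n : ℕ} {i : Var} {p : ℕ} (h : m.Ready B n)
    (hp : p < n) : (m.set i p).Ready (i :: B) n where
  used j hj := by
    by_cases hji : j = i
    · subst hji; simpa
    · simpa [hji] using h.used j (by simpa [hji] using hj)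
  unused j hj := by
    simp only [List.mem_cons, not_or] at hj
    simpa [hj.1] using h.unused j hj.2
  counter := h.counter
  tabPos := h.tabPos
  table := h.table

theorem Mem.Ready.push {m : Mem} {B : List Var} {n : ℕ} {b : Bool} (h : m.Ready B n) :
    (m.push b).Ready B n := ⟨h.used, h.unused, h.counter, h.tabPos, h.table⟩

/-- Scanning two lists as long as they have the same bits compares their initial blocks of bits. -/
theorem takeWhile_isBit_eq_iff (l l' : List Sym) (N : ℕ) (h : ∀ k < N, sameBit l[k]? l'[k]? = true)
    (hN : sameBit l[N]? l'[N]? = false) :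
    l.takeWhile Sym.isBit = l'.takeWhile Sym.isBit ↔ (notBit l[N]? && notBit l'[N]?) = true := by
  induction N generalizing l l' with
  | zero =>
    rcases l with _ | ⟨a, l⟩ <;> rcases l' with _ | ⟨a', l'⟩
    · simp [notBit]
    · cases a' <;> simp [notBit, List.takeWhile, Sym.isBit]
    · cases a <;> simp [notBit, List.takeWhile, Sym.isBit]
    · cases a <;> cases a' <;> simp [notBit, List.takeWhile, Sym.isBit]
      exact fun h => absurd h (by simpa [sameBit] using hN)
  | succ N ih =>
    obtain ⟨b, hb, hb'⟩ := sameBit_eq_true_iff.1 (h 0 (by omega))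
    obtain ⟨l, rfl⟩ := List.head?_eq_some_iff.1 (List.head?_eq_getElem? ▸ hb)
    obtain ⟨l', rfl⟩ := List.head?_eq_some_iff.1 (List.head?_eq_getElem? ▸ hb')
    have := ih l l' (fun k hk => by simpa using h (k + 1) (by omega)) (by simpa using hN)
    simpa [List.takeWhile, Sym.isBit] using this

theorem exists_sameBit_bound (l l' : List Sym) : ∃ N, (∀ k < N, sameBit l[k]? l'[k]? = true) ∧
    sameBit l[N]? l'[N]? = false ∧ N ≤ l.length ∧ N ≤ l'.length := by
  classical
  have hex : ∃ N, sameBit l[N]? l'[N]? = false := ⟨l.length, by simp [sameBit]⟩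
  refine ⟨Nat.find hex, fun k hk => by simpa using Nat.find_min hex hk, Nat.find_spec hex,
    Nat.find_min' hex (by simp [sameBit]), Nat.find_min' hex ?_⟩
  rw [List.getElem?_eq_none le_rfl]
  cases l[l'.length]? with
  | none => rfl
  | some a => cases a <;> rfl

theorem Mem.Ready.pos_le {m : Mem} {B : List Var} {n : ℕ} (h : m.Ready B n) (i : Var) :
    m.pos i ≤ n := by
  by_cases hi : i ∈ B
  · exact (h.used i hi).le
  · exact (h.unused i hi).le

/-- Both heads move left until one of them reaches the beginning; the position of `i` is the smaller
one iff head `j` has not arrived there by then. -/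
theorem Realizes.lt {ι : Type} {i j : Var} (hij : i ≠ j) {B : List Var} {w : ι → List Sym}
    {m : ι → Mem} (h : ∀ x, (m x).Ready B (w x).length) :
    Realizes (Fm.lt i j).cmd (fun x => (w x).length) (fun x => stk (w x) (m x))
      (fun x => stk (w x) ((m x).push ((Fm.lt i j).value (w x) (m x)))) := by
  have hle : ∀ x k, ((m x).shifted false i j k).pos i ≤ (w x).length ∧
      ((m x).shifted false i j k).pos j ≤ (w x).length := by
    intro x k
    have := (h x).pos_le i
    have := (h x).pos_le j
    simp [Mem.shifted, shift, hij]
    omega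
  refine Realizes.lockstep hij (fun x => min ((m x).pos i) ((m x).pos j)) _ (fun x => (h x).counter)
    (by simp) (fun _ x => ⟨min_le_left _ _, min_le_right _ _, (h x).pos_le i, (h x).pos_le j⟩)
    (fun x k hk => ?_) (fun x => ?_) (fun x => ?_)
  · rw [tops_left_isSome (hle x k).1, tops_left_isSome (hle x k).2]
    simp [Mem.shifted, shift, hij] at hk ⊢
    exact hk
  · rw [tops_left_isSome (hle x _).1, tops_left_isSome (hle x _).2]
    simp [Mem.shifted, shift, hij]
    omega
  · rw [tops_left_isSome (hle x _).2, Bool.eq_iff_iff, Fm.value_eq_true_iff]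
    simp [Mem.shifted, shift, Fm.eval]

theorem Realizes.sameName {ι : Type} {i j : Var} (hij : i ≠ j) {B : List Var} (hi : i ∈ B)
    (hj : j ∈ B) {w : ι → List Sym} {m : ι → Mem} (h : ∀ x, (m x).Ready B (w x).length) :
    Realizes (Fm.sameName i j).cmd (fun x => (w x).length) (fun x => stk (w x) (m x))
      (fun x => stk (w x) ((m x).push ((Fm.sameName i j).value (w x) (m x)))) := by
  choose N hN hN' hNi hNj using fun x =>
    exists_sameBit_bound ((w x).drop ((m x).pos i + 1)) ((w x).drop ((m x).pos j + 1))
  have hright : ∀ x k, tops (stk (w x) ((m x).shifted true i j (k + 1))) (.right i) =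
      ((w x).drop ((m x).pos i + 1))[k]? ∧
      tops (stk (w x) ((m x).shifted true i j (k + 1))) (.right j) =
      ((w x).drop ((m x).pos j + 1))[k]? := by
    intro x k
    simp [tops, stk, Mem.shifted, shift, hij, add_assoc, add_comm]
  -- One move more than the number of common bits: the empty counter forces a first move, which
  -- takes both heads past the symbols in front of the names.
  refine Realizes.lockstep hij (fun x => N x + 1) _ (fun x => (h x).counter)
    (fun _ x => ?_) (by simp) (fun x k hk => ?_) (fun x => ?_) (fun x => ?_)
  · have h1 := hNi x
    have h2 := hNj x
    have h3 := (h x).used i hi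
    have h4 := (h x).used j hj
    simp only [List.length_drop] at h1 h2
    omega
  · cases k with
    | zero =>
      rw [tops_counter_isSome]
      simp [Mem.shifted, Mem.setCounter]
    | succ k =>
      rw [(hright x k).1, (hright x k).2, hN x k (by omega)]
      simp
  · rw [(hright x _).1, (hright x _).2, hN' x, tops_counter_isSome]
    simp [Mem.shifted, Mem.setCounter]
  · rw [(hright x _).1, (hright x _).2]
    have := takeWhile_isBit_eq_iff _ _ _ (hN x) (hN' x)
    rw [Bool.eq_iff_iff, ← this, Fm.value_eq_true_iff]
    rfl

/-- The index type is generalized in the induction: for a quantifier, the subformula is run on the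
family of all pairs of an instance and a position of the new head, again within one polynomial
bound. -/
theorem Fm.realizes (φ : Fm) (B : List Var) (hφ : φ.ok B = true) {ι : Type} (w : ι → List Sym)
    (m : ι → Mem) (h : ∀ x, (m x).Ready B (w x).length) :
    Realizes φ.cmd (fun x => (w x).length) (fun x => stk (w x) (m x))
      (fun x => stk (w x) ((m x).push (φ.value (w x) (m x)))) := by
  classical
  induction φ generalizing B ι with
  | sym s i =>
    refine Realizes.act fun x => ?_
    rw [runOps_pushBit]
    congr 2
    rw [Bool.eq_iff_iff, Fm.value_eq_true_iff]
    simp [tops, stk, Fm.eval, Option.any_eq_true]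
  | lt i j =>
    simp only [Fm.ok, decide_eq_true_eq] at hφ
    exact Realizes.lt hφ.2.2 h
  | sameName i j =>
    simp only [Fm.ok, decide_eq_true_eq] at hφ
    exact Realizes.sameName hφ.2.2 hφ.1 hφ.2.1 h
  | tab i j z =>
    simp only [Fm.ok, decide_eq_true_eq] at hφ
    have hpi := fun x => (h x).used i hφ.1
    have hpj := fun x => (h x).used j hφ.2.1
    refine (Realizes.lookup (i := i) (j := j) (z := z) (fun hi => hφ.2.2 (hi ▸ hφ.1))
      (fun x => (h x).counter) (fun x => (h x).tabPos) (fun x => (h x).table) hpi hpj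
      (fun x => (h x).unused z hφ.2.2)).congr (fun _ => rfl) fun x => ?_
    congr 2
    rw [Bool.eq_iff_iff, Fm.value_eq_true_iff]
    simp [Fm.eval, tabRel, hpi, hpj]
  | not φ ih =>
    refine (ih B hφ w m h).seq (Realizes.act fun x => ?_)
    rw [runOps_popBit_push]
    have : Fm.value (.not φ) (w x) (m x) = !φ.value (w x) (m x) := by
      rw [Bool.eq_iff_iff, Fm.value_eq_true_iff, Bool.not_eq_true', ← Bool.not_eq_true,
        Fm.value_eq_true_iff]
      rfl
    rw [this]
    rfl
  | and φ ψ ihφ ihψ =>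
    simp only [Fm.ok, Bool.and_eq_true] at hφ
    have hv : ∀ x, Fm.value (.and φ ψ) (w x) (m x) = (φ.value (w x) (m x) && ψ.value (w x) (m x)) := by
      intro x
      rw [Bool.eq_iff_iff, Fm.value_eq_true_iff, Bool.and_eq_true, Fm.value_eq_true_iff,
        Fm.value_eq_true_iff]
      rfl
    refine (ihφ B hφ.1 w m h).seq ((ihψ B hφ.2 w _ fun x => (h x).push).seq
      (Realizes.iteAct (fun x hx => ?_) (fun x hx => ?_)))
    · replace hx : ψ.value (w x) (m x) = true := hx
      rw [hv, hx, Bool.and_true, runOps_popBit]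
      rfl
    · replace hx : ψ.value (w x) (m x) = false := hx
      rw [hv, hx, Bool.and_false, runOps_popBit_popBit_push]
      rfl
  | ex i φ ih =>
    simp only [Fm.ok, Bool.and_eq_true, decide_eq_true_eq] at hφ
    refine Realizes.seq (S' := fun x => stk (w x) ((m x).push false))
      (Realizes.act fun x => runOps_pushBit _ _ _) ?_
    -- Invariant: before round `k`, the topmost bit tells whether a witness below `k` has been
    -- found.
    refine Realizes.forEach (fun x k => ((m x).push (decide (∃ p < k, φ.eval (w x)
      (tabRel (w x).length (m x).table) (Function.update (m x).pos i p)))).set i k)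
      (fun x => (h x).pos_le i) (fun x => by simp) (fun x => ?_) (fun x k => by simp) ?_
    · rw [Mem.set_eq_self (by simp [(h x).unused i hφ.1])]
      congr 2
    · refine (ih (i :: B) hφ.2 (ι := {x : ι × ℕ // x.2 < (w x.1).length}) (fun x => w x.1.1) _ fun x => ((h x.1.1).push).ex x.2).seq
        (Realizes.iteAct (fun x hx => ?_) (fun x hx => ?_))
      · have hv : φ.eval (w x.1.1) (tabRel (w x.1.1).length (m x.1.1).table)
          (Function.update (m x.1.1).pos i x.1.2) := of_decide_eq_true hx
        have h1 : ∃ p < x.1.2 + 1, φ.eval (w x.1.1) (tabRel (w x.1.1).length (m x.1.1).table)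
          (Function.update (m x.1.1).pos i p) := ⟨x.1.2, by omega, hv⟩
        rw [runOps_popBit_popBit_push, decide_eq_true h1, Mem.set_set]
        rfl
      · have hv : ¬ φ.eval (w x.1.1) (tabRel (w x.1.1).length (m x.1.1).table)
          (Function.update (m x.1.1).pos i x.1.2) := of_decide_eq_false hx
        have h1 : (∃ p < x.1.2 + 1, φ.eval (w x.1.1) (tabRel (w x.1.1).length (m x.1.1).table)
          (Function.update (m x.1.1).pos i p)) ↔ ∃ p < x.1.2, φ.eval (w x.1.1)
            (tabRel (w x.1.1).length (m x.1.1).table) (Function.update (m x.1.1).pos i p) := by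
          constructor
          · rintro ⟨p, hp, hp'⟩
            refine ⟨p, lt_of_le_of_ne (Nat.lt_succ_iff.1 hp) ?_, hp'⟩
            rintro rfl
            exact hv hp'
          · rintro ⟨p, hp, hp'⟩
            exact ⟨p, by omega, hp'⟩
        rw [runOps_popBit, decide_eq_decide.2 h1, Mem.set_set]
        rfl

/-! ### Iterating a formula -/

theorem Realizes.comap {K : Type} [DecidableEq K] {Γ : K → Type} {ι κ : Type} {c : Cmd Γ}
    {n : ι → ℕ} {S S' : ι → Store Γ} (h : Realizes c n S S') (f : κ → ι) :
    Realizes c (fun x => n (f x)) (fun x => S (f x)) (fun x => S' (f x)) := by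
  obtain ⟨q, hq⟩ := h
  exact ⟨q, fun x => hq (f x)⟩

def Mem.setNew (m : Mem) (l : List Bool) : Mem := { m with tabNew := l }

def Mem.setTable (m : Mem) (l : List Bool) : Mem := { m with table := l }

@[simp] theorem Mem.pos_setNew (m : Mem) (l : List Bool) : (m.setNew l).pos = m.pos := rfl
@[simp] theorem Mem.pos_setTable (m : Mem) (l : List Bool) : (m.setTable l).pos = m.pos := rfl

/-- The first `k` entries of a table, the last one first. -/
def tableEntries (n : ℕ) (g : ℕ → ℕ → Bool) (k : ℕ) : List Bool :=
  ((List.range k).map fun j => g (j / n) (j % n)).reverse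

def tableOf (n : ℕ) (g : ℕ → ℕ → Bool) : List Bool := (tableEntries n g (n * n)).reverse

theorem tableEntries_succ {n p q : ℕ} (g : ℕ → ℕ → Bool) (hq : q < n) :
    tableEntries n g (p * n + (q + 1)) = g p q :: tableEntries n g (p * n + q) := by
  have h1 : (p * n + q) / n = p := by
    rw [Nat.add_comm, Nat.add_mul_div_right _ _ (by omega), Nat.div_eq_of_lt hq, Nat.zero_add]
  have h2 : (p * n + q) % n = q := by
    rw [Nat.add_comm, Nat.add_mul_mod_self_right, Nat.mod_eq_of_lt hq]
  rw [← add_assoc, tableEntries, List.range_succ]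
  simp [tableEntries, h1, h2]

@[simp] theorem length_tableOf (n : ℕ) (g : ℕ → ℕ → Bool) : (tableOf n g).length = n * n := by
  simp [tableOf, tableEntries]

theorem tabRel_tableOf (n : ℕ) (g : ℕ → ℕ → Bool) (p q : ℕ) :
    tabRel n (tableOf n g) p q ↔ p < n ∧ q < n ∧ g p q = true := by
  unfold tabRel
  refine and_congr_right fun hp => and_congr_right fun hq => ?_
  have h1 : (p * n + q) / n = p := by
    rw [Nat.add_comm, Nat.add_mul_div_right _ _ (by omega), Nat.div_eq_of_lt hq, Nat.zero_add]
  have h2 : (p * n + q) % n = q := by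
    rw [Nat.add_comm, Nat.add_mul_mod_self_right, Nat.mod_eq_of_lt hq]
  have h3 : p * n + q < n * n := by
    calc p * n + q < p * n + n := by omega
      _ = (p + 1) * n := by ring
      _ ≤ _ := Nat.mul_le_mul_right _ hp
  rw [tableOf, tableEntries, List.reverse_reverse, List.getD_eq_getElem?_getD,
    List.getElem?_map, List.getElem?_range h3]
  simp [h1, h2]

/-- Replace the table by the new one. -/
def flush : Cmd Alph :=
  .seq (clear Stk.tabRight) (.loop (fun t => (t .tabNew).isSome)
    (.act [.push .tabRight (fun t => (t .tabNew).getD false), .pop .tabNew]))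

/-- Transferring a stack reverses it, which restores the order of the entries, since they were
pushed with the last one on top. -/
theorem Realizes.flush {ι : Type} {w : ι → List Sym} {m : ι → Mem} (l : ι → List Bool)
    (h0 : ∀ x, (m x).tabPos = 0) (hT : ∀ x, (m x).table.length ≤ (w x).length * (w x).length)
    (hl : ∀ x, (l x).length ≤ (w x).length * (w x).length) :
    Realizes flush (fun x => (w x).length) (fun x => stk (w x) ((m x).setNew (l x)))
      (fun x => stk (w x) (((m x).setNew []).setTable (l x).reverse)) := by
  refine Realizes.seq (S' := fun x => stk (w x) (((m x).setNew (l x)).setTable []))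
    ((Realizes.clear Stk.tabRight (Polynomial.X * Polynomial.X) fun x => ?_).congr (fun _ => rfl)
      fun x => ?_) ?_
  · simpa [stk, Mem.setNew, h0] using hT x
  · funext k
    cases k <;> simp [stk, Mem.setTable, h0, Mem.setNew]
  · refine Realizes.loop (fun x => (l x).length)
      (fun x k => stk (w x) (((m x).setNew ((l x).drop k)).setTable ((l x).take k).reverse))
      (Polynomial.X * Polynomial.X) (by simpa) (by simp) (by simp) (fun x k hk => ?_)
      (fun x => ?_) (Realizes.act fun x => ?_)
    · simp [tops, stk, Mem.setTable, Mem.setNew, hk]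
    · simp [tops, stk, Mem.setTable, Mem.setNew]
    · funext k
      have hk := x.2
      cases k <;> simp [runOps, stk, Mem.setTable, Mem.setNew, h0, tops, -List.head?_drop,
        List.head?_drop_of_lt _ hk, List.reverse_take_succ _ hk]

/-- Compute a new table, where `c` computes the entry at row `P` and column `Q`. -/
def build (P Q : Var) (c : Cmd Alph) : Cmd Alph := .seq (forEach P (forEach Q c)) flush

/-- The hypothesis on `c` allows any list of entries pushed before, so the entry computation need
not depend on how much of the table is complete. -/
theorem Realizes.build {ι : Type} {P Q : Var} (hPQ : P ≠ Q) {c : Cmd Alph} {w : ι → List Sym}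
    {m : ι → Mem} (g : ι → ℕ → ℕ → Bool) (hP : ∀ x, (m x).pos P = (w x).length)
    (hQ : ∀ x, (m x).pos Q = (w x).length) (h0 : ∀ x, (m x).tabPos = 0)
    (hT : ∀ x, (m x).table.length ≤ (w x).length * (w x).length)
    (hnew : ∀ x, (m x).tabNew = [])
    (hc : Realizes c (ι := {x : ι × ℕ × ℕ × List Bool // x.2.1 < (w x.1).length ∧
        x.2.2.1 < (w x.1).length}) (fun x => (w x.1.1).length)
      (fun x => stk (w x.1.1) ((((m x.1.1).set P x.1.2.1).set Q x.1.2.2.1).setNew x.1.2.2.2))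
      (fun x => stk (w x.1.1) ((((m x.1.1).set P x.1.2.1).set Q x.1.2.2.1).setNew
        (g x.1.1 x.1.2.1 x.1.2.2.1 :: x.1.2.2.2)))) :
    Realizes (build P Q c) (fun x => (w x).length) (fun x => stk (w x) (m x))
      (fun x => stk (w x) ((m x).setTable (tableOf (w x).length (g x)))) := by
  refine Realizes.seq (S' := fun x => stk (w x)
    ((m x).setNew (tableEntries (w x).length (g x) ((w x).length * (w x).length)))) ?_ ?_
  · refine Realizes.forEach (fun x p => ((m x).set P p).setNew
      (tableEntries (w x).length (g x) (p * (w x).length))) (fun x => (hP x).le) (fun x => ?_)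
      (fun x => ?_) (by simp) ?_
    · ext <;> simp [Mem.setNew, Mem.set, tableEntries, hnew]
    · rw [Mem.set_eq_self (hP x)]
    · refine Realizes.forEach (fun x q => ((((m x.1.1).set P x.1.2).set Q q).setNew
        (tableEntries (w x.1.1).length (g x.1.1) (x.1.2 * (w x.1.1).length + q))))
        (fun x => ?_) (fun x => rfl) (fun x => ?_) (by simp) ?_
      · simp [hPQ.symm, hQ]
      · rw [Mem.set_eq_self (by simp [hPQ.symm, hQ])]
        simp [Mem.set, Mem.setNew, add_mul]
      · refine (hc.comap (κ := {x : {x : ι × ℕ // x.2 < (w x.1).length} × ℕ // x.2 < (w x.1.1.1).length})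
          fun x => ⟨(x.1.1.1.1, x.1.1.1.2, x.1.2, tableEntries (w x.1.1.1.1).length
          (g x.1.1.1.1) (x.1.1.1.2 * (w x.1.1.1.1).length + x.1.2)), x.1.1.2, x.2⟩).congr
          (fun x => rfl) fun x => ?_
        rw [tableEntries_succ _ x.2]
        simp [Mem.set, Mem.setNew]
  · refine (Realizes.flush _ h0 hT fun x => ?_).congr (fun _ => rfl) fun x => ?_
    · simp [tableEntries]
    · congr 1
      simp [Mem.setTable, Mem.setNew, tableOf, ← hnew x]

/-- The stages of the iteration of `Step`, starting with the empty relation. -/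
def stages (Step : List Sym → (ℕ → ℕ → Prop) → ℕ → ℕ → Prop) (w : List Sym) : ℕ → ℕ → ℕ → Prop
  | 0 => fun _ _ => False
  | r + 1 => fun p q => p < w.length ∧ q < w.length ∧ Step w (stages Step w r) p q

open Classical in
noncomputable def stageTable (Step : List Sym → (ℕ → ℕ → Prop) → ℕ → ℕ → Prop) (w : List Sym) :
    ℕ → List Bool
  | 0 => tableOf w.length fun _ _ => false
  | r + 1 => tableOf w.length fun p q =>
      decide (Step w (tabRel w.length (stageTable Step w r)) p q)

theorem tabRel_stageTable (Step : List Sym → (ℕ → ℕ → Prop) → ℕ → ℕ → Prop) (w : List Sym) (r : ℕ) :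
    tabRel w.length (stageTable Step w r) = stages Step w r := by
  induction r with
  | zero => funext p q; simp [stageTable, stages, tabRel_tableOf]
  | succ r ih => funext p q; simp [stageTable, stages, tabRel_tableOf, ih]

theorem length_stageTable (Step : List Sym → (ℕ → ℕ → Prop) → ℕ → ℕ → Prop) (w : List Sym) (r : ℕ) :
    (stageTable Step w r).length = w.length * w.length := by
  cases r <;> simp [stageTable]

/-- Evaluate a formula and append the result to the new table. -/
def Fm.store (φ : Fm) : Cmd Alph :=
  .seq φ.cmd (.act [.push .tabNew (fun t => (t .bits).getD false), .pop .bits])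

/-- `R` and `R'` serve only as the two digits, in base the length of the word, of a counter for the
quadratically many rounds. -/
def Fm.rounds (φ : Fm) (P Q R R' : Var) : Cmd Alph :=
  forEach R (forEach R' (build P Q φ.store))

theorem Fm.realizes_store {φ : Fm} {B : List Var} (hφ : φ.ok B = true) {ι : Type}
    {w : ι → List Sym} {m : ι → Mem} (h : ∀ x, (m x).Ready B (w x).length) :
    Realizes φ.store (fun x => (w x).length) (fun x => stk (w x) (m x))
      (fun x => stk (w x) ((m x).setNew (φ.value (w x) (m x) :: (m x).tabNew))) := by
  refine (φ.realizes B hφ w m h).seq (Realizes.act fun x => ?_)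
  funext k
  cases k <;> simp [runOps, stk, Mem.setNew, Mem.push, tops]

theorem Mem.Ready.setNew {m : Mem} {B : List Var} {n : ℕ} {l : List Bool} (h : m.Ready B n) :
    (m.setNew l).Ready B n := ⟨h.used, h.unused, h.counter, h.tabPos, h.table⟩

theorem Mem.Ready.setTable {m : Mem} {B : List Var} {n : ℕ} {l : List Bool} (h : m.Ready B n)
    (hl : l.length = n * n) : (m.setTable l).Ready B n :=
  ⟨h.used, h.unused, h.counter, h.tabPos, hl⟩

theorem Realizes.rounds {φ : Fm} {P Q R R' : Var} (hPQ : P ≠ Q) (hPR : P ≠ R) (hPR' : P ≠ R')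
    (hQR : Q ≠ R) (hQR' : Q ≠ R') (hRR' : R ≠ R') (hok : φ.ok [Q, P, R', R] = true)
    {Step : List Sym → (ℕ → ℕ → Prop) → ℕ → ℕ → Prop}
    (hφ : ∀ w T v, φ.eval w T v ↔ Step w T (v P) (v Q)) {ι : Type} {w : ι → List Sym}
    {m : ι → Mem} (h : ∀ x, (m x).Ready [] (w x).length) (hnew : ∀ x, (m x).tabNew = [])
    (hT : ∀ x, (m x).table = stageTable Step (w x) 0) :
    Realizes (φ.rounds P Q R R') (fun x => (w x).length) (fun x => stk (w x) (m x))
      (fun x => stk (w x) ((m x).setTable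
        (stageTable Step (w x) ((w x).length * (w x).length)))) := by
  have hpos : ∀ x i, (m x).pos i = (w x).length := fun x i => (h x).unused i (by simp)
  refine Realizes.forEach (fun x r => ((m x).set R r).setTable
    (stageTable Step (w x) (r * (w x).length))) (fun x => (hpos x R).le) (fun x => ?_) (fun x => ?_)
    (by simp) ?_
  · rw [zero_mul, ← hT]; rfl
  · rw [Mem.set_eq_self (hpos x R)]
  refine Realizes.forEach (fun x r => ((((m x.1.1).set R x.1.2).set R' r).setTable
    (stageTable Step (w x.1.1) (x.1.2 * (w x.1.1).length + r)))) (fun x => ?_) (fun x => rfl)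
    (fun x => ?_) (by simp) ?_
  · simp [hRR'.symm, hpos]
  · rw [Mem.set_eq_self (by simp [hRR'.symm, hpos])]
    simp [Mem.set, Mem.setTable, add_mul]
  classical
  -- All rounds of all instances form one family, for the sake of a uniform time bound.
  let κ : Type := {x : {x : ι × ℕ // x.2 < (w x.1).length} × ℕ // x.2 < (w x.1.1.1).length}
  let M : κ → Mem := fun x => (((m x.1.1.1.1).set R x.1.1.1.2).set R' x.1.2).setTable
    (stageTable Step (w x.1.1.1.1) (x.1.1.1.2 * (w x.1.1.1.1).length + x.1.2))
  have hM : ∀ x : κ, (M x).Ready [R', R] (w x.1.1.1.1).length := fun x =>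
    (((h x.1.1.1.1).ex x.1.1.2).ex x.2).setTable (length_stageTable _ _ _)
  refine (Realizes.build (w := fun x : κ => w x.1.1.1.1) (m := M) hPQ
    (fun x p q => φ.value (w x.1.1.1.1) (((M x).set P p).set Q q))
    (fun x => (hM x).unused P (by simp [hPR, hPR'])) (fun x => (hM x).unused Q (by simp [hQR, hQR']))
    (fun x => (hM x).tabPos) (fun x => (hM x).table.le)
    (fun x => hnew x.1.1.1.1) ?_).congr (fun _ => rfl) fun x => ?_
  · exact Fm.realizes_store hok fun x => (((hM x.1.1).ex x.2.1).ex x.2.2).setNew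
  · congr 1
    have : stageTable Step (w x.1.1.1.1) (x.1.1.1.2 * (w x.1.1.1.1).length + (x.1.2 + 1)) =
      tableOf (w x.1.1.1.1).length fun p q =>
        φ.value (w x.1.1.1.1) (((M x).set P p).set Q q) := by
      rw [← add_assoc, stageTable]
      congr 1
      funext p q
      rw [Bool.eq_iff_iff, Fm.value_eq_true_iff, hφ, decide_eq_true_iff]
      simp [hPQ]
      rfl
    rw [this]
    simp [Mem.setTable, Mem.set, M]

/-! ### The automaton for well-formed words -/

def WfState.next : WfState → Sym → WfState
  | .start, .posMark => .label
  | .start, .negMark => .label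
  | .label, .conceptMark => .conceptName
  | .label, .roleMark => .roleName
  | .conceptName, .bit _ => .conceptName
  | .conceptName, .comma => .last
  | .roleName, .bit _ => .roleName
  | .roleName, .comma => .source
  | .source, .bit _ => .source
  | .source, .comma => .last
  | .last, .bit _ => .last
  | .last, .conceptMark => .conceptName
  | .last, .roleMark => .roleName
  | .last, .posMark => .label
  | .last, .negMark => .label
  | _, _ => .dead

def WfState.accept : WfState → Bool
  | .start => true
  | .last => true
  | _ => false

def wfRun (w : List Sym) : WfState := w.foldl WfState.next .start

/-- The automaton only pushes: its current state is the top of the stack of all states visited so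
far. -/
def wfStates (w : List Sym) (k : ℕ) : List WfState :=
  ((List.range (k + 1)).map fun j => wfRun (w.take j)).reverse

theorem wfStates_succ (w : List Sym) (k : ℕ) :
    wfStates w (k + 1) = wfRun (w.take (k + 1)) :: wfStates w k := by
  rw [wfStates, List.range_succ]
  simp [wfStates]

theorem head?_wfStates (w : List Sym) (k : ℕ) : (wfStates w k).head? = some (wfRun (w.take k)) := by
  simp [wfStates, List.range_succ]

/-- Push whether the word is well-formed. -/
def wfCmd : Cmd Alph :=
  .seq (.act [.push .states fun _ => .start])
    (.seq (forEach 0 (.act [.push .states fun t =>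
      ((t .states).getD .dead).next ((t (.right 0)).getD .comma)]))
    (.act [.push .bits fun t => ((t .states).getD .dead).accept]))

def Mem.setStates (m : Mem) (l : List WfState) : Mem := { m with states := l }

theorem runOps_pushState (w : List Sym) (m : Mem) (f : Tops Alph → WfState) :
    runOps (tops (stk w m)) [.push .states f] (stk w m) =
      stk w (m.setStates (f (tops (stk w m)) :: m.states)) := by
  funext k
  cases k <;> simp [runOps, stk, Mem.setStates]

theorem Realizes.wfCmd {ι : Type} {w : ι → List Sym} {m : ι → Mem}
    (hpos : ∀ x, (m x).pos 0 = (w x).length) (h0 : ∀ x, (m x).states = []) :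
    Realizes wfCmd (fun x => (w x).length) (fun x => stk (w x) (m x))
      (fun x => stk (w x) (((m x).setStates (wfStates (w x) (w x).length)).push
        (wfRun (w x)).accept)) := by
  refine Realizes.seq (S' := fun x => stk (w x) ((m x).setStates (wfStates (w x) 0)))
    (Realizes.act fun x => ?_) (Realizes.seq (S' := fun x => stk (w x)
      ((m x).setStates (wfStates (w x) (w x).length))) ?_ (Realizes.act fun x => ?_))
  · rw [runOps_pushState, h0]
    rfl
  · refine Realizes.forEach (fun x k => ((m x).set 0 k).setStates (wfStates (w x) k))
      (fun x => (hpos x).le) (fun x => rfl) (fun x => ?_) (fun x k => ?_)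
      (Realizes.act fun x => ?_)
    · rw [Mem.set_eq_self (hpos x)]
    · simp [Mem.setStates]
    · rw [runOps_pushState, wfStates_succ]
      have h1 : tops (stk (w x.1.1) (((m x.1.1).set 0 x.1.2).setStates (wfStates (w x.1.1) x.1.2)))
        .states = some (wfRun ((w x.1.1).take x.1.2)) := head?_wfStates _ _
      have h2 : tops (stk (w x.1.1) (((m x.1.1).set 0 x.1.2).setStates (wfStates (w x.1.1) x.1.2)))
          (.right 0) = some (w x.1.1)[x.1.2] := by
        simp [tops, stk, Mem.setStates, x.2]
      rw [h1, h2]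
      have h3 : wfRun ((w x.1.1).take (x.1.2 + 1)) =
          (wfRun ((w x.1.1).take x.1.2)).next (w x.1.1)[x.1.2] := by
        rw [List.take_succ_eq_append_getElem x.2, wfRun, List.foldl_append]
        rfl
      rw [h3]
      simp [Mem.setStates, Mem.set]
  · rw [runOps_pushBit]
    have h1 : tops (stk (w x) ((m x).setStates (wfStates (w x) (w x).length))) .states =
        some (wfRun (w x)) := by
      refine (head?_wfStates _ _).trans ?_
      simp
    rw [h1]
    rfl

/-! ### The complete program -/

/-- Distribute the input to all heads. -/
noncomputable def load : Cmd Alph :=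
  .loop (fun t => (t .inp).isSome) (.act
    (((Finset.univ : Finset Var).toList.map fun i =>
      .push (.left i) fun t => (t .inp).getD .comma) ++ [.pop .inp]))

def emptyMem : Mem where
  inp := []
  out := []
  pos _ := 0
  bits := []
  counter := 0
  table := []
  tabPos := 0
  tabNew := []
  states := []

/-- The list has no duplicates, so the pushes go to different stacks and each of these stacks
receives the symbol exactly once. -/
theorem runOps_pushLeft (t : Tops Alph) (f : Tops Alph → Sym) (l : List Var) (hl : l.Nodup)
    (os : List (Op Alph)) (S : Store Alph) :
    ∃ S' : Store Alph, runOps t ((l.map fun i => .push (.left i) f) ++ os) S = runOps t os S' ∧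
      (∀ i ∈ l, S' (.left i) = f t :: S (.left i)) ∧
      ∀ k, (∀ i ∈ l, k ≠ .left i) → S' k = S k := by
  induction l generalizing S with
  | nil => exact ⟨S, rfl, by simp, by simp⟩
  | cons j l ih =>
    obtain ⟨S', h1, h2, h3⟩ := ih hl.of_cons (Function.update S (.left j) (f t :: S (.left j)))
    have hj : j ∉ l := (List.nodup_cons.1 hl).1
    refine ⟨S', h1, ?_, ?_⟩
    · intro i hi
      by_cases hij : i = j
      · subst hij
        rw [h3 _ fun i' hi' h => hj (by simpa using (Stk.left.inj h) ▸ hi')]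
        simp
      · rw [h2 i (by simpa [hij] using hi)]
        simp [hij]
    · intro k hk
      rw [h3 k fun i hi => hk i (by simp [hi])]
      have := hk j (by simp)
      simp [this]

theorem Realizes.load : Realizes load (fun w : List Sym => w.length)
    (fun w => stk [] { emptyMem with inp := w })
    (fun w => stk w { emptyMem with pos := fun _ => w.length }) := by
  refine Realizes.loop (fun w => w.length)
    -- The word below the heads grows while it is read: after `k` rounds it is the prefix of length
    -- `k`, with every head at its right end.
    (fun w k => stk (w.take k) { emptyMem with inp := w.drop k, pos := fun _ => k })
    Polynomial.X (by simp) (by simp [emptyMem]) (by simp [emptyMem]) (fun w k hk => ?_)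
    (fun w => ?_) (Realizes.act fun x => ?_)
  · simp [tops, stk, hk]
  · simp [tops, stk]
  · obtain ⟨S', h1, h2, h3⟩ := runOps_pushLeft (tops (stk (x.1.1.take x.1.2)
      { emptyMem with inp := x.1.1.drop x.1.2, pos := fun _ => x.1.2 }))
      (fun t => (t .inp).getD .comma) _ (Finset.nodup_toList (Finset.univ : Finset Var))
      [.pop .inp] (stk (x.1.1.take x.1.2)
      { emptyMem with inp := x.1.1.drop x.1.2, pos := fun _ => x.1.2 })
    refine h1.trans ?_
    have hx := x.2
    funext k
    cases k with
    | left i =>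
      simp [runOps, h2, stk, tops, -List.head?_drop, List.head?_drop_of_lt _ hx]
      rw [List.take_take, List.take_take, min_self, min_self, List.reverse_take_succ _ hx]
    | inp => simp [runOps, stk, h3]
    | right i => simp [runOps, stk, h3]
    | _ => simp [runOps, stk, h3, emptyMem]

/-- Combine the two results, write the answer and empty all other stacks. -/
noncomputable def finish : Cmd Alph :=
  .seq (.ite (fun t => (t .bits).getD false) (.act [.pop .bits])
      (.act [.pop .bits, .pop .bits, .push .bits fun _ => false]))
    (.seq (.act [.push .out fun t => (t .bits).getD false])
      (clearAll ((Finset.univ.erase .out : Finset Stk).toList)))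

theorem Realizes.finish {ι : Type} {w : ι → List Sym} {m : ι → Mem} (b b' : ι → Bool)
    (hinp : ∀ x, (m x).inp = []) (hout : ∀ x, (m x).out = [])
    (hbits : ∀ x, (m x).bits = [b x, b' x]) (hcounter : ∀ x, (m x).counter = 0)
    (htab : ∀ x, (m x).table.length = (w x).length * (w x).length)
    (hnew : ∀ x, (m x).tabNew = [])
    (hstates : ∀ x, (m x).states.length = (w x).length + 1) :
    Realizes finish (fun x => (w x).length) (fun x => stk (w x) (m x))
      (fun x => stk [] { emptyMem with out := [b x && b' x] }) := by
  refine Realizes.seq (S' := fun x => stk (w x) { m x with bits := [b x && b' x] })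
    (Realizes.iteAct (fun x hx => ?_) (fun x hx => ?_)) (Realizes.seq
    (S' := fun x => stk (w x) { m x with bits := [b x && b' x], out := [b x && b' x] })
    (Realizes.act fun x => ?_) ?_)
  · have hb : b x = true := by simpa [tops, stk, hbits] using hx
    rw [runOps_popBit, hbits, hb]
    rfl
  · have hb : b x = false := by simpa [tops, stk, hbits] using hx
    rw [runOps_popBit_popBit_push, hbits, hb]
    rfl
  · funext k
    cases k <;> simp [runOps, stk, hout, tops]
  · refine (Realizes.clearAll _ (Polynomial.X * Polynomial.X + Polynomial.X + 1)
      fun x k => ?_).congr (fun _ => rfl) fun x => ?_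
    · cases k <;> simp [stk, hinp, hcounter, htab, hnew, hstates] <;> grind
    · funext k
      cases k <;> simp [stk, emptyMem]

noncomputable def mainCmd (φ ψ : Fm) (P Q R R' : Var) : Cmd Alph :=
  .seq load (.seq wfCmd (.seq (build P Q (.act [.push .tabNew fun _ => false]))
    (.seq (φ.rounds P Q R R') (.seq ψ.cmd finish))))

/-- The formulas do not depend on the input, so this is a single program with a fixed nesting of
loops. The iteration also runs on ill-formed words, where its result is overruled by the conjunction
with the verdict of the automaton. -/
theorem inPTime_of_formulas {φ ψ : Fm} {P Q R R' : Var} (hPQ : P ≠ Q) (hPR : P ≠ R)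
    (hPR' : P ≠ R') (hQR : Q ≠ R) (hQR' : Q ≠ R') (hRR' : R ≠ R')
    (hφok : φ.ok [Q, P, R', R] = true) (hψok : ψ.ok [] = true)
    {Step : List Sym → (ℕ → ℕ → Prop) → ℕ → ℕ → Prop}
    (hφ : ∀ w T v, φ.eval w T v ↔ Step w T (v P) (v Q))
    {Final : List Sym → (ℕ → ℕ → Prop) → Prop} (hψ : ∀ w T v, ψ.eval w T v ↔ Final w T) :
    InPTime ({w | (wfRun w).accept = true ∧
      Final w (stages Step w (w.length * w.length))} : Language Sym) := by
  classical
  let f : List Sym → Bool := fun w => decide (Final w (stages Step w (w.length * w.length))) &&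
    (wfRun w).accept
  have key : Realizes (mainCmd φ ψ P Q R R') (fun w : List Sym => w.length)
      (fun w => stk [] { emptyMem with inp := w })
      (fun w => stk [] { emptyMem with out := [f w] }) := by
    let m₀ : List Sym → Mem := fun w =>
      (({ emptyMem with pos := fun _ => w.length } : Mem).setStates (wfStates w w.length)).push
        (wfRun w).accept
    let m₁ : List Sym → Mem := fun w => (m₀ w).setTable (stageTable Step w 0)
    let m₂ : List Sym → Mem := fun w => (m₁ w).setTable (stageTable Step w (w.length * w.length))
    have hready : ∀ w, (m₁ w).Ready [] w.length := fun w =>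
      ⟨by simp, fun _ _ => rfl, rfl, rfl, length_stageTable _ _ _⟩
    refine Realizes.load.seq ((Realizes.wfCmd (fun _ => rfl) (fun _ => rfl)).seq
      (Realizes.seq (S' := fun w => stk w (m₁ w)) ?_ (Realizes.seq (S' := fun w => stk w (m₂ w))
        (Realizes.rounds hPQ hPR hPR' hQR hQR' hRR' hφok hφ hready (fun _ => rfl) (fun _ => rfl))
        ((ψ.realizes [] hψok _ m₂ fun w => (hready w).setTable (length_stageTable _ _ _)).seq ?_))))
    -- Stage 0 is the empty relation, but its table must already have full length for lookups to
    -- work.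
    · refine Realizes.build hPQ (fun _ _ _ => false) (fun _ => rfl) (fun _ => rfl) (fun _ => rfl)
        (fun _ => Nat.zero_le _) (fun _ => rfl) (Realizes.act fun x => ?_)
      funext k
      cases k <;> simp [runOps, stk, Mem.setNew, Mem.set]
    · refine (Realizes.finish (fun w => ψ.value w (m₂ w)) (fun w => (wfRun w).accept) (fun _ => rfl)
        (fun _ => rfl) (fun _ => rfl) (fun _ => rfl) (fun w => length_stageTable _ _ _)
        (fun _ => rfl) (fun w => ?_)).congr (fun _ => rfl) fun w => ?_
      · exact (by simp [wfStates] : (wfStates w w.length).length = w.length + 1)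
      · have : ψ.value w (m₂ w) = decide (Final w (stages Step w (w.length * w.length))) := by
          rw [Bool.eq_iff_iff, Fm.value_eq_true_iff, hψ, decide_eq_true_iff, ← tabRel_stageTable]
          rfl
        rw [this]
  obtain ⟨q, hq⟩ := key
  refine ⟨f, fun w => ?_, ⟨?_⟩⟩
  · simp [f, and_comm]
    rfl
  · refine
      { tm := (mainCmd φ ψ P Q R R').machine .inp .out
        inputAlphabet := Equiv.refl Sym
        outputAlphabet := Equiv.refl Bool
        time := q + 1
        outputsFun := fun w => Classical.choice ?_ }
    obtain ⟨t, ht, h⟩ := hq w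
    refine Run.outputs (t := t) ?_ (by simpa using ht)
    refine (congrArg₂ (fun a b => Run _ a b t) ?_ ?_).mpr h
    · funext k
      cases k <;> simp [Turing.initList, stk, emptyMem, Cmd.machine]
      rfl
    · funext k
      cases k <;> simp [Turing.haltList, stk, emptyMem, Cmd.machine, Computability.encodeBool]
      rfl

/-! ### Simulations characterize fittings -/

theorem DL.isConcept_conj {L : DL} {C D : Concept} :
    L.IsConcept (.conj C D) ↔ L.IsConcept C ∧ L.IsConcept D := by
  cases L <;> simp [DL.IsConcept, Concept.NoInverse]

theorem DL.isConcept_ex_name {L : DL} {r : RoleName} {C : Concept} :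
    L.IsConcept (.ex (.name r) C) ↔ L.IsConcept C := by
  cases L <;> simp [DL.IsConcept, Concept.NoInverse]

theorem DL.isConcept_ex_inv {L : DL} {r : RoleName} {C : Concept} :
    L.IsConcept (.ex (.inv r) C) ↔ L = .ELIbot ∧ L.IsConcept C := by
  cases L <;> simp [DL.IsConcept, Concept.NoInverse]

theorem DL.isConcept_top {L : DL} : L.IsConcept .top := by
  cases L <;> trivial

theorem DL.isConcept_bot {L : DL} : L.IsConcept .bot := by
  cases L <;> trivial

def Assertion.inds : Assertion → List IndName
  | .concept _ a => [a]
  | .role _ a b => [a, b]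

/-- The individuals that occur in a set of assertions. -/
def inds (s : Set Assertion) : Set IndName := {a | ∃ α ∈ s, a ∈ α.inds}

/-- Simulations between sets of assertions; in the presence of inverse roles, they also respect
predecessors. -/
structure IsSimulation (L : DL) (s t : Set Assertion) (S : IndName → IndName → Prop) : Prop where
  concept : ∀ a b, S a b → ∀ A, .concept A a ∈ s → .concept A b ∈ t
  succ : ∀ a b, S a b → ∀ r a', .role r a a' ∈ s → ∃ b', .role r b b' ∈ t ∧ S a' b'
  pred : L = .ELIbot → ∀ a b, S a b → ∀ r a', .role r a' a ∈ s → ∃ b', .role r b' b ∈ t ∧ S a' b'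

def Simulated (L : DL) (s t : Set Assertion) (a b : IndName) : Prop :=
  ∃ S, IsSimulation L s t S ∧ S a b

theorem Interpretation.ext_subset (I : Interpretation) (C : Concept) : I.ext C ⊆ I.domain := by
  induction C with
  | top => exact subset_rfl
  | bot => exact Set.empty_subset _
  | atom A => exact I.concept_subset A
  | conj C D ihC _ => exact fun _ h => ihC h.1
  | ex r C _ =>
    rintro d ⟨e, h, -⟩
    cases r with
    | name r => exact (I.role_subset r h).1
    | inv r => exact (I.role_subset r h).2

/-- An ABox as an interpretation. -/
def ABox.interp (A : ABox) : Interpretation where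
  Other := Empty
  domain := Sum.inl '' inds (A.1 : Set Assertion)
  domain_nonempty := by
    obtain ⟨α, hα⟩ := A.2
    cases α with
    | concept N a => exact ⟨_, a, ⟨_, hα, by simp [Assertion.inds]⟩, rfl⟩
    | role r a b => exact ⟨_, a, ⟨_, hα, by simp [Assertion.inds]⟩, rfl⟩
  concept N := {d | ∃ a, d = Sum.inl a ∧ .concept N a ∈ A.1}
  concept_subset N := by
    rintro _ ⟨a, rfl, h⟩
    exact ⟨a, ⟨_, h, by simp [Assertion.inds]⟩, rfl⟩
  role r := {p | ∃ a b, p = (Sum.inl a, Sum.inl b) ∧ .role r a b ∈ A.1}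
  role_subset r := by
    rintro _ ⟨a, b, rfl, h⟩
    exact ⟨⟨a, ⟨_, h, by simp [Assertion.inds]⟩, rfl⟩, ⟨b, ⟨_, h, by simp [Assertion.inds]⟩, rfl⟩⟩

theorem ABox.interp_isModel (A : ABox) : A.interp.IsModelOfABox A := by
  intro α hα
  cases α with
  | concept N a => exact ⟨a, rfl, hα⟩
  | role r a b => exact ⟨a, b, rfl, hα⟩

/-- Apart from `⊥`, concepts are positive existential, hence preserved under the inclusion of the
ABox into a model. For `⊤` it matters that an individual occurring in an assertion lies in the
domain of every model. -/
theorem ABox.mem_ext_of_isModel {A : ABox} {I : Interpretation} (hI : I.IsModelOfABox A)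
    {C : Concept} {a : IndName} (h : Sum.inl a ∈ A.interp.ext C) : Sum.inl a ∈ I.ext C := by
  induction C generalizing a with
  | top =>
    obtain ⟨_, ⟨α, hα, ha⟩, ⟨⟩⟩ := h
    cases α with
    | concept N b =>
      obtain rfl : a = b := by simpa [Assertion.inds] using ha
      exact I.concept_subset _ (hI _ hα)
    | role r b c =>
      have := I.role_subset r (hI _ hα)
      rcases (by simpa [Assertion.inds] using ha : a = b ∨ a = c) with rfl | rfl
      · exact this.1
      · exact this.2
  | bot => exact h
  | atom N =>
    obtain ⟨_, ⟨⟩, h⟩ := h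
    exact hI _ h
  | conj C D ihC ihD => exact ⟨ihC h.1, ihD h.2⟩
  | ex r C ih =>
    obtain ⟨e, h, he⟩ := h
    cases r with
    | name r =>
      obtain ⟨a', b', heq, hr⟩ := h
      cases heq
      exact ⟨_, hI _ hr, ih he⟩
    | inv r =>
      obtain ⟨a', b', heq, hr⟩ := h
      cases heq
      exact ⟨_, hI _ hr, ih he⟩

/-- Finitely many properties that are inherited by conjunctions can be achieved at once. -/
theorem exists_concept_forall {L : DL} {I : Interpretation} {d : IndName ⊕ I.Other}
    (hd : d ∈ I.domain) {κ : Type} (T : Finset κ) (P : κ → Concept → Prop)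
    (hP : ∀ k C D, P k C ∨ P k D → P k (.conj C D))
    (h : ∀ k ∈ T, ∃ C, L.IsConcept C ∧ d ∈ I.ext C ∧ P k C) :
    ∃ C, L.IsConcept C ∧ d ∈ I.ext C ∧ ∀ k ∈ T, P k C := by
  classical
  induction T using Finset.induction_on with
  | empty => exact ⟨.top, DL.isConcept_top, hd, by simp⟩
  | insert k T _ ih =>
    obtain ⟨C, hC, hdC, hCk⟩ := ih fun k' hk' => h k' (Finset.mem_insert_of_mem hk')
    obtain ⟨D, hD, hdD, hDk⟩ := h k (Finset.mem_insert_self k T)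
    refine ⟨.conj C D, DL.isConcept_conj.2 ⟨hC, hD⟩, ⟨hdC, hdD⟩, fun k' hk' => hP _ _ _ ?_⟩
    rcases Finset.mem_insert.1 hk' with rfl | hk'
    · exact Or.inr hDk
    · exact Or.inl (hCk k' hk')

/-- A Hennessy–Milner argument: preservation of all concepts is itself a simulation. If every
counterpart of a neighbour `a'` failed some concept that `a'` has, the conjunction of these finitely
many concepts under the existential restriction would hold at `a` but not at `b`. -/
theorem simulated_of_forall_concept {L : DL} {A B : ABox} {a b : IndName}
    (ha : a ∈ inds (A.1 : Set Assertion)) (h : ∀ C, L.IsConcept C →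
      Sum.inl a ∈ A.interp.ext C → Sum.inl b ∈ B.interp.ext C) :
    Simulated L (A.1 : Set Assertion) (B.1 : Set Assertion) a b := by
  refine ⟨fun a b => a ∈ inds (A.1 : Set Assertion) ∧ ∀ C, L.IsConcept C →
    Sum.inl a ∈ A.interp.ext C → Sum.inl b ∈ B.interp.ext C, ⟨?_, ?_, ?_⟩, ha, h⟩
  · rintro a b ⟨-, h⟩ N hN
    obtain ⟨_, ⟨⟩, h⟩ := h (.atom N) (by cases L <;> trivial) ⟨a, rfl, hN⟩
    exact h
  · rintro a b ⟨-, h⟩ r a' hr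
    have ha' : a' ∈ inds (A.1 : Set Assertion) := ⟨_, hr, by simp [Assertion.inds]⟩
    by_contra hcon
    -- The conjunction ranges over the assertions of `B`; those that give no `r`-successor of `b`
    -- contribute `⊤`.
    obtain ⟨C, hC, haC, hCB⟩ := exists_concept_forall (L := L) (I := A.interp) ⟨a', ha', rfl⟩ B.1
      (fun α C => ∀ b', α = .role r b b' → Sum.inl b' ∉ B.interp.ext C)
      (fun α C D h b' hb' hCD => h.elim (fun h => h b' hb' hCD.1) (fun h => h b' hb' hCD.2))
      (fun α hα => by
        by_cases hαr : ∃ b', α = .role r b b'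
        · obtain ⟨b', rfl⟩ := hαr
          by_contra hno
          refine hcon ⟨b', hα, ha', fun C hC haC => by_contra fun hbC =>
            hno ⟨C, hC, haC, fun b'' hb'' => ?_⟩⟩
          cases hb''
          exact hbC
        · exact ⟨.top, DL.isConcept_top, ⟨a', ha', rfl⟩, fun b' hb' => absurd ⟨b', hb'⟩ hαr⟩)
    obtain ⟨e, ⟨b₁, b', heq, hr'⟩, he⟩ := h (.ex (.name r) C) (DL.isConcept_ex_name.2 hC)
      ⟨Sum.inl a', ⟨a, a', rfl, hr⟩, haC⟩
    cases heq
    exact hCB _ hr' b' rfl he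
  · rintro hL a b ⟨-, h⟩ r a' hr
    have ha' : a' ∈ inds (A.1 : Set Assertion) := ⟨_, hr, by simp [Assertion.inds]⟩
    by_contra hcon
    obtain ⟨C, hC, haC, hCB⟩ := exists_concept_forall (L := L) (I := A.interp) ⟨a', ha', rfl⟩ B.1
      (fun α C => ∀ b', α = .role r b' b → Sum.inl b' ∉ B.interp.ext C)
      (fun α C D h b' hb' hCD => h.elim (fun h => h b' hb' hCD.1) (fun h => h b' hb' hCD.2))
      (fun α hα => by
        by_cases hαr : ∃ b', α = .role r b' b
        · obtain ⟨b', rfl⟩ := hαr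
          by_contra hno
          refine hcon ⟨b', hα, ha', fun C hC haC => by_contra fun hbC =>
            hno ⟨C, hC, haC, fun b'' hb'' => ?_⟩⟩
          cases hb''
          exact hbC
        · exact ⟨.top, DL.isConcept_top, ⟨a', ha', rfl⟩, fun b' hb' => absurd ⟨b', hb'⟩ hαr⟩)
    obtain ⟨e, ⟨b', b₁, heq, hr'⟩, he⟩ := h (.ex (.inv r) C) (DL.isConcept_ex_inv.2 ⟨hL, hC⟩)
      ⟨Sum.inl a', ⟨a', a, rfl, hr⟩, haC⟩
    cases heq
    exact hCB _ hr' b' rfl he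

/-- By `simulated_of_forall_concept`, each individual of each `B` misses some concept of `a`; the
conjunction of these finitely many concepts is empty in `B`, whose domain consists of its
individuals only. -/
theorem exists_separating_concept {L : DL} {A : ABox} {a : IndName}
    (ha : a ∈ inds (A.1 : Set Assertion)) (T : Finset ABox)
    (h : ∀ B ∈ T, ∀ b ∈ inds (B.1 : Set Assertion),
      ¬ Simulated L (A.1 : Set Assertion) (B.1 : Set Assertion) a b) :
    ∃ C, L.IsConcept C ∧ Sum.inl a ∈ A.interp.ext C ∧ ∀ B ∈ T, B.interp.ext C = ∅ := by
  have hd : Sum.inl a ∈ A.interp.domain := ⟨a, ha, rfl⟩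
  have key : ∀ B ∈ T, ∃ C, L.IsConcept C ∧ Sum.inl a ∈ A.interp.ext C ∧
      ∀ α ∈ B.1, ∀ b ∈ α.inds, Sum.inl b ∉ B.interp.ext C := by
    intro B hB
    refine exists_concept_forall (L := L) (I := A.interp) hd B.1
      (fun α C => ∀ b ∈ α.inds, Sum.inl b ∉ B.interp.ext C)
      (fun α C D h b hb hCD => h.elim (fun h => h b hb hCD.1) (fun h => h b hb hCD.2)) fun α hα => ?_
    obtain ⟨C, hC, haC, hCT⟩ := exists_concept_forall (L := L) (I := A.interp) hd α.inds.toFinset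
      (fun b C => Sum.inl b ∉ B.interp.ext C)
      (fun b C D h hCD => h.elim (fun h => h hCD.1) (fun h => h hCD.2)) (fun b hb => by
        by_contra! hcon
        exact h B hB b ⟨α, hα, by simpa using hb⟩ (simulated_of_forall_concept ha hcon))
    exact ⟨C, hC, haC, fun b hb => hCT b (by simpa using hb)⟩
  obtain ⟨C, hC, haC, hCT⟩ := exists_concept_forall (L := L) (I := A.interp) hd T
    (fun B C => ∀ α ∈ B.1, ∀ b ∈ α.inds, Sum.inl b ∉ B.interp.ext C)
    (fun B C D h α hα b hb hCD => h.elim (fun h => h α hα b hb hCD.1)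
      (fun h => h α hα b hb hCD.2)) key
  refine ⟨C, hC, haC, fun B hB => Set.eq_empty_of_forall_notMem fun d hd => ?_⟩
  obtain ⟨b, ⟨α, hα, hb⟩, rfl⟩ := B.interp.ext_subset C hd
  exact hCT B hB α hα b hb hd

/-! ### Amalgamation of models: sets of elements of a disjoint union -/

section PowerModel

variable {κ : Type} (J : κ → Interpretation)

/-- The elements of the disjoint union of a family of interpretations, in a larger type. -/
abbrev UnionElt : Type := Σ k, IndName ⊕ (J k).Other

/-- Nonempty sets of elements of the disjoint union. -/
def PowerElt : Type := {X : Set (UnionElt J) // X.Nonempty ∧ ∀ u ∈ X, u.2 ∈ (J u.1).domain}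

variable {J} (L : DL) (D : Set IndName) (S : IndName → Set (UnionElt J))

/-- The set that an element of the power model stands for. -/
def powerSet : IndName ⊕ PowerElt J → Set (UnionElt J)
  | .inl a => S a
  | .inr X => X.1

/-- The power model of the disjoint union of the interpretations `J k`, with the individuals `a`
in `D` as names for the sets `S a`. -/
def powerModel (hD : D.Nonempty) : Interpretation where
  Other := PowerElt J
  domain := {d | ∀ a, d = .inl a → a ∈ D}
  domain_nonempty := by
    obtain ⟨a, ha⟩ := hD
    exact ⟨.inl a, fun b hb => by cases hb; exact ha⟩
  concept N := {d | (∀ a, d = .inl a → a ∈ D) ∧ ∀ u ∈ powerSet S d, u.2 ∈ (J u.1).concept N}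
  concept_subset N := fun _ h => h.1
  role r := {p | ((∀ a, p.1 = .inl a → a ∈ D) ∧ ∀ a, p.2 = .inl a → a ∈ D) ∧
    (∀ u ∈ powerSet S p.1, ∃ y, (u.2, y) ∈ (J u.1).role r ∧ ⟨u.1, y⟩ ∈ powerSet S p.2) ∧
    (L = .ELIbot → ∀ u ∈ powerSet S p.2, ∃ y, (y, u.2) ∈ (J u.1).role r ∧
      ⟨u.1, y⟩ ∈ powerSet S p.1)}
  role_subset r := fun _ h => h.1

/-- Nonemptiness of the sets settles `⊥`. For an existential restriction that holds at all members
of a set, the witness is the set `Y` of all neighbours of members that satisfy `C`; it is an element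
because all nonempty sets are. Every element of `Y` is reached from a member, which gives the
condition in the converse direction. That condition is part of a role only for ELI⊥, matching what
simulations respect. -/
theorem mem_ext_powerModel (hD : D.Nonempty) (hS : ∀ a ∈ D, (S a).Nonempty)
    (hSD : ∀ a ∈ D, ∀ u ∈ S a, u.2 ∈ (J u.1).domain) {C : Concept} (hC : L.IsConcept C)
    {d : IndName ⊕ PowerElt J} (hd : ∀ a, d = .inl a → a ∈ D) :
    d ∈ (powerModel L D S hD).ext C ↔ ∀ u ∈ powerSet S d, u.2 ∈ (J u.1).ext C := by
  have hne : ∀ d : IndName ⊕ PowerElt J, (∀ a, d = .inl a → a ∈ D) → (powerSet S d).Nonempty := by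
    rintro (a | X) h
    · exact hS a (h a rfl)
    · exact X.2.1
  have hdom : ∀ d : IndName ⊕ PowerElt J, (∀ a, d = .inl a → a ∈ D) →
      ∀ u ∈ powerSet S d, u.2 ∈ (J u.1).domain := by
    rintro (a | X) h
    · exact hSD a (h a rfl)
    · exact X.2.2
  induction C generalizing d with
  | top => exact ⟨fun _ => hdom d hd, fun _ => hd⟩
  | bot =>
    refine ⟨fun h => h.elim, fun h => ?_⟩
    obtain ⟨u, hu⟩ := hne d hd
    exact (h u hu).elim
  | atom N => exact ⟨fun h => h.2, fun h => ⟨hd, h⟩⟩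
  | conj C C' ih ih' =>
    obtain ⟨h, h'⟩ := DL.isConcept_conj.1 hC
    constructor
    · exact fun hd' u hu => ⟨(ih h hd).1 hd'.1 u hu, (ih' h' hd).1 hd'.2 u hu⟩
    · exact fun hu => ⟨(ih h hd).2 fun u h => (hu u h).1, (ih' h' hd).2 fun u h => (hu u h).2⟩
  | ex r C ih =>
    cases r with
    | name r =>
      replace ih := fun {d} => ih (DL.isConcept_ex_name.1 hC) (d := d)
      constructor
      · rintro ⟨e, ⟨⟨-, he⟩, hr, -⟩, heC⟩ u hu
        obtain ⟨y, hy, hye⟩ := hr u hu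
        exact ⟨y, hy, (ih he).1 heC _ hye⟩
      · intro h
        let Y : Set (UnionElt J) := {v | v.2 ∈ (J v.1).ext C ∧
          ∃ x, ⟨v.1, x⟩ ∈ powerSet S d ∧ (x, v.2) ∈ (J v.1).role r}
        have hY : Y.Nonempty := by
          obtain ⟨u, hu⟩ := hne d hd
          obtain ⟨y, hy, hyC⟩ := h u hu
          exact ⟨⟨u.1, y⟩, hyC, u.2, hu, hy⟩
        refine ⟨.inr ⟨Y, hY, fun v hv => (J v.1).ext_subset C hv.1⟩,
          ⟨⟨hd, by simp⟩, fun u hu => ?_, fun _ v hv => ?_⟩, (ih (by simp)).2 fun v hv => hv.1⟩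
        · obtain ⟨y, hy, hyC⟩ := h u hu
          exact ⟨y, hy, hyC, u.2, hu, hy⟩
        · obtain ⟨-, x, hx, hxv⟩ := hv
          exact ⟨x, hxv, hx⟩
    | inv r =>
      obtain ⟨hL, hC⟩ := DL.isConcept_ex_inv.1 hC
      replace ih := fun {d} => ih hC (d := d)
      constructor
      · rintro ⟨e, ⟨⟨he, -⟩, -, hr⟩, heC⟩ u hu
        obtain ⟨y, hy, hye⟩ := hr hL u hu
        exact ⟨y, hy, (ih he).1 heC _ hye⟩
      · intro h
        let Y : Set (UnionElt J) := {v | v.2 ∈ (J v.1).ext C ∧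
          ∃ x, ⟨v.1, x⟩ ∈ powerSet S d ∧ (v.2, x) ∈ (J v.1).role r}
        have hY : Y.Nonempty := by
          obtain ⟨u, hu⟩ := hne d hd
          obtain ⟨y, hy, hyC⟩ := h u hu
          exact ⟨⟨u.1, y⟩, hyC, u.2, hu, hy⟩
        refine ⟨.inr ⟨Y, hY, fun v hv => (J v.1).ext_subset C hv.1⟩,
          ⟨⟨by simp, hd⟩, fun v hv => ?_, fun _ u hu => ?_⟩, (ih (by simp)).2 fun v hv => hv.1⟩
        · obtain ⟨-, x, hx, hxv⟩ := hv
          exact ⟨x, hxv, hx⟩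
        · obtain ⟨y, hy, hyC⟩ := h u hu
          exact ⟨y, hy, hyC, u.2, hu, hy⟩

end PowerModel

theorem Simulated.concept {L : DL} {s t : Set Assertion} {a b : IndName} (h : Simulated L s t a b)
    {A : ConceptName} (hA : .concept A a ∈ s) : .concept A b ∈ t := by
  obtain ⟨S, hS, hab⟩ := h
  exact hS.concept a b hab A hA

theorem Simulated.succ {L : DL} {s t : Set Assertion} {a b a' : IndName} (h : Simulated L s t a b)
    {r : RoleName} (hr : .role r a a' ∈ s) : ∃ b', .role r b b' ∈ t ∧ Simulated L s t a' b' := by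
  obtain ⟨S, hS, hab⟩ := h
  obtain ⟨b', hb, hab'⟩ := hS.succ a b hab r a' hr
  exact ⟨b', hb, S, hS, hab'⟩

theorem Simulated.pred {s t : Set Assertion} {a b a' : IndName}
    (h : Simulated .ELIbot s t a b) {r : RoleName} (hr : .role r a' a ∈ s) :
    ∃ b', .role r b' b ∈ t ∧ Simulated .ELIbot s t a' b' := by
  obtain ⟨S, hS, hab⟩ := h
  obtain ⟨b', hb, hab'⟩ := hS.pred rfl a b hab r a' hr
  exact ⟨b', hb, S, hS, hab'⟩

theorem mem_domain_of_isModel {A : ABox} {I : Interpretation} (hI : I.IsModelOfABox A)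
    {a : IndName} (ha : a ∈ inds (A.1 : Set Assertion)) : Sum.inl a ∈ I.domain :=
  ABox.mem_ext_of_isModel (C := .top) hI ⟨a, ha, rfl⟩

/-- An individual of `A` stands for the set of all individuals of ABoxes in `T` that simulate it,
located in the chosen models. The clauses of a simulation are what the assertions of `A` need in the
power model. An inclusion passes from all members of a set to the set by `mem_ext_powerModel`. -/
theorem consistent_of_simulated {L : DL} {O : Ontology L} {T : Finset ABox}
    (hT : ∀ B ∈ T, Consistent B O) {A : ABox}
    (h : ∀ a ∈ inds (A.1 : Set Assertion), ∃ B ∈ T, ∃ b ∈ inds (B.1 : Set Assertion),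
      Simulated L (A.1 : Set Assertion) (B.1 : Set Assertion) a b) : Consistent A O := by
  choose J hJ hJO using fun B : {B // B ∈ T} => hT B.1 B.2
  let S : IndName → Set (UnionElt J) := fun a => {u | ∃ (B : {B // B ∈ T}) (b : IndName),
    u = ⟨B, .inl b⟩ ∧ b ∈ inds (B.1.1 : Set Assertion) ∧
      Simulated L (A.1 : Set Assertion) (B.1.1 : Set Assertion) a b}
  let D : Set IndName := inds (A.1 : Set Assertion)
  have hD : D.Nonempty := by
    obtain ⟨_, a, ha, -⟩ := A.interp.domain_nonempty
    exact ⟨a, ha⟩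
  have hS : ∀ a ∈ D, (S a).Nonempty := by
    intro a ha
    obtain ⟨B, hB, b, hb, hab⟩ := h a ha
    exact ⟨⟨⟨B, hB⟩, .inl b⟩, ⟨B, hB⟩, b, rfl, hb, hab⟩
  have hSD : ∀ a ∈ D, ∀ u ∈ S a, u.2 ∈ (J u.1).domain := by
    rintro a - _ ⟨B, b, rfl, hb, -⟩
    exact mem_domain_of_isModel (hJ B) hb
  refine ⟨powerModel L D S hD, fun α hα => ?_, fun i hi d hd => ?_⟩
  · cases α with
    | concept N a =>
      refine ⟨?_, ?_⟩
      · rintro _ ⟨⟩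
        exact ⟨_, hα, by simp [Assertion.inds]⟩
      · rintro _ ⟨B, b, rfl, hb, hab⟩
        exact hJ B _ (hab.concept hα)
    | role r a a' =>
      refine ⟨⟨?_, ?_⟩, ?_, ?_⟩
      · rintro _ ⟨⟩
        exact ⟨_, hα, by simp [Assertion.inds]⟩
      · rintro _ ⟨⟩
        exact ⟨_, hα, by simp [Assertion.inds]⟩
      · rintro _ ⟨B, b, rfl, hb, hab⟩
        obtain ⟨b', hb', hab'⟩ := hab.succ hα
        exact ⟨.inl b', hJ B _ hb', B, b', rfl, ⟨_, hb', by simp [Assertion.inds]⟩, hab'⟩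
      · rintro rfl _ ⟨B, b, rfl, hb, hab⟩
        obtain ⟨b', hb', hab'⟩ := hab.pred hα
        exact ⟨.inl b', hJ B _ hb', B, b', rfl, ⟨_, hb', by simp [Assertion.inds]⟩, hab'⟩
  · have hdD := (powerModel L D S hD).ext_subset _ hd
    have hC := O.isConcept i hi
    exact (mem_ext_powerModel L D S hD hS hSD hC.2 hdD).2 fun u hu =>
      hJO u.1 i hi ((mem_ext_powerModel L D S hD hS hSD hC.1 hdD).1 hd u hu)

/-- The left-to-right direction is the contrapositive of `consistent_of_simulated`. For the other
one, a separating concept for each negative ABox is declared unsatisfiable. -/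
theorem admitsFitting_iff (L : DL) (E : LabeledExamples) :
    AdmitsFitting L E ↔ ∀ A ∈ E.neg, ∃ a ∈ inds (A.1 : Set Assertion), ∀ B ∈ E.pos,
      ∀ b ∈ inds (B.1 : Set Assertion),
        ¬ Simulated L (A.1 : Set Assertion) (B.1 : Set Assertion) a b := by
  classical
  constructor
  · rintro ⟨O, hpos, hneg⟩ A hA
    by_contra! hcon
    exact hneg A hA (consistent_of_simulated hpos hcon)
  · intro h
    choose a ha hab using fun A : {A // A ∈ E.neg} => h A.1 A.2
    choose C hC haC hCE using fun A => exists_separating_concept (ha A) E.pos (hab A)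
    refine ⟨⟨E.neg.attach.image fun A => ⟨C A, .bot⟩, ?_⟩, fun B hB => ?_, fun A hA => ?_⟩
    · intro i hi
      obtain ⟨A, -, rfl⟩ := Finset.mem_image.1 hi
      exact ⟨hC A, DL.isConcept_bot⟩
    · refine ⟨B.interp, B.interp_isModel, fun i hi => ?_⟩
      obtain ⟨A, -, rfl⟩ := Finset.mem_image.1 hi
      exact (hCE A B hB).subset
    · rintro ⟨I, hIA, hmod⟩
      exact hmod _ (Finset.mem_image.2 ⟨⟨A, hA⟩, Finset.mem_attach _ _, rfl⟩)
        (ABox.mem_ext_of_isModel hIA (haC ⟨A, hA⟩))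

/-! ### Well-formed words -/

def encodeAll (xs : List (Bool × List Assertion)) : List Sym := xs.flatMap encodeExample

def labelSym (l : Bool) : Sym := if l then .posMark else .negMark

theorem encodeExample_eq (x : Bool × List Assertion) :
    encodeExample x = labelSym x.1 :: x.2.flatMap encodeAssertion := rfl

def NonemptyExamples (xs : List (Bool × List Assertion)) : Prop := ∀ x ∈ xs, x.2 ≠ []

/-- A beginning of a description that ends in the middle of an example. -/
def IsOpenPrefix (u : List Sym) : Prop :=
  ∃ (xs : List (Bool × List Assertion)) (l : Bool) (as : List Assertion), NonemptyExamples xs ∧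
    u = encodeAll xs ++ labelSym l :: as.flatMap encodeAssertion

/-- What is known of the word read so far. `label` is kept apart from `last` since an example
without assertions is not complete; `dead` never accepts and needs no information. -/
def WfState.Inv : WfState → List Sym → Prop
  | .start, u => u = []
  | .label, u => ∃ xs l, NonemptyExamples xs ∧ u = encodeAll xs ++ [labelSym l]
  | .conceptName, u => ∃ v A, IsOpenPrefix v ∧ u = v ++ Sym.conceptMark :: encodeName A
  | .roleName, u => ∃ v r, IsOpenPrefix v ∧ u = v ++ Sym.roleMark :: encodeName r
  | .source, u => ∃ v r a, IsOpenPrefix v ∧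
      u = v ++ (Sym.roleMark :: encodeName r ++ Sym.comma :: encodeName a)
  | .last, u => ∃ v α, IsOpenPrefix v ∧ u = v ++ encodeAssertion α
  | .dead, _ => True

theorem encodeName_append (A : List Bool) (b : Bool) :
    encodeName (A ++ [b]) = encodeName A ++ [.bit b] := by
  simp [encodeName]

theorem IsOpenPrefix.append {u : List Sym} (h : IsOpenPrefix u) (α : Assertion) :
    IsOpenPrefix (u ++ encodeAssertion α) := by
  obtain ⟨xs, l, as, hxs, rfl⟩ := h
  exact ⟨xs, l, as ++ [α], hxs, by simp⟩

theorem IsOpenPrefix.append_eq_encodeAll {u : List Sym} (h : IsOpenPrefix u) (α : Assertion) :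
    ∃ xs, NonemptyExamples xs ∧ u ++ encodeAssertion α = encodeAll xs := by
  obtain ⟨xs, l, as, hxs, rfl⟩ := h
  refine ⟨xs ++ [(l, as ++ [α])], ?_, by simp [encodeAll, encodeExample_eq]⟩
  intro x hx
  rcases List.mem_append.1 hx with hx | hx
  · exact hxs x hx
  · simp only [List.mem_singleton] at hx
    subst hx
    simp

theorem WfState.Inv.next {q : WfState} {u : List Sym} (h : q.Inv u) (a : Sym) :
    (q.next a).Inv (u ++ [a]) := by
  have hlabel : ∀ l, q = .last → WfState.label.Inv (u ++ [labelSym l]) := by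
    rintro l rfl
    obtain ⟨v, α, hv, rfl⟩ := h
    obtain ⟨xs, hxs, hu⟩ := hv.append_eq_encodeAll α
    exact ⟨xs, l, hxs, by rw [hu]⟩
  have hopen : q = .label ∨ q = .last → IsOpenPrefix u := by
    rintro (rfl | rfl)
    · obtain ⟨xs, l, hxs, rfl⟩ := h
      exact ⟨xs, l, [], hxs, by simp⟩
    · obtain ⟨v, α, hv, rfl⟩ := h
      exact hv.append α
  cases q with
  | start =>
    cases h
    cases a with
    | posMark => exact ⟨[], true, by simp [NonemptyExamples], rfl⟩
    | negMark => exact ⟨[], false, by simp [NonemptyExamples], rfl⟩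
    | _ => trivial
  | label =>
    cases a with
    | conceptMark => exact ⟨u, [], hopen (by simp), rfl⟩
    | roleMark => exact ⟨u, [], hopen (by simp), rfl⟩
    | _ => trivial
  | conceptName =>
    obtain ⟨v, A, hv, rfl⟩ := h
    cases a with
    | bit b => exact ⟨v, A ++ [b], hv, by simp [encodeName_append]⟩
    | comma => exact ⟨v, .concept A [], hv, by simp [encodeAssertion, encodeName]⟩
    | _ => trivial
  | roleName =>
    obtain ⟨v, r, hv, rfl⟩ := h
    cases a with
    | bit b => exact ⟨v, r ++ [b], hv, by simp [encodeName_append]⟩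
    | comma => exact ⟨v, r, [], hv, by simp [encodeName]⟩
    | _ => trivial
  | source =>
    obtain ⟨v, r, c, hv, rfl⟩ := h
    cases a with
    | bit b => exact ⟨v, r, c ++ [b], hv, by simp [encodeName_append]⟩
    | comma => exact ⟨v, .role r c [], hv, by simp [encodeAssertion, encodeName]⟩
    | _ => trivial
  | last =>
    cases a with
    | conceptMark => exact ⟨u, [], hopen (by simp), rfl⟩
    | roleMark => exact ⟨u, [], hopen (by simp), rfl⟩
    | posMark => exact hlabel true rfl
    | negMark => exact hlabel false rfl
    | comma => trivial
    | bit b =>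
      obtain ⟨v, α, hv, rfl⟩ := h
      cases α with
      | concept A c => exact ⟨v, .concept A (c ++ [b]), hv, by
          simp [encodeAssertion, encodeName_append]⟩
      | role r c d => exact ⟨v, .role r c (d ++ [b]), hv, by
          simp [encodeAssertion, encodeName_append]⟩
  | dead => trivial

theorem wfRun_inv (w : List Sym) : (wfRun w).Inv w := by
  induction w using List.reverseRecOn with
  | nil => rfl
  | append_singleton w a ih =>
    rw [wfRun, List.foldl_append]
    exact ih.next a

theorem foldl_next_encodeName {q : WfState} (hq : ∀ b, q.next (.bit b) = q) (A : List Bool) :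
    (encodeName A).foldl WfState.next q = q := by
  induction A with
  | nil => rfl
  | cons b A ih => simpa [encodeName, hq] using ih

theorem foldl_next_encodeAssertion {q : WfState} (hq : q = .label ∨ q = .last) (α : Assertion) :
    (encodeAssertion α).foldl WfState.next q = .last := by
  have h1 : q.next .conceptMark = .conceptName := by rcases hq with rfl | rfl <;> rfl
  have h2 : q.next .roleMark = .roleName := by rcases hq with rfl | rfl <;> rfl
  cases α with
  | concept A a =>
    simp only [encodeAssertion, List.cons_append, List.foldl_cons, List.foldl_append, h1]
    rw [foldl_next_encodeName (q := .conceptName) (fun _ => rfl)]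
    exact foldl_next_encodeName (q := .last) (fun _ => rfl) a
  | role r a b =>
    simp only [encodeAssertion, List.cons_append, List.foldl_cons, List.foldl_append, h2]
    rw [foldl_next_encodeName (q := .roleName) (fun _ => rfl)]
    rw [show WfState.roleName.next .comma = .source from rfl,
      foldl_next_encodeName (q := .source) (fun _ => rfl)]
    exact foldl_next_encodeName (q := .last) (fun _ => rfl) b

theorem foldl_next_flatMap {q : WfState} (hq : q = .label ∨ q = .last) {as : List Assertion}
    (has : as ≠ []) : (as.flatMap encodeAssertion).foldl WfState.next q = .last := by
  induction as generalizing q with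
  | nil => exact absurd rfl has
  | cons α as ih =>
    rw [List.flatMap_cons, List.foldl_append, foldl_next_encodeAssertion hq]
    cases as with
    | nil => rfl
    | cons β as => exact ih (Or.inr rfl) (by simp)

theorem foldl_next_encodeAll {q : WfState} (hq : q = .start ∨ q = .last)
    {xs : List (Bool × List Assertion)} (hxs : NonemptyExamples xs) :
    ((encodeAll xs).foldl WfState.next q).accept = true := by
  induction xs generalizing q with
  | nil => rcases hq with rfl | rfl <;> rfl
  | cons x xs ih =>
    have h1 : q.next (labelSym x.1) = .label := by
      rcases hq with rfl | rfl <;> cases x.1 <;> rfl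
    rw [encodeAll, List.flatMap_cons, List.foldl_append, encodeExample_eq, List.foldl_cons, h1,
      foldl_next_flatMap (Or.inl rfl) (hxs x (by simp))]
    exact ih (Or.inr rfl) fun y hy => hxs y (by simp [hy])

/-- Of the states with acceptance, `start` has read the empty word, and `last` a prefix whose
current example has an assertion and can thus be closed. -/
theorem wfRun_accept_iff (w : List Sym) :
    (wfRun w).accept = true ↔ ∃ xs, NonemptyExamples xs ∧ w = encodeAll xs := by
  constructor
  · intro h
    have hinv := wfRun_inv w
    cases hq : wfRun w <;> rw [hq] at h hinv <;> try (simp [WfState.accept] at h; done)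
    · exact ⟨[], by simp [NonemptyExamples], hinv⟩
    · obtain ⟨v, α, hv, rfl⟩ := hinv
      exact hv.append_eq_encodeAll α
  · rintro ⟨xs, hxs, rfl⟩
    exact foldl_next_encodeAll (Or.inl rfl) hxs

/-! ### Positions in words -/

/-- The symbol at position `p` has the property `s`. -/
def At (w : List Sym) (p : ℕ) (s : Sym → Bool) : Prop := ∃ a, w[p]? = some a ∧ s a = true

theorem At.lt_length {w : List Sym} {p : ℕ} {s : Sym → Bool} (h : At w p s) : p < w.length := by
  obtain ⟨a, ha, -⟩ := h
  exact (List.getElem?_eq_some_iff.1 ha).1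

def Sym.isLabel : Sym → Bool
  | .posMark => true
  | .negMark => true
  | _ => false

/-- Position `c` carries the comma that directly follows the name at position `m`. -/
def NextComma (w : List Sym) (m c : ℕ) : Prop :=
  m < c ∧ At w c (· == .comma) ∧ ∀ z < w.length, m < z → z < c → At w z Sym.isBit

/-- There is no label strictly after `e` and up to `p`. -/
def InExample (w : List Sym) (e p : ℕ) : Prop :=
  e < p ∧ ∀ z < w.length, At w z Sym.isLabel → e < z → p < z

/-- The example `x` is described from position `e` on. -/
def DescribedAt (xs : List (Bool × List Assertion)) (e : ℕ) (x : Bool × List Assertion) : Prop :=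
  ∃ xs₁ xs₂, xs = xs₁ ++ x :: xs₂ ∧ e = (encodeAll xs₁).length

/-- The word does not begin with a bit. -/
def StartsNoBit (u : List Sym) : Prop := ∀ a, u.head? = some a → a.isBit = false

/-- Whatever follows a name starts with a symbol other than a bit, so the maximal block of bits in
`nameAt` is exactly that name. -/
theorem startsNoBit_encodeAll (xs : List (Bool × List Assertion)) : StartsNoBit (encodeAll xs) := by
  intro a ha
  cases xs with
  | nil => simp [encodeAll] at ha
  | cons x xs =>
    have : labelSym x.1 = a := by simpa [encodeAll, encodeExample_eq] using ha
    subst this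
    cases x.1 <;> rfl

theorem startsNoBit_flatMap (as : List Assertion) {u : List Sym} (hu : StartsNoBit u) :
    StartsNoBit (as.flatMap encodeAssertion ++ u) := by
  intro a ha
  cases as with
  | nil => exact hu a (by simpa using ha)
  | cons α as =>
    cases α with
    | concept A b =>
      have : Sym.conceptMark = a := by simpa [encodeAssertion] using ha
      subst this; rfl
    | role r b c =>
      have : Sym.roleMark = a := by simpa [encodeAssertion] using ha
      subst this; rfl

theorem drop_of_describedAt {xs : List (Bool × List Assertion)} {e : ℕ}
    {x : Bool × List Assertion} (h : DescribedAt xs e x) :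
    ∃ u, (encodeAll xs).drop e = labelSym x.1 :: (x.2.flatMap encodeAssertion ++ u) ∧
      StartsNoBit u ∧ (u = [] ∨ ∃ a u', u = a :: u' ∧ a.isLabel = true) := by
  obtain ⟨xs₁, xs₂, rfl, rfl⟩ := h
  refine ⟨encodeAll xs₂, ?_, startsNoBit_encodeAll xs₂, ?_⟩
  · simp [encodeAll, encodeExample_eq]
  · cases xs₂ with
    | nil => exact Or.inl rfl
    | cons y ys =>
      refine Or.inr ⟨labelSym y.1, y.2.flatMap encodeAssertion ++ encodeAll ys, by
        simp [encodeAll, encodeExample_eq], ?_⟩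
      cases y.1 <;> rfl

theorem isLabel_of_mem_flatMap {as : List Assertion} {a : Sym}
    (h : a ∈ as.flatMap encodeAssertion) : a.isLabel = false := by
  obtain ⟨α, -, ha⟩ := List.mem_flatMap.1 h
  cases α with
  | concept A b =>
    simp only [encodeAssertion, encodeName, List.mem_cons, List.mem_append, List.mem_map] at ha
    rcases ha with (rfl | ⟨_, _, rfl⟩) | rfl | ⟨_, _, rfl⟩ <;> rfl
  | role r b c =>
    simp only [encodeAssertion, encodeName, List.mem_cons, List.mem_append, List.mem_map] at ha
    rcases ha with ((rfl | ⟨_, _, rfl⟩) | rfl | ⟨_, _, rfl⟩) | rfl | ⟨_, _, rfl⟩ <;> rfl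

/-- Assertions contain no labels, so a label can only be the first symbol of an example. -/
theorem describedAt_of_isLabel {xs : List (Bool × List Assertion)} {e : ℕ} {a : Sym}
    (h : (encodeAll xs)[e]? = some a) (ha : a.isLabel = true) :
    ∃ x, DescribedAt xs e x ∧ a = labelSym x.1 := by
  induction xs generalizing e with
  | nil => simp [encodeAll] at h
  | cons x xs ih =>
    have h' : (encodeExample x ++ encodeAll xs)[e]? = some a := h
    by_cases he : e < (encodeExample x).length
    · rw [List.getElem?_append_left he, encodeExample_eq] at h'
      cases e with
      | zero => exact ⟨x, ⟨[], xs, rfl, rfl⟩, by simpa using h'.symm⟩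
      | succ e =>
        rw [List.getElem?_cons_succ] at h'
        rw [isLabel_of_mem_flatMap (List.mem_of_getElem? h')] at ha
        cases ha
    · rw [List.getElem?_append_right (by omega)] at h'
      obtain ⟨y, ⟨xs₁, xs₂, rfl, hlen⟩, hy⟩ := ih h'
      refine ⟨y, ⟨x :: xs₁, xs₂, rfl, ?_⟩, hy⟩
      simp only [encodeAll, List.flatMap_cons, List.length_append] at hlen ⊢
      omega

theorem getElem?_of_describedAt {xs : List (Bool × List Assertion)} {e : ℕ}
    {x : Bool × List Assertion} (h : DescribedAt xs e x) :
    (encodeAll xs)[e]? = some (labelSym x.1) := by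
  obtain ⟨u, hu, -⟩ := drop_of_describedAt h
  rw [← List.head?_drop, hu]
  rfl

theorem exists_describedAt {xs : List (Bool × List Assertion)} {x : Bool × List Assertion}
    (h : x ∈ xs) : ∃ e, DescribedAt xs e x := by
  obtain ⟨xs₁, xs₂, rfl⟩ := List.append_of_mem h
  exact ⟨_, xs₁, xs₂, rfl, rfl⟩

theorem DescribedAt.mem {xs : List (Bool × List Assertion)} {e : ℕ} {x : Bool × List Assertion}
    (h : DescribedAt xs e x) : x ∈ xs := by
  obtain ⟨xs₁, xs₂, rfl, -⟩ := h
  simp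

/-- The assertion `α` of the example at `e` is described from position `m` on. -/
def AssertionAt (w : List Sym) (m : ℕ) (α : Assertion) : Prop :=
  ∃ u, w.drop m = encodeAssertion α ++ u ∧ StartsNoBit u

theorem exists_assertion_of_lt {as : List Assertion} {u : List Sym} (hu : StartsNoBit u) {k : ℕ}
    (hk : k < (as.flatMap encodeAssertion).length) :
    ∃ α ∈ as, ∃ j ≤ k, k < j + (encodeAssertion α).length ∧
      AssertionAt (as.flatMap encodeAssertion ++ u) j α := by
  induction as generalizing k with
  | nil => simp at hk
  | cons α as ih =>
    rw [List.flatMap_cons] at hk ⊢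
    by_cases h : k < (encodeAssertion α).length
    · exact ⟨α, by simp, 0, by omega, by omega, as.flatMap encodeAssertion ++ u, by simp,
        startsNoBit_flatMap as hu⟩
    · rw [List.length_append] at hk
      obtain ⟨β, hβ, j, hj, hkj, v, hv, hv'⟩ := ih (k := k - (encodeAssertion α).length) (by omega)
      refine ⟨β, by simp [hβ], (encodeAssertion α).length + j, by omega, by omega, v, ?_, hv'⟩
      rw [List.append_assoc, ← List.drop_drop, List.drop_left, hv]

theorem exists_position_of_mem {as : List Assertion} {u : List Sym} (hu : StartsNoBit u)
    {α : Assertion} (hα : α ∈ as) :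
    ∃ j, j + (encodeAssertion α).length ≤ (as.flatMap encodeAssertion).length ∧
      AssertionAt (as.flatMap encodeAssertion ++ u) j α := by
  obtain ⟨as₁, as₂, rfl⟩ := List.append_of_mem hα
  refine ⟨(as₁.flatMap encodeAssertion).length, by simp, as₂.flatMap encodeAssertion ++ u, ?_,
    startsNoBit_flatMap as₂ hu⟩
  simp

theorem encodeAssertion_length_pos (α : Assertion) : 0 < (encodeAssertion α).length := by
  cases α <;> simp [encodeAssertion]

section Example

variable {xs : List (Bool × List Assertion)} {e : ℕ} {x : Bool × List Assertion}

theorem AssertionAt.of_drop {w v : List Sym} {k j : ℕ} {α : Assertion} (h : w.drop k = v)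
    (hv : AssertionAt v j α) : AssertionAt w (k + j) α := by
  obtain ⟨u, hu, hu'⟩ := hv
  exact ⟨u, by rw [← List.drop_drop, h, hu], hu'⟩

theorem DescribedAt.exists_assertion (hx : DescribedAt xs e x) {p : ℕ}
    (hp : InExample (encodeAll xs) e p) (hpl : p < (encodeAll xs).length) :
    ∃ α ∈ x.2, ∃ m ≤ p, p < m + (encodeAssertion α).length ∧ e < m ∧
      AssertionAt (encodeAll xs) m α := by
  obtain ⟨u, hu, hu', hlabel⟩ := drop_of_describedAt hx
  have hdrop : (encodeAll xs).drop (e + 1) = x.2.flatMap encodeAssertion ++ u := by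
    rw [← List.drop_drop, hu]
    rfl
  have hlen : (encodeAll xs).length = e + 1 + ((x.2.flatMap encodeAssertion).length + u.length) := by
    have := congrArg List.length hdrop
    have := hp.1
    simp only [List.length_drop, List.length_append] at *
    omega
  have hk : p - (e + 1) < (x.2.flatMap encodeAssertion).length := by
    have hep := hp.1
    -- A position behind the assertions of `x` is either outside the word or not before the label of
    -- the next example, which `InExample` forbids.
    by_contra hcon
    rcases hlabel with rfl | ⟨a, u', rfl, ha⟩
    · simp only [List.length_nil] at hlen
      omega
    · have hz : (encodeAll xs)[e + 1 + (x.2.flatMap encodeAssertion).length]? = some a := by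
        rw [← List.head?_drop, ← List.drop_drop, hdrop, List.drop_left]
        rfl
      have := hp.2 _ (List.getElem?_eq_some_iff.1 hz).1 ⟨a, hz, ha⟩ (by omega)
      omega
  obtain ⟨α, hα, j, hj, hkj, hat⟩ := exists_assertion_of_lt hu' hk
  have := hp.1
  exact ⟨α, hα, e + 1 + j, by omega, by omega, by omega, hat.of_drop hdrop⟩

theorem DescribedAt.exists_position (hx : DescribedAt xs e x) {α : Assertion} (hα : α ∈ x.2) :
    ∃ m, InExample (encodeAll xs) e m ∧ AssertionAt (encodeAll xs) m α := by
  obtain ⟨u, hu, hu', hlabel⟩ := drop_of_describedAt hx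
  have hdrop : (encodeAll xs).drop (e + 1) = x.2.flatMap encodeAssertion ++ u := by
    rw [← List.drop_drop, hu]
    rfl
  obtain ⟨j, hj, hat⟩ := exists_position_of_mem hu' hα
  refine ⟨e + 1 + j, ⟨by omega, fun z hz hzl hez => ?_⟩, hat.of_drop hdrop⟩
  by_contra hcon
  obtain ⟨a, ha, hal⟩ := hzl
  have hpos := encodeAssertion_length_pos α
  have h1 : (x.2.flatMap encodeAssertion ++ u)[z - (e + 1)]? = some a := by
    rw [← hdrop, List.getElem?_drop, ← ha]
    congr 1
    omega
  rw [List.getElem?_append_left (by omega)] at h1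
  rw [isLabel_of_mem_flatMap (List.mem_of_getElem? h1)] at hal
  cases hal

end Example

/-! ### Names at positions -/

theorem nameAt_of_drop {w : List Sym} {p : ℕ} {s : Sym} {A : List Bool} {u : List Sym}
    (h : w.drop p = s :: (encodeName A ++ u)) (hu : StartsNoBit u) :
    nameAt w p = encodeName A := by
  have h' : w.drop (p + 1) = encodeName A ++ u := by
    rw [← List.drop_drop, h]
    rfl
  rw [nameAt, h', List.takeWhile_append_of_pos]
  · cases u with
    | nil => simp
    | cons a u => simp [hu a rfl]
  · intro a ha
    obtain ⟨b, -, rfl⟩ := List.mem_map.1 ha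
    rfl

theorem drop_after_name {w : List Sym} {p : ℕ} {s : Sym} {A : List Bool} {u : List Sym}
    (h : w.drop p = s :: (encodeName A ++ u)) : w.drop (p + (1 + A.length)) = u := by
  rw [← List.drop_drop, h, add_comm, List.drop_succ_cons]
  have : A.length = (encodeName A).length := by simp [encodeName]
  rw [this, List.drop_left]

theorem at_of_drop {w : List Sym} {p : ℕ} {a : Sym} {u : List Sym} {s : Sym → Bool}
    (h : w.drop p = a :: u) (ha : s a = true) : At w p s :=
  ⟨a, by rw [← List.head?_drop, h]; rfl, ha⟩

/-- A smaller candidate would carry a bit instead of a comma, and a larger one would have this comma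
among the symbols required to be bits. -/
theorem nextComma_iff {w : List Sym} {p c : ℕ} {s : Sym} {A : List Bool} {u : List Sym}
    (h : w.drop p = s :: (encodeName A ++ Sym.comma :: u)) :
    NextComma w p c ↔ c = p + (1 + A.length) := by
  have hcomma := drop_after_name h
  have hbit : ∀ z, p < z → z < p + (1 + A.length) → ∃ b, w[z]? = some (.bit b) := by
    intro z hz hz'
    obtain ⟨k, rfl⟩ : ∃ k, z = p + (1 + k) := ⟨z - p - 1, by omega⟩
    have hk : k < A.length := by omega
    refine ⟨A[k], ?_⟩
    rw [← List.getElem?_drop, h, add_comm, List.getElem?_cons_succ,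
      List.getElem?_append_left (by simpa [encodeName] using hk)]
    simp [encodeName, hk]
  have hc : w[p + (1 + A.length)]? = some .comma := by
    rw [← List.head?_drop, hcomma]
    rfl
  constructor
  · rintro ⟨hpc, ⟨a, ha, hac⟩, hz⟩
    obtain rfl : a = .comma := by simpa using hac
    by_contra hne
    rcases lt_or_gt_of_ne hne with hlt | hgt
    · obtain ⟨b, hb⟩ := hbit c hpc hlt
      rw [hb] at ha
      cases ha
    · obtain ⟨a, ha, hab⟩ := hz _ (List.getElem?_eq_some_iff.1 hc).1 (by omega) hgt
      rw [hc] at ha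
      cases ha
      cases hab
  · rintro rfl
    refine ⟨by omega, ⟨_, hc, rfl⟩, fun z _ hz hz' => ?_⟩
    obtain ⟨b, hb⟩ := hbit z hz hz'
    exact ⟨_, hb, rfl⟩

theorem startsNoBit_comma (u : List Sym) : StartsNoBit (Sym.comma :: u) := by
  intro a ha
  cases ha
  rfl

/-- A concept assertion with its mark at `m` and its individual at `c`. -/
def ConceptFact (w : List Sym) (m c : ℕ) : Prop := At w m (· == .conceptMark) ∧ NextComma w m c

/-- A role assertion with its mark at `m` and its individuals at `c` and `d`. -/
def RoleFact (w : List Sym) (m c d : ℕ) : Prop :=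
  At w m (· == .roleMark) ∧ NextComma w m c ∧ NextComma w c d

theorem AssertionAt.concept {w : List Sym} {m : ℕ} {A : ConceptName} {a : IndName}
    (h : AssertionAt w m (.concept A a)) : At w m (· == .conceptMark) ∧ nameAt w m = encodeName A ∧
      (∀ c, NextComma w m c ↔ c = m + (1 + A.length)) ∧
      nameAt w (m + (1 + A.length)) = encodeName a := by
  obtain ⟨u, hu, hu'⟩ := h
  have h1 : w.drop m = Sym.conceptMark :: (encodeName A ++ Sym.comma :: (encodeName a ++ u)) := by
    simpa [encodeAssertion] using hu
  exact ⟨at_of_drop h1 rfl, nameAt_of_drop h1 (startsNoBit_comma _), fun c => nextComma_iff h1,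
    nameAt_of_drop (drop_after_name h1) hu'⟩

theorem AssertionAt.role {w : List Sym} {m : ℕ} {r : RoleName} {a b : IndName}
    (h : AssertionAt w m (.role r a b)) : At w m (· == .roleMark) ∧ nameAt w m = encodeName r ∧
      (∀ c, NextComma w m c ↔ c = m + (1 + r.length)) ∧
      nameAt w (m + (1 + r.length)) = encodeName a ∧
      (∀ d, NextComma w (m + (1 + r.length)) d ↔ d = m + (1 + r.length) + (1 + a.length)) ∧
      nameAt w (m + (1 + r.length) + (1 + a.length)) = encodeName b := by
  obtain ⟨u, hu, hu'⟩ := h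
  have h1 : w.drop m = Sym.roleMark :: (encodeName r ++ Sym.comma :: (encodeName a ++
      Sym.comma :: (encodeName b ++ u))) := by
    simpa [encodeAssertion] using hu
  have h2 := drop_after_name h1
  exact ⟨at_of_drop h1 rfl, nameAt_of_drop h1 (startsNoBit_comma _), fun c => nextComma_iff h1,
    nameAt_of_drop h2 (startsNoBit_comma _), fun d => nextComma_iff h2,
    nameAt_of_drop (drop_after_name h2) hu'⟩

/-- In a symbol followed by a name, only the first can fail to be a bit. Applied to one name after
another, this locates all other symbols of an assertion. -/
theorem eq_or_le_of_drop {w : List Sym} {m p : ℕ} {s a : Sym} {A : List Bool} {u : List Sym}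
    (h : w.drop m = s :: (encodeName A ++ u)) (hp : m ≤ p) (ha : w[p]? = some a)
    (hb : a.isBit = false) : p = m ∧ a = s ∨ m + (1 + A.length) ≤ p := by
  obtain ⟨k, rfl⟩ := Nat.exists_eq_add_of_le hp
  rw [← List.getElem?_drop, h] at ha
  cases k with
  | zero => exact Or.inl ⟨rfl, by simpa using ha.symm⟩
  | succ k =>
    refine Or.inr ?_
    by_contra hcon
    have hk : k < A.length := by omega
    rw [List.getElem?_cons_succ, List.getElem?_append_left (by simpa [encodeName] using hk)] at ha
    obtain ⟨b, -, rfl⟩ := List.mem_map.1 (List.mem_of_getElem? ha)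
    cases hb

/-- The symbols of an assertion other than bits are its mark and the commas that precede its
individuals. -/
theorem AssertionAt.mark_or_comma {w : List Sym} {m p : ℕ} {α : Assertion} {a : Sym}
    (h : AssertionAt w m α) (hp : m ≤ p) (hp' : p < m + (encodeAssertion α).length)
    (ha : w[p]? = some a) (hb : a.isBit = false) :
    p = m ∧ a ≠ .comma ∨ a = .comma ∧ ∃ b ∈ α.inds, nameAt w p = encodeName b := by
  have h' := h
  obtain ⟨u, hu, hu'⟩ := h
  cases α with
  | concept A b =>
    have h1 : w.drop m = Sym.conceptMark :: (encodeName A ++ Sym.comma :: (encodeName b ++ u)) := by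
      simpa [encodeAssertion] using hu
    rcases eq_or_le_of_drop h1 hp ha hb with ⟨rfl, rfl⟩ | hp
    · exact Or.inl ⟨rfl, by simp⟩
    rcases eq_or_le_of_drop (drop_after_name h1) hp ha hb with ⟨rfl, rfl⟩ | hp
    · exact Or.inr ⟨rfl, b, by simp [Assertion.inds], h'.concept.2.2.2⟩
    · simp [encodeAssertion, encodeName] at hp'
      omega
  | role r b c =>
    have h1 : w.drop m = Sym.roleMark :: (encodeName r ++ Sym.comma :: (encodeName b ++
        Sym.comma :: (encodeName c ++ u))) := by
      simpa [encodeAssertion] using hu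
    rcases eq_or_le_of_drop h1 hp ha hb with ⟨rfl, rfl⟩ | hp
    · exact Or.inl ⟨rfl, by simp⟩
    have h2 := drop_after_name h1
    rcases eq_or_le_of_drop h2 hp ha hb with ⟨rfl, rfl⟩ | hp
    · exact Or.inr ⟨rfl, b, by simp [Assertion.inds], h'.role.2.2.2.1⟩
    rcases eq_or_le_of_drop (drop_after_name h2) hp ha hb with ⟨rfl, rfl⟩ | hp
    · exact Or.inr ⟨rfl, c, by simp [Assertion.inds], h'.role.2.2.2.2.2⟩
    · simp [encodeAssertion, encodeName] at hp'
      omega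

theorem encodeName_injective : Function.Injective encodeName :=
  List.map_injective_iff.2 fun _ _ h => Sym.bit.inj h

/-- On the way from `m` to the comma there are only bits, so no label is passed. -/
theorem InExample.nextComma {w : List Sym} {e m c : ℕ} (h : InExample w e m)
    (hc : NextComma w m c) : InExample w e c := by
  refine ⟨h.1.trans hc.1, fun z hz hzl hez => ?_⟩
  by_contra hcon
  obtain ⟨a, ha, hal⟩ := hzl
  rcases (not_lt.1 hcon).eq_or_lt with rfl | hlt
  · obtain ⟨b, hb, hbc⟩ := hc.2.1
    rw [ha] at hb
    cases hb
    cases a <;> simp [Sym.isLabel] at hal hbc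
  · obtain ⟨b, hb, hbb⟩ := hc.2.2 z hz (h.2 z hz ⟨a, ha, hal⟩ hez) hlt
    rw [ha] at hb
    cases hb
    cases a <;> simp [Sym.isLabel, Sym.isBit] at hal hbb

section Example

variable {xs : List (Bool × List Assertion)} {e : ℕ} {x : Bool × List Assertion}

theorem DescribedAt.assertionAt (hx : DescribedAt xs e x) {m : ℕ}
    (hm : InExample (encodeAll xs) e m) {s : Sym} (hs : s.isBit = false) (hsc : s ≠ .comma)
    (hms : At (encodeAll xs) m (· == s)) : ∃ α ∈ x.2, AssertionAt (encodeAll xs) m α := by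
  obtain ⟨α, hα, j, hj, hmj, -, hat⟩ := hx.exists_assertion hm hms.lt_length
  obtain ⟨a, ha, has⟩ := hms
  obtain rfl : a = s := by simpa using has
  rcases hat.mark_or_comma hj hmj ha hs with ⟨rfl, -⟩ | ⟨rfl, -⟩
  · exact ⟨α, hα, hat⟩
  · exact absurd rfl hsc

theorem DescribedAt.conceptFact (hx : DescribedAt xs e x) {m c : ℕ}
    (hm : InExample (encodeAll xs) e m) (h : ConceptFact (encodeAll xs) m c) :
    ∃ A a, .concept A a ∈ x.2 ∧ nameAt (encodeAll xs) m = encodeName A ∧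
      nameAt (encodeAll xs) c = encodeName a := by
  obtain ⟨α, hα, hat⟩ := hx.assertionAt hm rfl (by simp) h.1
  cases α with
  | concept A a =>
    obtain ⟨-, h1, h2, h3⟩ := hat.concept
    refine ⟨A, a, hα, h1, ?_⟩
    rw [(h2 c).1 h.2]
    exact h3
  | role r a b =>
    obtain ⟨s, hs, hs'⟩ := hat.role.1
    obtain ⟨t, ht, ht'⟩ := h.1
    rw [hs] at ht
    cases ht
    simp_all

theorem DescribedAt.roleFact (hx : DescribedAt xs e x) {m c d : ℕ}
    (hm : InExample (encodeAll xs) e m) (h : RoleFact (encodeAll xs) m c d) :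
    ∃ r a b, .role r a b ∈ x.2 ∧ nameAt (encodeAll xs) m = encodeName r ∧
      nameAt (encodeAll xs) c = encodeName a ∧ nameAt (encodeAll xs) d = encodeName b ∧
      InExample (encodeAll xs) e c ∧ InExample (encodeAll xs) e d := by
  obtain ⟨α, hα, hat⟩ := hx.assertionAt hm rfl (by simp) h.1
  cases α with
  | concept A a =>
    obtain ⟨s, hs, hs'⟩ := hat.concept.1
    obtain ⟨t, ht, ht'⟩ := h.1
    rw [hs] at ht
    cases ht
    simp_all
  | role r a b =>
    obtain ⟨-, h1, h2, h3, h4, h5⟩ := hat.role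
    have hc := hm.nextComma h.2.1
    have hd := hc.nextComma h.2.2
    obtain rfl := (h2 c).1 h.2.1
    obtain rfl := (h4 d).1 h.2.2
    exact ⟨r, a, b, hα, h1, h3, h5, hc, hd⟩

theorem DescribedAt.exists_conceptFact (hx : DescribedAt xs e x) {A : ConceptName} {a : IndName}
    (h : .concept A a ∈ x.2) : ∃ m c, ConceptFact (encodeAll xs) m c ∧
      InExample (encodeAll xs) e m ∧ nameAt (encodeAll xs) m = encodeName A ∧
      nameAt (encodeAll xs) c = encodeName a := by
  obtain ⟨m, hm, hat⟩ := hx.exists_position h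
  obtain ⟨h0, h1, h2, h3⟩ := hat.concept
  exact ⟨m, _, ⟨h0, (h2 _).2 rfl⟩, hm, h1, h3⟩

theorem DescribedAt.exists_roleFact (hx : DescribedAt xs e x) {r : RoleName} {a b : IndName}
    (h : .role r a b ∈ x.2) : ∃ m c d, RoleFact (encodeAll xs) m c d ∧
      InExample (encodeAll xs) e m ∧ nameAt (encodeAll xs) m = encodeName r ∧
      nameAt (encodeAll xs) c = encodeName a ∧ nameAt (encodeAll xs) d = encodeName b := by
  obtain ⟨m, hm, hat⟩ := hx.exists_position h
  obtain ⟨h0, h1, h2, h3, h4, h5⟩ := hat.role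
  exact ⟨m, _, _, ⟨h0, (h2 _).2 rfl, (h4 _).2 rfl⟩, hm, h1, h3, h5⟩

/-- Every comma precedes an individual, never a concept or role name. Hence commas can represent
individuals, one individual possibly having several of them. -/
theorem DescribedAt.exists_ind (hx : DescribedAt xs e x) {p : ℕ}
    (hp : InExample (encodeAll xs) e p) (hpc : At (encodeAll xs) p (· == .comma)) :
    ∃ a ∈ inds {α | α ∈ x.2}, nameAt (encodeAll xs) p = encodeName a := by
  obtain ⟨α, hα, j, hj, hpj, -, hat⟩ := hx.exists_assertion hp hpc.lt_length
  obtain ⟨s, hs, hsc⟩ := hpc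
  obtain rfl : s = .comma := by simpa using hsc
  rcases hat.mark_or_comma hj hpj hs rfl with ⟨-, h⟩ | ⟨-, b, hb, hname⟩
  · exact absurd rfl h
  · exact ⟨b, ⟨α, hα, hb⟩, hname⟩

theorem DescribedAt.exists_comma (hx : DescribedAt xs e x) {a : IndName}
    (ha : a ∈ inds {α | α ∈ x.2}) : ∃ p, InExample (encodeAll xs) e p ∧
      At (encodeAll xs) p (· == .comma) ∧ nameAt (encodeAll xs) p = encodeName a := by
  obtain ⟨α, hα, ha⟩ := ha
  cases α with
  | concept A b =>
    obtain rfl : a = b := by simpa [Assertion.inds] using ha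
    obtain ⟨m, c, h, hm, -, hc⟩ := hx.exists_conceptFact hα
    exact ⟨c, hm.nextComma h.2, h.2.2.1, hc⟩
  | role r b b' =>
    obtain ⟨m, c, d, h, hm, -, hc, hd⟩ := hx.exists_roleFact hα
    rcases (by simpa [Assertion.inds] using ha : a = b ∨ a = b') with rfl | rfl
    · exact ⟨c, hm.nextComma h.2.1, h.2.1.2.1, hc⟩
    · exact ⟨d, (hm.nextComma h.2.1).nextComma h.2.2, h.2.2.2.1, hd⟩

end Example

/-! ### Non-simulation as a least fixed point -/

/-- No label separates the two positions. -/
def SameExample (w : List Sym) (p q : ℕ) : Prop :=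
  ∀ z < w.length, At w z Sym.isLabel → (z < p ↔ z < q)

/-- The individual at `p` has a concept that the individual at `q` does not have. -/
def ConceptStep (w : List Sym) (p q : ℕ) : Prop :=
  ∃ m < w.length, ∃ c < w.length, ConceptFact w m c ∧ SameExample w m p ∧
    nameAt w c = nameAt w p ∧ ¬ ∃ m' < w.length, ∃ c' < w.length, ConceptFact w m' c' ∧
      SameExample w m' q ∧ nameAt w c' = nameAt w q ∧ nameAt w m = nameAt w m'

/-- The individual at `p` has a successor all of whose counterparts are separated from it
by `T`. -/
def SuccStep (w : List Sym) (T : ℕ → ℕ → Prop) (p q : ℕ) : Prop :=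
  ∃ m < w.length, ∃ c < w.length, ∃ d < w.length, RoleFact w m c d ∧ SameExample w m p ∧
    nameAt w c = nameAt w p ∧ ¬ ∃ m' < w.length, ∃ c' < w.length, ∃ d' < w.length,
      RoleFact w m' c' d' ∧ SameExample w m' q ∧ nameAt w c' = nameAt w q ∧
      nameAt w m = nameAt w m' ∧ ¬ T d d'

/-- The individual at `p` has a predecessor all of whose counterparts are separated from it
by `T`. -/
def PredStep (w : List Sym) (T : ℕ → ℕ → Prop) (p q : ℕ) : Prop :=
  ∃ m < w.length, ∃ c < w.length, ∃ d < w.length, RoleFact w m c d ∧ SameExample w m p ∧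
    nameAt w d = nameAt w p ∧ ¬ ∃ m' < w.length, ∃ c' < w.length, ∃ d' < w.length,
      RoleFact w m' c' d' ∧ SameExample w m' q ∧ nameAt w d' = nameAt w q ∧
      nameAt w m = nameAt w m' ∧ ¬ T c c'

/-- The disjunct `T p q` makes the iteration inflationary, which is all that `stages_closed` needs;
monotonicity in `T` plays no role. -/
def Step (L : DL) (w : List Sym) (T : ℕ → ℕ → Prop) (p q : ℕ) : Prop :=
  T p q ∨ ConceptStep w p q ∨ SuccStep w T p q ∨ (L = .ELIbot ∧ PredStep w T p q)

/-- `SameExample` compares strictly, so it would also hold if `m` were the label of the next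
example; this is what `hm` excludes. -/
theorem sameExample_iff {w : List Sym} {e m p : ℕ} (he : At w e Sym.isLabel)
    (hp : InExample w e p) (hm : ¬ At w m Sym.isLabel) : SameExample w m p ↔ InExample w e m := by
  constructor
  · refine fun h => ⟨(h e he.lt_length he).2 hp.1, fun z hz hzl hez => ?_⟩
    have h1 := hp.2 z hz hzl hez
    have h2 := h z hz hzl
    have h3 : m ≠ z := fun h => hm (h ▸ hzl)
    omega
  · intro h z hz hzl
    have h1 := hp.2 z hz hzl
    have h2 := h.2 z hz hzl
    have := hp.1
    have := h.1
    omega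

theorem not_isLabel_of_at {w : List Sym} {m : ℕ} {s : Sym} (h : At w m (· == s))
    (hs : s.isLabel = false) : ¬ At w m Sym.isLabel := by
  rintro ⟨a, ha, hal⟩
  obtain ⟨b, hb, hbs⟩ := h
  rw [ha] at hb
  cases hb
  simp_all

theorem DescribedAt.at_isLabel {xs : List (Bool × List Assertion)} {e : ℕ}
    {x : Bool × List Assertion} (h : DescribedAt xs e x) : At (encodeAll xs) e Sym.isLabel :=
  ⟨_, getElem?_of_describedAt h, by cases x.1 <;> rfl⟩

section Fixpoint

variable {xs : List (Bool × List Assertion)} {e e' : ℕ} {x y : Bool × List Assertion} {L : DL}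

theorem ConceptFact.sameExample_iff {w : List Sym} {e m c p : ℕ} (he : At w e Sym.isLabel)
    (hp : InExample w e p) (h : ConceptFact w m c) : SameExample w m p ↔ InExample w e m :=
  OntologyFitting.sameExample_iff he hp (not_isLabel_of_at h.1 rfl)

theorem RoleFact.sameExample_iff {w : List Sym} {e m c d p : ℕ} (he : At w e Sym.isLabel)
    (hp : InExample w e p) (h : RoleFact w m c d) : SameExample w m p ↔ InExample w e m :=
  OntologyFitting.sameExample_iff he hp (not_isLabel_of_at h.1 rfl)

theorem RoleFact.lt_length {w : List Sym} {m c d : ℕ} (h : RoleFact w m c d) :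
    m < w.length ∧ c < w.length ∧ d < w.length :=
  ⟨h.1.lt_length, h.2.1.2.1.lt_length, h.2.2.2.1.lt_length⟩

theorem ConceptFact.lt_length {w : List Sym} {m c : ℕ} (h : ConceptFact w m c) :
    m < w.length ∧ c < w.length :=
  ⟨h.1.lt_length, h.2.2.1.lt_length⟩

/-- By induction on the round, each way of being separated contradicts one clause of a simulation:
the counterpart that the clause provides would have to be separated already, which the induction
hypothesis rules out. -/
theorem not_simulated_of_stages (hx : DescribedAt xs e x) (hy : DescribedAt xs e' y) (r : ℕ)
    {p q : ℕ} {a b : IndName} (hp : InExample (encodeAll xs) e p)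
    (hq : InExample (encodeAll xs) e' q) (hpa : nameAt (encodeAll xs) p = encodeName a)
    (hqb : nameAt (encodeAll xs) q = encodeName b) (h : stages (Step L) (encodeAll xs) r p q) :
    ¬ Simulated L {α | α ∈ x.2} {α | α ∈ y.2} a b := by
  induction r generalizing p q a b with
  | zero => exact h.elim
  | succ r ih =>
    intro hsim
    obtain ⟨-, -, h | h | h | ⟨rfl, h⟩⟩ := h
    · exact ih hp hq hpa hqb h hsim
    · obtain ⟨m, -, c, -, hfact, hsame, hname, hno⟩ := h
      rw [hfact.sameExample_iff hx.at_isLabel hp] at hsame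
      obtain ⟨A, a', hA, hmA, hca⟩ := hx.conceptFact hsame hfact
      obtain rfl : a' = a := encodeName_injective (by rw [← hca, hname, hpa])
      obtain ⟨m', c', hfact', hm', hmA', hcb⟩ := hy.exists_conceptFact (hsim.concept hA)
      exact hno ⟨m', hfact'.lt_length.1, c', hfact'.lt_length.2, hfact',
        (hfact'.sameExample_iff hy.at_isLabel hq).2 hm', by rw [hcb, hqb], by rw [hmA, hmA']⟩
    · obtain ⟨m, -, c, -, d, -, hfact, hsame, hname, hno⟩ := h
      rw [hfact.sameExample_iff hx.at_isLabel hp] at hsame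
      obtain ⟨r', a₁, a₂, hr, hmr, hc, hd, -, hdx⟩ := hx.roleFact hsame hfact
      obtain rfl : a₁ = a := encodeName_injective (by rw [← hc, hname, hpa])
      obtain ⟨b₂, hr', hsim'⟩ := hsim.succ hr
      obtain ⟨m', c', d', hfact', hm', hmr', hc', hd'⟩ := hy.exists_roleFact hr'
      obtain ⟨h1, h2, h3⟩ := hfact'.lt_length
      refine hno ⟨m', h1, c', h2, d', h3, hfact',
        (hfact'.sameExample_iff hy.at_isLabel hq).2 hm', by rw [hc', hqb], by rw [hmr, hmr'],
        fun hT => ih hdx ((hm'.nextComma hfact'.2.1).nextComma hfact'.2.2) hd hd' hT hsim'⟩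
    · obtain ⟨m, -, c, -, d, -, hfact, hsame, hname, hno⟩ := h
      rw [hfact.sameExample_iff hx.at_isLabel hp] at hsame
      obtain ⟨r', a₁, a₂, hr, hmr, hc, hd, hcx, -⟩ := hx.roleFact hsame hfact
      obtain rfl : a₂ = a := encodeName_injective (by rw [← hd, hname, hpa])
      obtain ⟨b₁, hr', hsim'⟩ := hsim.pred hr
      obtain ⟨m', c', d', hfact', hm', hmr', hc', hd'⟩ := hy.exists_roleFact hr'
      obtain ⟨h1, h2, h3⟩ := hfact'.lt_length
      refine hno ⟨m', h1, c', h2, d', h3, hfact',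
        (hfact'.sameExample_iff hy.at_isLabel hq).2 hm', by rw [hd', hqb], by rw [hmr, hmr'],
        fun hT => ih hcx (hm'.nextComma hfact'.2.1) hc hc' hT hsim'⟩

/-- The complement of a closed relation, transferred from positions to names, is a simulation. Some
pair of positions for the two names suffices, because the steps use a position only through its name
and its example. -/
theorem simulated_of_closed (hx : DescribedAt xs e x) (hy : DescribedAt xs e' y)
    {T : ℕ → ℕ → Prop} (hT : ∀ p < (encodeAll xs).length, ∀ q < (encodeAll xs).length,
      Step L (encodeAll xs) T p q → T p q)
    {p q : ℕ} {a b : IndName} (hpl : p < (encodeAll xs).length) (hql : q < (encodeAll xs).length)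
    (hp : InExample (encodeAll xs) e p)
    (hq : InExample (encodeAll xs) e' q) (hpa : nameAt (encodeAll xs) p = encodeName a)
    (hqb : nameAt (encodeAll xs) q = encodeName b) (h : ¬ T p q) :
    Simulated L {α | α ∈ x.2} {α | α ∈ y.2} a b := by
  refine ⟨fun a b => ∃ p < (encodeAll xs).length, ∃ q < (encodeAll xs).length,
    InExample (encodeAll xs) e p ∧ InExample (encodeAll xs) e' q ∧
    nameAt (encodeAll xs) p = encodeName a ∧ nameAt (encodeAll xs) q = encodeName b ∧ ¬ T p q,
    ⟨?_, ?_, ?_⟩, p, hpl, q, hql, hp, hq, hpa, hqb, h⟩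
  · rintro a b ⟨p, hpl, q, hql, hp, hq, hpa, hqb, h⟩ A hA
    have h1 : ¬ ConceptStep (encodeAll xs) p q := fun hs => h (hT p hpl q hql (Or.inr (Or.inl hs)))
    obtain ⟨m, c, hfact, hm, hmA, hca⟩ := hx.exists_conceptFact hA
    have h2 := not_not.1 fun hno => h1 ⟨m, hfact.lt_length.1, c, hfact.lt_length.2, hfact,
      (hfact.sameExample_iff hx.at_isLabel hp).2 hm, by rw [hca, hpa], hno⟩
    obtain ⟨m', -, c', -, hfact', hm', hname, hname'⟩ := h2
    rw [hfact'.sameExample_iff hy.at_isLabel hq] at hm'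
    obtain ⟨A', b', hA', hmA', hcb'⟩ := hy.conceptFact hm' hfact'
    obtain rfl : A' = A := encodeName_injective (by rw [← hmA', ← hname', hmA])
    obtain rfl : b' = b := encodeName_injective (by rw [← hcb', hname, hqb])
    exact hA'
  · rintro a b ⟨p, hpl, q, hql, hp, hq, hpa, hqb, h⟩ r a' hr
    have h1 : ¬ SuccStep (encodeAll xs) T p q := fun hs =>
      h (hT p hpl q hql (Or.inr (Or.inr (Or.inl hs))))
    obtain ⟨m, c, d, hfact, hm, hmr, hca, hda⟩ := hx.exists_roleFact hr
    obtain ⟨l1, l2, l3⟩ := hfact.lt_length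
    have h2 := not_not.1 fun hno => h1 ⟨m, l1, c, l2, d, l3, hfact,
      (hfact.sameExample_iff hx.at_isLabel hp).2 hm, by rw [hca, hpa], hno⟩
    obtain ⟨m', -, c', -, d', hd'l, hfact', hm', hname, hname', hTd⟩ := h2
    rw [hfact'.sameExample_iff hy.at_isLabel hq] at hm'
    obtain ⟨r', b₁, b', hr', hmr', hcb, hdb, -, hd'⟩ := hy.roleFact hm' hfact'
    obtain rfl : r' = r := encodeName_injective (by rw [← hmr', ← hname', hmr])
    obtain rfl : b₁ = b := encodeName_injective (by rw [← hcb, hname, hqb])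
    exact ⟨b', hr', d, l3, d', hd'l, (hm.nextComma hfact.2.1).nextComma hfact.2.2, hd', hda, hdb,
      hTd⟩
  · rintro hL a b ⟨p, hpl, q, hql, hp, hq, hpa, hqb, h⟩ r a' hr
    have h1 : ¬ PredStep (encodeAll xs) T p q := fun hs =>
      h (hT p hpl q hql (Or.inr (Or.inr (Or.inr ⟨hL, hs⟩))))
    obtain ⟨m, c, d, hfact, hm, hmr, hca, hda⟩ := hx.exists_roleFact hr
    obtain ⟨l1, l2, l3⟩ := hfact.lt_length
    have h2 := not_not.1 fun hno => h1 ⟨m, l1, c, l2, d, l3, hfact,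
      (hfact.sameExample_iff hx.at_isLabel hp).2 hm, by rw [hda, hpa], hno⟩
    obtain ⟨m', -, c', hc'l, d', -, hfact', hm', hname, hname', hTc⟩ := h2
    rw [hfact'.sameExample_iff hy.at_isLabel hq] at hm'
    obtain ⟨r', b', b₂, hr', hmr', hcb, hdb, hc', -⟩ := hy.roleFact hm' hfact'
    obtain rfl : r' = r := encodeName_injective (by rw [← hmr', ← hname', hmr])
    obtain rfl : b₂ = b := encodeName_injective (by rw [← hdb, hname, hqb])
    exact ⟨b', hr', c, l2, c', hc'l, hm.nextComma hfact.2.1, hc', hca, hcb, hTc⟩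

end Fixpoint

/-! ### Stabilization of the iteration and the test on the final stage -/

theorem stages_lt {S : List Sym → (ℕ → ℕ → Prop) → ℕ → ℕ → Prop} {w : List Sym} {r p q : ℕ}
    (h : stages S w r p q) : p < w.length ∧ q < w.length := by
  cases r with
  | zero => exact h.elim
  | succ r => exact ⟨h.1, h.2.1⟩

/-- An inflationary iteration has reached its fixed point after `n * n` rounds. -/
theorem stages_closed {S : List Sym → (ℕ → ℕ → Prop) → ℕ → ℕ → Prop} {w : List Sym}
    (hS : ∀ T p q, T p q → S w T p q) {p q : ℕ} (hp : p < w.length) (hq : q < w.length)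
    (h : S w (stages S w (w.length * w.length)) p q) :
    stages S w (w.length * w.length) p q := by
  classical
  let F : ℕ → Finset (ℕ × ℕ) := fun r =>
    (Finset.range w.length ×ˢ Finset.range w.length).filter fun z => stages S w r z.1 z.2
  have hmem : ∀ r p q, (p, q) ∈ F r ↔ stages S w r p q := by
    intro r p q
    simp only [F, Finset.mem_filter, Finset.mem_product, Finset.mem_range]
    exact ⟨fun h => h.2, fun h => ⟨stages_lt h, h⟩⟩
  have hmono : ∀ r, F r ⊆ F (r + 1) := by
    rintro r ⟨p, q⟩ h
    rw [hmem] at h ⊢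
    exact ⟨(stages_lt h).1, (stages_lt h).2, hS _ _ _ h⟩
  have hstable : ∀ r, F r = F (r + 1) → F (r + 1) = F (r + 2) := by
    intro r hr
    have : stages S w r = stages S w (r + 1) := by
      funext p q
      rw [← hmem, ← hmem, hr]
    ext ⟨p, q⟩
    rw [hmem, hmem]
    change (_ ∧ _ ∧ S w (stages S w r) p q) ↔ (_ ∧ _ ∧ S w (stages S w (r + 1)) p q)
    rw [this]
  by_contra hcon
  -- A round that adds nothing is followed only by such rounds. Counting backwards from the round
  -- that adds `(p, q)`, every round from the first on adds a pair, so there would be more than `n *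
  -- n` pairs for a word of length `n`.
  have hne : ∀ k ≤ w.length * w.length,
      F (w.length * w.length - k) ≠ F (w.length * w.length - k + 1) := by
    intro k
    induction k with
    | zero =>
      intro _ heq
      refine hcon ((hmem _ _ _).1 (heq ▸ (hmem _ _ _).2 ?_))
      exact ⟨hp, hq, h⟩
    | succ k ih =>
      intro hk heq
      have := hstable _ heq
      rw [show w.length * w.length - (k + 1) + 2 = w.length * w.length - k + 1 by omega,
        show w.length * w.length - (k + 1) + 1 = w.length * w.length - k by omega] at this
      exact ih (by omega) this
  have hcard : ∀ r ≤ w.length * w.length + 1, r ≤ (F r).card := by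
    intro r
    induction r with
    | zero => simp
    | succ r ih =>
      intro hr
      have h1 := hne (w.length * w.length - r) (by omega)
      rw [show w.length * w.length - (w.length * w.length - r) = r by omega] at h1
      have h2 := Finset.card_lt_card ((hmono r).ssubset_of_ne h1)
      have := ih (by omega)
      omega
  have h1 := hcard (w.length * w.length + 1) le_rfl
  have h2 : (F (w.length * w.length + 1)).card ≤ w.length * w.length := by
    refine (Finset.card_filter_le _ _).trans ?_
    simp
  omega

/-- Every negative example has an individual that is separated by `T` from all individuals of all
positive examples. -/
def Final (w : List Sym) (T : ℕ → ℕ → Prop) : Prop :=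
  ∀ e < w.length, At w e (· == .negMark) → ∃ p < w.length, At w p (· == .comma) ∧
    InExample w e p ∧ ∀ q < w.length, At w q (· == .comma) →
      (∃ e' < w.length, At w e' (· == .posMark) ∧ InExample w e' q) → T p q

/-- Any position of an individual will do: stages only contain pairs that are not simulated, and the
last stage is closed, so it contains all such pairs from two examples. -/
theorem final_iff {L : DL} (xs : List (Bool × List Assertion)) :
    Final (encodeAll xs) (stages (Step L) (encodeAll xs)
      ((encodeAll xs).length * (encodeAll xs).length)) ↔
    ∀ x ∈ xs, x.1 = false → ∃ a ∈ inds {α | α ∈ x.2}, ∀ y ∈ xs, y.1 = true →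
      ∀ b ∈ inds {α | α ∈ y.2}, ¬ Simulated L {α | α ∈ x.2} {α | α ∈ y.2} a b := by
  constructor
  · intro h x hx hxl
    obtain ⟨e, he⟩ := exists_describedAt hx
    have hat : At (encodeAll xs) e (· == .negMark) :=
      ⟨_, getElem?_of_describedAt he, by rw [hxl]; rfl⟩
    obtain ⟨p, -, hpc, hp, hpq⟩ := h e hat.lt_length hat
    obtain ⟨a, ha, hpa⟩ := he.exists_ind hp hpc
    refine ⟨a, ha, fun y hy hyl b hb => ?_⟩
    obtain ⟨e', he'⟩ := exists_describedAt hy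
    have hat' : At (encodeAll xs) e' (· == .posMark) :=
      ⟨_, getElem?_of_describedAt he', by rw [hyl]; rfl⟩
    obtain ⟨q, hq, hqc, hqb⟩ := he'.exists_comma hb
    exact not_simulated_of_stages he he' _ hp hq hpa hqb
      (hpq q hqc.lt_length hqc ⟨e', hat'.lt_length, hat', hq⟩)
  · rintro h e - ⟨s, hs, hsn⟩
    obtain rfl : s = .negMark := by simpa using hsn
    obtain ⟨x, hx, hxl⟩ := describedAt_of_isLabel hs rfl
    have hxl' : x.1 = false := by
      cases hx1 : x.1
      · rfl
      · rw [hx1] at hxl; cases hxl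
    obtain ⟨a, ha, hay⟩ := h x hx.mem hxl'
    obtain ⟨p, hp, hpc, hpa⟩ := hx.exists_comma ha
    refine ⟨p, hpc.lt_length, hpc, hp, ?_⟩
    rintro q hql hqc ⟨e', -, ⟨s, hs, hsn⟩, hq⟩
    obtain rfl : s = .posMark := by simpa using hsn
    obtain ⟨y, hy, hyl⟩ := describedAt_of_isLabel hs rfl
    have hyl' : y.1 = true := by
      cases hy1 : y.1
      · rw [hy1] at hyl; cases hyl
      · rfl
    obtain ⟨b, hb, hqb⟩ := hy.exists_ind hq hqc
    by_contra hT
    exact hay y hy.mem hyl' b hb (simulated_of_closed hx hy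
      (fun p hp q hq hs => stages_closed (fun T p q hT => Or.inl hT) hp hq hs)
      hpc.lt_length hql hp hq hpa hqb hT)

/-- Unique readability of words is not needed, since `final_iff` holds for every list of examples
that the word encodes. -/
theorem mem_fittingProblem_iff (L : DL) (w : List Sym) :
    w ∈ ConsistentFittingProblem L ↔ (wfRun w).accept = true ∧
      Final w (stages (Step L) w (w.length * w.length)) := by
  have hcoe : ∀ (l : List Assertion) (A : ABox), l.toFinset = A.1 →
      (A.1 : Set Assertion) = {α | α ∈ l} := by
    intro l A h
    rw [← h]
    ext
    simp
  rw [wfRun_accept_iff]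
  constructor
  · rintro ⟨E, ⟨xs, rfl, hxs, hpos, hneg⟩, hfit⟩
    refine ⟨⟨xs, hxs, rfl⟩, (final_iff xs).2 fun x hx hxl => ?_⟩
    rw [admitsFitting_iff] at hfit
    have hne : ∀ x ∈ xs, x.2.toFinset.Nonempty := fun x hx => by
      simpa using hxs x hx
    obtain ⟨a, ha, hay⟩ := hfit ⟨x.2.toFinset, hne x hx⟩ ((hneg _).2 ⟨x, hx, hxl, rfl⟩)
    rw [hcoe x.2 _ rfl] at ha
    refine ⟨a, ha, fun y hy hyl b hb => ?_⟩
    have := hay ⟨y.2.toFinset, hne y hy⟩ ((hpos _).2 ⟨y, hy, hyl, rfl⟩) b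
      (by rwa [hcoe y.2 _ rfl])
    rwa [hcoe x.2 _ rfl, hcoe y.2 _ rfl] at this
  · rintro ⟨⟨xs, hxs, rfl⟩, hfinal⟩
    rw [final_iff] at hfinal
    -- `Finset.subtype` would discard empty sets of assertions, but `hxs` says that there are none.
    let E : LabeledExamples :=
      { pos := (((xs.filter (·.1)).map fun x => x.2.toFinset).toFinset).subtype _
        neg := (((xs.filter (!·.1)).map fun x => x.2.toFinset).toFinset).subtype _ }
    have hpos : ∀ A : ABox, A ∈ E.pos ↔ ∃ x ∈ xs, x.1 = true ∧ x.2.toFinset = A.1 := by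
      intro A
      simp [E, and_assoc]
    have hneg : ∀ A : ABox, A ∈ E.neg ↔ ∃ x ∈ xs, x.1 = false ∧ x.2.toFinset = A.1 := by
      intro A
      simp [E, and_assoc]
    refine ⟨E, ⟨xs, rfl, hxs, hpos, hneg⟩, ?_⟩
    rw [admitsFitting_iff]
    intro A hA
    obtain ⟨x, hx, hxl, hxA⟩ := (hneg A).1 hA
    obtain ⟨a, ha, hay⟩ := hfinal x hx hxl
    rw [hcoe _ _ hxA]
    refine ⟨a, ha, fun B hB => ?_⟩
    obtain ⟨y, hy, hyl, hyB⟩ := (hpos B).1 hB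
    rw [hcoe _ _ hyB]
    exact hay y hy hyl

/-! ### The formulas -/

namespace Fm

def or (φ ψ : Fm) : Fm := .not (.and (.not φ) (.not ψ))

def all (i : Var) (φ : Fm) : Fm := .not (.ex i (.not φ))

def imp (φ ψ : Fm) : Fm := .not (.and φ (.not ψ))

def iff (φ ψ : Fm) : Fm := .and (imp φ ψ) (imp ψ φ)

variable {w : List Sym} {T : ℕ → ℕ → Prop} {φ ψ : Fm} {v : Var → ℕ}

theorem eval_or : (or φ ψ).eval w T v ↔ φ.eval w T v ∨ ψ.eval w T v := by
  simp only [or, eval]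
  tauto

theorem eval_all {i : Var} :
    (all i φ).eval w T v ↔ ∀ p < w.length, φ.eval w T (Function.update v i p) := by
  simp [all, eval]

theorem eval_imp : (imp φ ψ).eval w T v ↔ (φ.eval w T v → ψ.eval w T v) := by
  simp [imp, eval]

theorem eval_iff : (iff φ ψ).eval w T v ↔ (φ.eval w T v ↔ ψ.eval w T v) := by
  simp only [iff, eval, eval_imp]
  tauto

/-- The auxiliary variable `10` is used for positions between two others. -/
def nextComma (m c : Var) : Fm :=
  .and (.lt m c) (.and (.sym (· == .comma) c)
    (all 10 (imp (.lt m 10) (imp (.lt 10 c) (.sym Sym.isBit 10)))))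

def inExample (e p : Var) : Fm :=
  .and (.lt e p) (all 10 (imp (.sym Sym.isLabel 10) (imp (.lt e 10) (.lt p 10))))

def sameExample (p q : Var) : Fm :=
  all 10 (imp (.sym Sym.isLabel 10) (iff (.lt 10 p) (.lt 10 q)))

/-- The arguments must differ from the bound variable `10`, or they would be captured. -/
theorem eval_nextComma {m c : Var} (hm : m ≠ 10) (hc : c ≠ 10) :
    (nextComma m c).eval w T v ↔ NextComma w (v m) (v c) := by
  simp [nextComma, eval, eval_all, eval_imp, NextComma, At, hm, hc]

theorem eval_inExample {e p : Var} (he : e ≠ 10) (hp : p ≠ 10) :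
    (inExample e p).eval w T v ↔ InExample w (v e) (v p) := by
  simp [inExample, eval, eval_all, eval_imp, InExample, At, he, hp]

theorem eval_sameExample {p q : Var} (hp : p ≠ 10) (hq : q ≠ 10) :
    (sameExample p q).eval w T v ↔ SameExample w (v p) (v q) := by
  simp [sameExample, eval, eval_all, eval_imp, eval_iff, SameExample, At, hp, hq]

def conceptFact (m c : Var) : Fm := .and (.sym (· == .conceptMark) m) (nextComma m c)

def roleFact (m c d : Var) : Fm :=
  .and (.sym (· == .roleMark) m) (.and (nextComma m c) (nextComma c d))

theorem eval_conceptFact {m c : Var} (hm : m ≠ 10) (hc : c ≠ 10) :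
    (conceptFact m c).eval w T v ↔ ConceptFact w (v m) (v c) := by
  simp only [conceptFact, eval, eval_nextComma hm hc, ConceptFact, At]

theorem eval_roleFact {m c d : Var} (hm : m ≠ 10) (hc : c ≠ 10) (hd : d ≠ 10) :
    (roleFact m c d).eval w T v ↔ RoleFact w (v m) (v c) (v d) := by
  simp only [roleFact, eval, eval_nextComma hm hc, eval_nextComma hc hd, RoleFact, At]

def conceptStep : Fm :=
  .ex 4 (.ex 5 (.and (conceptFact 4 5) (.and (sameExample 4 0) (.and (.sameName 5 0)
    (.not (.ex 7 (.ex 8 (.and (conceptFact 7 8) (.and (sameExample 7 1) (.and (.sameName 8 1)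
      (.sameName 4 7)))))))))))

def succStep : Fm :=
  .ex 4 (.ex 5 (.ex 6 (.and (roleFact 4 5 6) (.and (sameExample 4 0) (.and (.sameName 5 0)
    (.not (.ex 7 (.ex 8 (.ex 9 (.and (roleFact 7 8 9) (.and (sameExample 7 1) (.and (.sameName 8 1)
      (.and (.sameName 4 7) (.not (.tab 6 9 11)))))))))))))))

def predStep : Fm :=
  .ex 4 (.ex 5 (.ex 6 (.and (roleFact 4 5 6) (.and (sameExample 4 0) (.and (.sameName 6 0)
    (.not (.ex 7 (.ex 8 (.ex 9 (.and (roleFact 7 8 9) (.and (sameExample 7 1) (.and (.sameName 9 1)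
      (.and (.sameName 4 7) (.not (.tab 5 8 11)))))))))))))))

/-- Variables `0` and `1` hold the pair, `4` to `6` a fact about the first and `7` to `9` one about
the second individual, `10` is for positions in between and `11` for table lookups; `2` and `3` are
occupied by the counter of the rounds. -/
def step : DL → Fm
  | .ELbot => or (.tab 0 1 11) (or conceptStep succStep)
  | .ELIbot => or (.tab 0 1 11) (or conceptStep (or succStep predStep))

/-- Evaluated after the iteration, so `2` and `3` are free again and hold the labels of the two
examples. -/
def final : Fm :=
  all 2 (imp (.sym (· == .negMark) 2) (.ex 0 (.and (.sym (· == .comma) 0) (.and (inExample 2 0)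
    (all 1 (imp (.sym (· == .comma) 1) (imp (.ex 3 (.and (.sym (· == .posMark) 3) (inExample 3 1)))
      (.tab 0 1 11))))))))

theorem eval_conceptStep : conceptStep.eval w T v ↔ ConceptStep w (v 0) (v 1) := by
  simp [conceptStep, eval, eval_conceptFact, eval_sameExample, ConceptStep]

theorem eval_succStep : succStep.eval w T v ↔ SuccStep w T (v 0) (v 1) := by
  simp [succStep, eval, eval_roleFact, eval_sameExample, SuccStep]

theorem eval_predStep : predStep.eval w T v ↔ PredStep w T (v 0) (v 1) := by
  simp [predStep, eval, eval_roleFact, eval_sameExample, PredStep]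

theorem eval_step (L : DL) : (step L).eval w T v ↔ Step L w T (v 0) (v 1) := by
  cases L <;> simp [step, eval_or, eval_conceptStep, eval_succStep, eval_predStep, eval, Step]

theorem eval_final : final.eval w T v ↔ Final w T := by
  simp [final, eval, eval_all, eval_imp, eval_inExample, Final, At]

end Fm

end OntologyFitting

theorem mainTheorem12 (L : OntologyFitting.DL) :
    OntologyFitting.InPTime (OntologyFitting.ConsistentFittingProblem L) := by
  have h := OntologyFitting.inPTime_of_formulas (φ := .step L) (ψ := .final) (P := 0) (Q := 1)
    (R := 2) (R' := 3) (by decide) (by decide) (by decide) (by decide) (by decide) (by decide)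
    (by cases L <;> decide) (by decide) (fun _ _ _ => OntologyFitting.Fm.eval_step L)
    (fun _ _ _ => OntologyFitting.Fm.eval_final)
  refine Eq.mpr (congrArg OntologyFitting.InPTime ?_) h
  exact Set.ext fun w => OntologyFitting.mem_fittingProblem_iff L w
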